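/- Let $F$ be a field of characteristic $\neq 2$ and let $A$ be an $F$-algebra (not assumed commutative, associative or unital). For $a\in A$ and $\mu,\nu\in F$ put $A_{\mu,\nu}(a)=\{x: ax=\mu x,\ xa=\nu x\}$, $A_1(a)=A_{1,1}(a)$, $A_0(a)=A_{0,0}(a)$. An axis is an idempotent $a$ such that left multiplication $L_a$ and right multiplication $R_a$ are both diagonalizable (that is, $A$ is the direct sum of the eigenspaces of each) and $L_aR_a=R_aL_a$; it is weakly primitive if $A_1(a)=Fa$. Let $S(a)$ be the set of pairs $(\mu,\nu)\ne(0,0),(1,1)$ with $\mu$ an eigenvalue of $L_a$ and $\nu$ of $R_a$; put $S^\circ(a)=\{(\mu,\nu)\in S(a): A_{\mu,\nu}(a)\ne0\}$ and $S^\dagger(a)=\{(\mu,\nu)\in S^\circ(a):\mu\neq\nu\}$. The axis $a$ satisfies the fusion rules if, with $E=A_1(a)+A_0(a)$: $EE\subseteq E$; $A_s(a)^2\subseteq E$, $E A_s(a)\subseteq A_s(a)$ and $A_s(a)E\subseteq A_s(a)$ for all $s\in S(a)$; and $A_s(a)A_t(a)=0$ for all $s\ne t$ in $S(a)$. Let $A$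 be noncommutative and generated by $a$ and $b$, where $a$ is a weakly primitive axis satisfying the fusion rules with $\dim A_0(a)\le 1$, and $b$ is an axis satisfying the fusion rules. Then $S=S^\circ(a)$ is finite. Write $b=\alpha a+b_0+\sum_{(\mu,\nu)\in S}b_{\mu,\nu}$ with $\alpha\in F$, $b_0\in A_0(a)$, $b_{\mu,\nu}\in A_{\mu,\nu}(a)$. One of the following holds. (i) $A_0(a)=0$; $\mu+\nu=1$ on $S$; $S^\dagger(a)\neq\emptyset$; $a$ and the $b_{\mu,\nu}$ form a basis of $A$; $b=a+\sum b_{\mu,\nu}$; and all products $b_{\mu,\nu}b_{\mu',\nu'}$ are $0$. (ii) $\dim A_0(a)=1$, and one of (a), (b) holds. (a) $\dim A_1(b)=2$; $\mu+\nu=1$ on $S$; $S^\dagger(a)\ne\emptyset$; $a$, $b_0$ and the $b_{\mu,\nu}$ form a basis of $A$; $b=a+b_0+\sum b_{\mu,\nu}$; $b_0^2=b_0$; and all $b_0b_{\mu,\nu}$, $b_{\mu,\nu}b_0$, $b_{\mu,\nu}b_{\mu',\nu'}$ are $0$. (b) $b$ is weakly primitive and $A$ is one of the following algebras. (E1, the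 $S$-exceptional algebra) $\mu+\nu=1$ on $S$; $a$, $b$ and the $b_{\mu,\nu}$ form a basis; $ab=\sum\mu b_{\mu,\nu}$, $ba=\sum\nu b_{\mu,\nu}$, $ab_{\mu,\nu}=\mu b_{\mu,\nu}=b_{\mu,\nu}b$, $b_{\mu,\nu}a=\nu b_{\mu,\nu}=bb_{\mu,\nu}$; all products $b_{\mu,\nu}b_{\mu',\nu'}$ are $0$. (E2) $(2,2)\in S$, $\mu+\nu=1$ on $T=S\setminus\{(2,2)\}$, $S^\dagger(a)\neq\emptyset$; $a$, $b_0$ and the $b_{\mu,\nu}$ form a basis; $b=a+b_0+\sum b_{\mu,\nu}$; $b_0^2=\frac32b_0$, $b_{2,2}^2=-\frac12b_0$, $b_0b_{2,2}=b_{2,2}b_0=-\frac32b_{2,2}$; on $T$, $b_0b_{\mu,\nu}=b_{\mu,\nu}b_0=b_{\mu,\nu}^2=0$; and $b_{\mu,\nu}b_{\mu',\nu'}=0$ for $(\mu,\nu)\neq(\mu',\nu')$. (E3) $(\frac12,\frac12)\in S$, $\mu+\nu=1$ on $S$, $S^\dagger(a)\neq\emptyset$; $a$, $b_0$ and the $b_{\mu,\nu}$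 form a basis; $b=a+b_0+\sum b_{\mu,\nu}$; $b_0^2=0$, $b_0b_{\mu,\nu}=b_{\mu,\nu}b_0=0$ on $S$, $b_{1/2,1/2}^2=b_0$, $b_{\mu,\nu}^2=0$ on $S^\dagger(a)$; and $b_{\mu,\nu}b_{\mu',\nu'}=0$ for $(\mu,\nu)\neq(\mu',\nu')$. Moreover, in case (b), write $a=\beta b+a_0+\sum_{(\rho,\xi)\in S^\circ(b)}a_{\rho,\xi}$ with $\beta\in F$, $a_0\in A_0(b)$, $a_{\rho,\xi}\in A_{\rho,\xi}(b)$ (and $a_{\rho,\xi}=0$ for $(\rho,\xi)\notin S^\circ(b)$). Then: every nonzero $A_{\rho,\xi}(b)$ has dimension $1$; $\alpha\neq\frac12\neq\beta$; for $(\mu,\nu)\in S^\dagger(a)$, $b_{\mu,\nu}^2=0$ and $\mu+\nu=1$; if $\alpha\ne0$ then $A_0(b)=Fw$ with $$w=\tfrac{(\alpha-1)^2}{\alpha}a+b_0+\sum_{(\mu,\mu)\in S}\Bigl(\tfrac{2\mu(2\alpha-1)}{\alpha}-1\Bigr)b_{\mu,\mu}+\sum_{(\mu,\nu)\in S^\dagger(a)}\tfrac{\alpha-1}{\alpha}b_{\mu,\nu};$$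 if $\beta\neq1$, then $A_{\mu,\mu}(a)=0$ for all $\mu\ne 0,1,\frac12$, either $A_{\frac12,\frac12}(a)=0$ or $A_{\frac12,\frac12}(a)=Fa_{\frac12,\frac12}$ with $a_{\frac12,\frac12}^2=0$, $\alpha=0$, $A_0(b)=F\bigl(a-\sum_{(\mu,\nu)\in S}(\mu+\nu)b_{\mu,\nu}\bigr)$, $bb_{\mu,\nu}=\nu b_{\mu,\nu}$ and $b_{\mu,\nu}b=\mu b_{\mu,\nu}$ for all $(\mu,\nu)\in S$, and $A$ is as in (E1); if $\beta=1$, then $\alpha=1$ and $A$ is as in (E2) or (E3). -/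

import Mathlib

/-! Axes, eigenspaces and fusion rules in algebras over a field that are not assumed to be
commutative, associative or unital, and the algebras of the classification. -/

noncomputable section

namespace WeakAxial

section Axes

variable (F : Type*) {A : Type*} [Field F] [NonUnitalNonAssocRing A] [Module F A]
  [IsScalarTower F A A] [SMulCommClass F A A]

/-- The two-sided eigenspace `A_{μ,ν}(a) = {x : a x = μ x, x a = ν x}`, for `s = (μ, ν)`. -/
def eig (a : A) (s : F × F) : Submodule F A :=
  Module.End.eigenspace (LinearMap.mulLeft F a) s.1 ⊓
    Module.End.eigenspace (LinearMap.mulRight F a) s.2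

/-- An axis: an idempotent `a` for which `A` is the sum of the eigenspaces of `L_a`, and also the
sum of those of `R_a` (such sums are automatically direct), with `L_a R_a = R_a L_a`. -/
structure IsAxis (a : A) : Prop where
  idem : a * a = a
  left : ⨆ μ : F, Module.End.eigenspace (LinearMap.mulLeft F a) μ = ⊤
  right : ⨆ ν : F, Module.End.eigenspace (LinearMap.mulRight F a) ν = ⊤
  comm : ∀ x : A, a * (x * a) = (a * x) * a

/-- The pairs `(μ, ν)` other than `(0,0)` and `(1,1)`, with `μ` a left eigenvalue and `ν` a right
eigenvalue of `a`. -/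
def pairs (a : A) : Set (F × F) :=
  {s | Module.End.HasEigenvalue (LinearMap.mulLeft F a) s.1 ∧
    Module.End.HasEigenvalue (LinearMap.mulRight F a) s.2 ∧ s ≠ (0, 0) ∧ s ≠ (1, 1)}

/-- `S°(a)`: the pairs whose two-sided eigenspace is nonzero. -/
def pairsO (a : A) : Set (F × F) := {s | s ∈ pairs F a ∧ eig F a s ≠ ⊥}

/-- `S†(a)`: the pairs `(μ, ν)` in `S°(a)` with `μ ≠ ν`. -/
def pairsDagger (a : A) : Set (F × F) := {s | s ∈ pairsO F a ∧ s.1 ≠ s.2}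

/-- The axis `a` is weakly primitive: `A_1(a) = F a`. -/
def WeaklyPrimitive (a : A) : Prop := eig F a (1, 1) = Submodule.span F {a}

/-- The even part `A_1(a) + A_0(a)`. -/
def evenPart (a : A) : Submodule F A := eig F a (1, 1) ⊔ eig F a (0, 0)

/-- The fusion rules for `a`. -/
structure FusionRules (a : A) : Prop where
  mul_of_ne : ∀ s ∈ pairs F a, ∀ t ∈ pairs F a, s ≠ t →
    ∀ x ∈ eig F a s, ∀ y ∈ eig F a t, x * y = 0
  mul_same : ∀ s ∈ pairs F a, ∀ x ∈ eig F a s, ∀ y ∈ eig F a s, x * y ∈ evenPart F a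
  even_mul_even : ∀ x ∈ evenPart F a, ∀ y ∈ evenPart F a, x * y ∈ evenPart F a
  even_mul : ∀ s ∈ pairs F a, ∀ x ∈ evenPart F a, ∀ y ∈ eig F a s, x * y ∈ eig F a s
  mul_even : ∀ s ∈ pairs F a, ∀ x ∈ eig F a s, ∀ y ∈ evenPart F a, x * y ∈ eig F a s

/-- `y = γ a + y₀ + ∑_{s ∈ S} v s` is the decomposition of `y` into components with respect to
the weakly primitive axis `a`, where `S = S°(a)` (so `γ`, `y₀`, `v s` are the `α_y`, `y_0`,
`y_{μ,ν}` of the theory); `v` is `0` outside `S`. -/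
structure IsDecomposition (a y : A) (S : Finset (F × F)) (γ : F) (y₀ : A) (v : F × F → A) :
    Prop where
  index : (S : Set (F × F)) = pairsO F a
  zero_part : y₀ ∈ eig F a (0, 0)
  part : ∀ s ∈ S, v s ∈ eig F a s
  off : ∀ s, s ∉ S → v s = 0
  eq_sum : y = γ • a + y₀ + ∑ s ∈ S, v s

/-- The family `x` is a basis of the vector space `A`. -/
def IsBasisOf {ι : Type*} (x : ι → A) : Prop :=
  LinearIndependent F x ∧ Submodule.span F (Set.range x) = ⊤

end Axes

section Algebras

variable {F : Type*} {A : Type*} [Field F] [NonUnitalNonAssocRing A] [Module F A]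

/-- The algebra with basis `a`, `v s` (`s ∈ S`), where `μ + ν = 1` on `S`, some `(μ, ν) ∈ S` has
`μ ≠ ν`, all products `v s * v t` vanish, and `b = a + ∑ v s`. -/
structure IsNull (a b : A) (S : Finset (F × F)) (v : F × F → A) : Prop where
  sum_one : ∀ s ∈ S, s.1 + s.2 = 1
  dagger : ∃ s ∈ S, s.1 ≠ s.2
  basis : IsBasisOf F (fun o : Option S => o.elim a (fun s => v s))
  b_eq : b = a + ∑ s ∈ S, v s
  a_mul_a : a * a = a
  a_mul : ∀ s ∈ S, a * v s = s.1 • v s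
  mul_a : ∀ s ∈ S, v s * a = s.2 • v s
  mul : ∀ s ∈ S, ∀ t ∈ S, v s * v t = 0

/-- The `S`-exceptional algebra: basis `a`, `b`, `v s` (`s ∈ S`), where `μ + ν = 1` on `S`. -/
structure IsExceptional (a b : A) (S : Finset (F × F)) (v : F × F → A) : Prop where
  sum_one : ∀ s ∈ S, s.1 + s.2 = 1
  basis : IsBasisOf F (Sum.elim ![a, b] (fun s : S => v s))
  a_mul_a : a * a = a
  b_mul_b : b * b = b
  a_mul_b : a * b = ∑ s ∈ S, s.1 • v s
  b_mul_a : b * a = ∑ s ∈ S, s.2 • v s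
  a_mul : ∀ s ∈ S, a * v s = s.1 • v s
  mul_b : ∀ s ∈ S, v s * b = s.1 • v s
  mul_a : ∀ s ∈ S, v s * a = s.2 • v s
  b_mul : ∀ s ∈ S, b * v s = s.2 • v s
  mul : ∀ s ∈ S, ∀ t ∈ S, v s * v t = 0

/-- The common part of the next three multiplication tables: `a`, `b₀`, `v s` (`s ∈ S`) is a
basis of eigenvectors of the idempotent `a`, different `v s`, `v t` have product zero, some
`(μ, ν) ∈ S` has `μ ≠ ν`, and `b = a + b₀ + ∑ v s`. -/
structure IsTable (a b : A) (S : Finset (F × F)) (b₀ : A) (v : F × F → A) : Prop where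
  basis : IsBasisOf F (Sum.elim ![a, b₀] (fun s : S => v s))
  dagger : ∃ s ∈ S, s.1 ≠ s.2
  b_eq : b = a + b₀ + ∑ s ∈ S, v s
  a_mul_a : a * a = a
  a_mul_b₀ : a * b₀ = 0
  b₀_mul_a : b₀ * a = 0
  a_mul : ∀ s ∈ S, a * v s = s.1 • v s
  mul_a : ∀ s ∈ S, v s * a = s.2 • v s
  mul_of_ne : ∀ s ∈ S, ∀ t ∈ S, s ≠ t → v s * v t = 0

/-- `μ + ν = 1` on `S`, `b₀` is an idempotent, `b₀ v s = v s b₀ = 0` and `(v s)² = 0`. In this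
algebra `A_1(b)` is two-dimensional. -/
structure IsTwoDimOne (a b : A) (S : Finset (F × F)) (b₀ : A) (v : F × F → A) : Prop
    extends IsTable a b S b₀ v where
  sum_one : ∀ s ∈ S, s.1 + s.2 = 1
  b₀_mul_b₀ : b₀ * b₀ = b₀
  b₀_mul : ∀ s ∈ S, b₀ * v s = 0
  mul_b₀ : ∀ s ∈ S, v s * b₀ = 0
  sq : ∀ s ∈ S, v s * v s = 0

/-- `S = T ∪ {(2,2)}` with `μ + ν = 1` on `T = S \ {(2,2)}`; `b₀² = (3/2) b₀`,
`v_{2,2}² = -(1/2) b₀`, `b₀ v_{2,2} = v_{2,2} b₀ = -(3/2) v_{2,2}`, and on `T` one has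
`b₀ v s = v s b₀ = 0` and `(v s)² = 0`. -/
structure IsTypeTwo (a b : A) (S : Finset (F × F)) (b₀ : A) (v : F × F → A) : Prop
    extends IsTable a b S b₀ v where
  two_mem : ((2, 2) : F × F) ∈ S
  sum_one : ∀ s ∈ S, s ≠ (2, 2) → s.1 + s.2 = 1
  b₀_mul_b₀ : b₀ * b₀ = (3 / 2 : F) • b₀
  b₀_mul_two : b₀ * v (2, 2) = (-(3 / 2) : F) • v (2, 2)
  two_mul_b₀ : v (2, 2) * b₀ = (-(3 / 2) : F) • v (2, 2)
  two_sq : v (2, 2) * v (2, 2) = (-(1 / 2) : F) • b₀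
  b₀_mul : ∀ s ∈ S, s ≠ (2, 2) → b₀ * v s = 0
  mul_b₀ : ∀ s ∈ S, s ≠ (2, 2) → v s * b₀ = 0
  sq : ∀ s ∈ S, s ≠ (2, 2) → v s * v s = 0

/-- `μ + ν = 1` on `S`, which contains `(1/2,1/2)`; `b₀² = 0`, `b₀ v s = v s b₀ = 0`,
`v_{1/2,1/2}² = b₀` and `(v s)² = 0` for the other `s ∈ S`. -/
structure IsTypeHalf (a b : A) (S : Finset (F × F)) (b₀ : A) (v : F × F → A) : Prop
    extends IsTable a b S b₀ v where
  half_mem : ((1 / 2, 1 / 2) : F × F) ∈ S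
  sum_one : ∀ s ∈ S, s.1 + s.2 = 1
  b₀_mul_b₀ : b₀ * b₀ = 0
  b₀_mul : ∀ s ∈ S, b₀ * v s = 0
  mul_b₀ : ∀ s ∈ S, v s * b₀ = 0
  half_sq : v (1 / 2, 1 / 2) * v (1 / 2, 1 / 2) = b₀
  sq : ∀ s ∈ S, s.1 ≠ s.2 → v s * v s = 0

end Algebras

section Finer

variable (F : Type*) {A : Type*} [Field F] [NonUnitalNonAssocRing A] [Module F A]
  [IsScalarTower F A A] [SMulCommClass F A A]

open Classical in
/-- The finer data when `b` is weakly primitive. Here `b = α a + b₀ + ∑_{s ∈ S} v s` and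
`a = β b + a₀ + ∑_{t ∈ T} w t` are the decompositions with respect to `a` and to `b`. -/
structure FinerData (a b : A) (S : Finset (F × F)) (α : F) (b₀ : A) (v : F × F → A)
    (β : F) (w : F × F → A) : Prop where
  dim_one : ∀ s : F × F, eig F b s ≠ ⊥ → Module.finrank F (eig F b s) = 1
  α_ne_half : α ≠ 1 / 2
  β_ne_half : β ≠ 1 / 2
  sq : ∀ s ∈ pairsDagger F a, v s * v s = 0
  sum_one : ∀ s ∈ pairsDagger F a, s.1 + s.2 = 1
  zero_eig : α ≠ 0 → eig F b (0, 0) = Submodule.span F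
    {((α - 1) ^ 2 / α) • a + b₀
      + ∑ s ∈ S with s.1 = s.2, ((s.1 + s.2) * (2 * α - 1) / α - 1) • v s
      + ∑ s ∈ S with s.1 ≠ s.2, ((α - 1) / α) • v s}
  β_ne_one : β ≠ 1 →
    (∀ s ∈ pairsO F a, s.1 = s.2 → s = (1 / 2, 1 / 2)) ∧
    (eig F a (1 / 2, 1 / 2) = ⊥ ∨
      (eig F a (1 / 2, 1 / 2) = Submodule.span F {w (1 / 2, 1 / 2)} ∧
        w (1 / 2, 1 / 2) * w (1 / 2, 1 / 2) = 0)) ∧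
    α = 0 ∧
    eig F b (0, 0) = Submodule.span F {a - ∑ s ∈ S, (s.1 + s.2) • v s} ∧
    (∀ s ∈ S, b * v s = s.2 • v s ∧ v s * b = s.1 • v s) ∧
    IsExceptional a b S v
  β_eq_one : β = 1 → α = 1 ∧ (IsTypeTwo a b S b₀ v ∨ IsTypeHalf a b S b₀ v)

end Finer

end WeakAxial

end

noncomputable section

namespace WeakAxial

/-! ### Direct sums of subspaces and their projections -/

section Projections

variable {ι F A : Type*} [Field F] [AddCommGroup A] [Module F A]

/-! Split `b = α a + b₀ + ∑ v s` along `a`, with `s = (μ, ν)`. The even part of `a` is spanned by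
`a` and a generator of `A_0(a)`, so it is commutative. The identities `b² = b`, `b (a b) = (b a) b`
and `b (v s b) = (b v s) b`, read component by component, make each `v s` an eigenvector for left
and right multiplication by `α a + b₀`; only `μ + ν = 0` needs more, namely the fusion rules of `b`
(`IsSplit.exists_eigenvalue`). If `b₀ = 0`, these relations and noncommutativity already give case
(i) (`IsSplit.isNull`). Otherwise `a`, `b₀`, `v s` form a basis, and the product is given by
scalars: `b₀ v s = p v s`, `v s b₀ = q v s`, `(v s)² = φ a + ψ b₀`, `b₀² = ε a + ω b₀` (`Frame`).

From then on the leverage is on `b`. Its multiplications are diagonalizable, so nilpotent parts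
vanish, and its even part is commuted with and acted on idempotently by `b`. Semisimplicity of `L_b
- R_b` forces `(v s)² = 0` when `μ ≠ ν` (`sq_dagger`), and noncommutativity supplies such an `s`.
This `v s` is then an eigenvector of `b` with unequal eigenvalues and serves as a probe.

If `α ≠ 1`, the probe shows that odd eigenvectors of `b` have no `a`- and `b₀`-coordinates; hence
all `(v s)²` vanish and `α = 0` (`sq_eq_zero`, `alpha_eq_zero`). Squaring a vector of `A_0(b)`
yields `μ + ν = 1`, the exceptional algebra.

If `α = 1`, squares of eigenvectors of `b` force `μ + ν = 1` off the diagonal (`dagger_sum_one`),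
and the `a`-coordinate becomes a character. Its kernel contains a nonzero even vector of `b`
(`exists_evenVector`), whose square being even leaves at most one label with `p ≠ 0`. If there is
none, then `ω` is `1` or `0`, giving the two-dimensional `A_1(b)` or (E3). If there is one, `b` acts
on the plane of `b₀` and `v s` by a 2 × 2 matrix, and the fusion rules for its eigenvectors leave
only `s = (2, 2)`, which is (E2). -/

theorem exists_projections (E : ι → Submodule F A) (hi : iSupIndep E) (ht : ⨆ i, E i = ⊤) :
    ∃ π : ι → A →ₗ[F] A, (∀ i x, π i x ∈ E i) ∧ (∀ i, ∀ x ∈ E i, π i x = x) ∧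
      (∀ i j, i ≠ j → ∀ x ∈ E j, π i x = 0) := by
  have hc : ∀ i, IsCompl (E i) (⨆ j, ⨆ _ : j ≠ i, E j) := fun i =>
    ⟨hi i, codisjoint_iff_le_sup.2 (ht ▸ iSup_le fun j => by
      by_cases h : j = i
      · exact h ▸ le_sup_left
      · exact le_sup_of_le_right (le_iSup₂_of_le j h le_rfl))⟩
  refine ⟨fun i => (E i).projection _ (hc i), fun i x => Submodule.projection_apply_mem _ _,
    fun i x hx => Submodule.projection_apply_of_mem_left _ hx, fun i j hij x hx => ?_⟩
  exact (Submodule.projection_apply_eq_zero_iff (hc i)).2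
    (Submodule.mem_iSup_of_mem j (Submodule.mem_iSup_of_mem hij.symm hx))

theorem eq_top_of_iSup_le {E : ι → Submodule F A} (ht : ⨆ i, E i = ⊤) (W : Submodule F A)
    (h : ∀ i, ∀ x ∈ E i, x ∈ W) (x : A) : x ∈ W := by
  have : ⨆ i, E i ≤ W := iSup_le fun i x hx => h i x hx
  rw [ht] at this
  exact this trivial

/-- Asking for the identity on every larger `T` makes the condition additive: two elements can be
expanded over the union of their index sets. -/
theorem exists_finset_sum {E : ι → Submodule F A} (ht : ⨆ i, E i = ⊤) {π : ι → A →ₗ[F] A}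
    (hid : ∀ i, ∀ x ∈ E i, π i x = x) (h0 : ∀ i j, i ≠ j → ∀ x ∈ E j, π i x = 0) (x : A) :
    ∃ S : Finset ι, ∀ T : Finset ι, S ⊆ T → x = ∑ i ∈ T, π i x := by
  classical
  let W : Submodule F A :=
    { carrier := {x | ∃ S : Finset ι, ∀ T : Finset ι, S ⊆ T → x = ∑ i ∈ T, π i x}
      zero_mem' := ⟨∅, by simp⟩
      add_mem' := by
        rintro x y ⟨S, hS⟩ ⟨T, hT⟩
        refine ⟨S ∪ T, fun U hU => ?_⟩
        simp only [map_add, Finset.sum_add_distrib]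
        rw [← hS U (Finset.union_subset_left hU), ← hT U (Finset.union_subset_right hU)]
      smul_mem' := by
        rintro c x ⟨S, hS⟩
        refine ⟨S, fun U hU => ?_⟩
        simp only [map_smul, ← Finset.smul_sum]
        rw [← hS U hU] }
  refine eq_top_of_iSup_le ht W (fun i x hx => ⟨{i}, fun T hT => ?_⟩) x
  rw [Finset.sum_eq_single i, hid i x hx]
  · exact fun j _ hj => h0 j i hj x hx
  · exact fun h => absurd (hT (Finset.mem_singleton_self i)) h

end Projections

/-! ### Two-sided eigenspaces and the even part of an axis -/

section Eig

variable {F : Type*} {A : Type*} [Field F] [NonUnitalNonAssocRing A] [Module F A]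
  [IsScalarTower F A A] [SMulCommClass F A A]

theorem mem_eig {a x : A} {s : F × F} : x ∈ eig F a s ↔ a * x = s.1 • x ∧ x * a = s.2 • x := by
  simp [eig]

/-- Projections onto the two-sided eigenspaces of `a`. -/
structure IsProj (a : A) (π : F × F → A →ₗ[F] A) : Prop where
  mem : ∀ s x, π s x ∈ eig F a s
  id : ∀ {s x}, x ∈ eig F a s → π s x = x
  zero : ∀ {s t x}, x ∈ eig F a t → s ≠ t → π s x = 0
  top : ⨆ s, eig F a s = ⊤

/-- Because `L_a` and `R_a` commute, each preserves the eigenspaces of the other, so it commutes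
with the other's spectral projections. The composite of a left and a right projection therefore
lands in the two-sided eigenspace. -/
theorem IsAxis.exists_isProj {a : A} (ha : IsAxis F a) : ∃ π, IsProj (F := F) a π := by
  obtain ⟨πL, hLm, hLid, hL0⟩ := exists_projections _
    (Module.End.eigenspaces_iSupIndep (LinearMap.mulLeft F a)) ha.left
  obtain ⟨πR, hRm, hRid, hR0⟩ := exists_projections _
    (Module.End.eigenspaces_iSupIndep (LinearMap.mulRight F a)) ha.right
  have hcL : ∀ ν x, πR ν (a * x) = a * πR ν x := by
    intro ν x
    refine eq_top_of_iSup_le ha.right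
      (LinearMap.eqLocus (πR ν ∘ₗ LinearMap.mulLeft F a) (LinearMap.mulLeft F a ∘ₗ πR ν)) ?_ x
    intro ν' y hy
    have hay : a * y ∈ Module.End.eigenspace (LinearMap.mulRight F a) ν' := by
      rw [Module.End.mem_eigenspace_iff] at hy ⊢
      simp only [LinearMap.mulRight_apply] at hy ⊢
      rw [← ha.comm, hy, mul_smul_comm]
    by_cases h : ν = ν'
    · subst h
      simp [hRid ν y hy, hRid ν _ hay]
    · simp [hR0 ν ν' h y hy, hR0 ν ν' h _ hay]
  have hcR : ∀ μ x, πL μ (x * a) = πL μ x * a := by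
    intro ν x
    refine eq_top_of_iSup_le ha.left
      (LinearMap.eqLocus (πL ν ∘ₗ LinearMap.mulRight F a) (LinearMap.mulRight F a ∘ₗ πL ν)) ?_ x
    intro ν' y hy
    have hay : y * a ∈ Module.End.eigenspace (LinearMap.mulLeft F a) ν' := by
      rw [Module.End.mem_eigenspace_iff] at hy ⊢
      simp only [LinearMap.mulLeft_apply] at hy ⊢
      rw [ha.comm, hy, smul_mul_assoc]
    by_cases h : ν = ν'
    · subst h
      simp [hLid ν y hy, hLid ν _ hay]
    · simp [hL0 ν ν' h y hy, hL0 ν ν' h _ hay]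
  have hmem : ∀ s x, πR s.2 (πL s.1 x) ∈ eig F a s := by
    intro s x
    have h1 := hLm s.1 x
    have h2 := hRm s.2 (πL s.1 x)
    rw [Module.End.mem_eigenspace_iff, LinearMap.mulLeft_apply] at h1
    rw [Module.End.mem_eigenspace_iff, LinearMap.mulRight_apply] at h2
    rw [mem_eig]
    exact ⟨by rw [← hcL, h1, map_smul], h2⟩
  refine ⟨fun s => πR s.2 ∘ₗ πL s.1, hmem, fun {s x} hx => ?_, fun {s t x} hx hst => ?_, ?_⟩
  · simp [hLid _ _ hx.1, hRid _ _ hx.2]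
  · by_cases h : s.1 = t.1
    · have h2 : s.2 ≠ t.2 := fun h' => hst (Prod.ext h h')
      simp [h, hLid _ _ hx.1, hR0 _ _ h2 _ hx.2]
    · simp [hL0 _ _ h _ hx.1]
  · rw [eq_top_iff]
    intro x _
    obtain ⟨S, hS⟩ := exists_finset_sum ha.left hLid hL0 x
    rw [hS S subset_rfl]
    refine Submodule.sum_mem _ fun μ _ => ?_
    obtain ⟨T, hT⟩ := exists_finset_sum ha.right hRid hR0 (πL μ x)
    rw [hT T subset_rfl]
    exact Submodule.sum_mem _ fun ν _ => Submodule.mem_iSup_of_mem (μ, ν) (hmem (μ, ν) x)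

theorem IsProj.exists_sum {a : A} {π : F × F → A →ₗ[F] A} (h : IsProj a π) (x : A) :
    ∃ S : Finset (F × F), ∀ T : Finset (F × F), S ⊆ T → x = ∑ i ∈ T, π i x :=
  exists_finset_sum h.top (fun _ _ hx => h.id hx) (fun _ _ hij _ hx => h.zero hx hij) x

theorem IsProj.ext {a : A} {π : F × F → A →ₗ[F] A} (h : IsProj a π) {x y : A}
    (hxy : ∀ s, π s x = π s y) : x = y := by
  obtain ⟨S, hS⟩ := h.exists_sum (x - y)
  have := hS S subset_rfl
  rw [Finset.sum_eq_zero fun i _ => by rw [map_sub, hxy, sub_self]] at this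
  exact sub_eq_zero.1 this

/-- To prove a linear condition everywhere, prove it on two-sided eigenvectors of an axis. -/
theorem IsAxis.induction {a : A} (ha : IsAxis F a) (W : Submodule F A)
    (h : ∀ s, ∀ x ∈ eig F a s, x ∈ W) (x : A) : x ∈ W := by
  obtain ⟨π, hπ⟩ := ha.exists_isProj
  exact eq_top_of_iSup_le hπ.top W h x

theorem mem_pairs {a x : A} {s : F × F} (hx : x ∈ eig F a s) (h0 : x ≠ 0) (hs0 : s ≠ (0, 0))
    (hs1 : s ≠ (1, 1)) : s ∈ pairs F a :=
  ⟨Module.End.hasEigenvalue_of_hasEigenvector ⟨hx.1, h0⟩,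
    Module.End.hasEigenvalue_of_hasEigenvector ⟨hx.2, h0⟩, hs0, hs1⟩

theorem FusionRules.mul_eq_zero {a : A} (hf : FusionRules F a) {x y : A} {s t : F × F}
    (hx : x ∈ eig F a s) (hy : y ∈ eig F a t) (hst : s ≠ t) (hs0 : s ≠ (0, 0))
    (hs1 : s ≠ (1, 1)) (ht0 : t ≠ (0, 0)) (ht1 : t ≠ (1, 1)) : x * y = 0 := by
  by_cases h : x = 0
  · simp [h]
  by_cases h' : y = 0
  · simp [h']
  exact hf.mul_of_ne s (mem_pairs hx h hs0 hs1) t (mem_pairs hy h' ht0 ht1) hst x hx y hy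

theorem eig_one_le {a : A} : eig F a (1, 1) ≤ evenPart F a := le_sup_left

theorem eig_zero_le {a : A} : eig F a (0, 0) ≤ evenPart F a := le_sup_right

/-- Squares of eigenvectors on the diagonal lie in the even part. -/
theorem FusionRules.sq_mem {a : A} (hf : FusionRules F a) {x y : A} {s : F × F}
    (hx : x ∈ eig F a s) (hy : y ∈ eig F a s) : x * y ∈ evenPart F a := by
  by_cases hs0 : s = (0, 0)
  · exact hf.even_mul_even _ (eig_zero_le (hs0 ▸ hx)) _ (eig_zero_le (hs0 ▸ hy))
  by_cases hs1 : s = (1, 1)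
  · exact hf.even_mul_even _ (eig_one_le (hs1 ▸ hx)) _ (eig_one_le (hs1 ▸ hy))
  by_cases h : x = 0
  · simp [h]
  exact hf.mul_same s (mem_pairs hx h hs0 hs1) x hx y hy

/-- An operator `p L_a + q R_a - c` is semisimple. -/
theorem IsAxis.semisimple {a : A} (ha : IsAxis F a) (T : A →ₗ[F] A) (p q c : F)
    (hT : ∀ x, T x = p • (a * x) + q • (x * a) - c • x) {x : A} (hx : T (T x) = 0) : T x = 0 := by
  obtain ⟨π, hπ⟩ := ha.exists_isProj
  have hTs : ∀ (s : F × F), ∀ x ∈ eig F a s, T x = (p * s.1 + q * s.2 - c) • x := by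
    intro s x hx
    rw [mem_eig] at hx
    rw [hT, hx.1, hx.2]
    module
  have hcomm : ∀ s x, π s (T x) = T (π s x) := by
    intro s x
    refine ha.induction (LinearMap.eqLocus (π s ∘ₗ T) (T ∘ₗ π s)) (fun t y hy => ?_) x
    by_cases h : s = t
    · subst h
      simp [hTs s y hy, hπ.id hy]
    · simp [hTs t y hy, hπ.zero hy h]
  apply hπ.ext
  intro s
  have h1 : T (T (π s x)) = 0 := by rw [← hcomm, ← hcomm, hx, map_zero]
  rw [hcomm, map_zero]
  rw [hTs s _ (hπ.mem s x), map_smul, hTs s _ (hπ.mem s x)] at h1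
  rw [hTs s _ (hπ.mem s x)]
  rcases smul_eq_zero.1 h1 with h | h
  · rw [h, zero_smul]
  · exact h

/-- The even part consists of the sums of a `1`-eigenvector and a `0`-eigenvector. -/
theorem mem_evenPart {a x : A} :
    x ∈ evenPart F a ↔ ∃ y ∈ eig F a (1, 1), ∃ z ∈ eig F a (0, 0), y + z = x :=
  Submodule.mem_sup

theorem even_comm {a x : A} (hx : x ∈ evenPart F a) : a * x = x * a := by
  obtain ⟨y, hy, z, hz, rfl⟩ := mem_evenPart.1 hx
  rw [mem_eig] at hy hz
  rw [mul_add, add_mul, hy.1, hy.2, hz.1, hz.2]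

theorem even_mul_mul {a x : A} (hx : x ∈ evenPart F a) : a * (a * x) = a * x := by
  obtain ⟨y, hy, z, hz, rfl⟩ := mem_evenPart.1 hx
  rw [mem_eig] at hy hz
  simp [mul_add, hy.1, hz.1]

/-- A spanning set of eigenvectors with different labels determines the eigenspaces. -/
theorem eig_of_span {a : A} (ha : IsAxis F a) {w : A} {T : Finset (F × F)} {e : F × F → A}
    (ha1 : a ∈ eig F a (1, 1)) (hw : w ∈ eig F a (0, 0)) (he : ∀ s ∈ T, e s ∈ eig F a s)
    (hT0 : ∀ s ∈ T, s ≠ (0, 0)) (hT1 : ∀ s ∈ T, s ≠ (1, 1))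
    (hspan : ∀ x, ∃ (p q : F) (k : F × F → F), x = p • a + q • w + ∑ s ∈ T, k s • e s) :
    eig F a (1, 1) = Submodule.span F {a} ∧ eig F a (0, 0) = Submodule.span F {w} ∧
    (∀ s ∈ T, eig F a s = Submodule.span F {e s}) ∧
    (∀ s, s ∉ T → s ≠ (0, 0) → s ≠ (1, 1) → eig F a s = ⊥) := by
  obtain ⟨π, hπ⟩ := ha.exists_isProj
  have h01 : ((0, 0) : F × F) ≠ (1, 1) := by simp
  refine ⟨le_antisymm ?_ ?_, le_antisymm ?_ ?_, fun s hs => le_antisymm ?_ ?_,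
    fun s hs hs0 hs1 => ?_⟩
  · intro x hx
    obtain ⟨p, q, k, hk⟩ := hspan x
    have h := hπ.id hx
    rw [hk] at h
    simp only [map_add, map_smul, map_sum, hπ.id ha1, hπ.zero hw h01.symm] at h
    rw [Finset.sum_eq_zero fun t ht => by
      rw [hπ.zero (he t ht) (hT1 t ht).symm, smul_zero]] at h
    rw [hk, ← h]
    simpa using Submodule.smul_mem _ _ (Submodule.mem_span_singleton_self a)
  · simpa [Submodule.span_le] using ha1
  · intro x hx
    obtain ⟨p, q, k, hk⟩ := hspan x
    have h := hπ.id hx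
    rw [hk] at h
    simp only [map_add, map_smul, map_sum, hπ.id hw, hπ.zero ha1 h01] at h
    rw [Finset.sum_eq_zero fun t ht => by
      rw [hπ.zero (he t ht) (hT0 t ht).symm, smul_zero]] at h
    rw [hk, ← h]
    simpa using Submodule.smul_mem _ _ (Submodule.mem_span_singleton_self w)
  · simpa [Submodule.span_le] using hw
  · intro x hx
    obtain ⟨p, q, k, hk⟩ := hspan x
    have h := hπ.id hx
    rw [hk] at h
    simp only [map_add, map_smul, map_sum, hπ.zero ha1 (hT1 s hs), hπ.zero hw (hT0 s hs)] at h
    rw [Finset.sum_eq_single s (fun t ht hts => by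
      rw [hπ.zero (he t ht) hts.symm, smul_zero]) (fun h => absurd hs h),
      hπ.id (he s hs)] at h
    rw [hk, ← h]
    simpa using Submodule.smul_mem _ _ (Submodule.mem_span_singleton_self (e s))
  · simpa [Submodule.span_le] using he s hs
  · rw [eq_bot_iff]
    intro x hx
    obtain ⟨p, q, k, hk⟩ := hspan x
    have h := hπ.id hx
    rw [hk] at h
    simp only [map_add, map_smul, map_sum, hπ.zero ha1 hs1, hπ.zero hw hs0] at h
    rw [Finset.sum_eq_zero fun t ht => by
      rw [hπ.zero (he t ht) (ne_of_mem_of_not_mem ht hs).symm, smul_zero]] at h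
    rw [hk, ← h]
    simp

theorem pairsO_of_span {a : A} (ha : IsAxis F a) {w : A} {T : Finset (F × F)} {e : F × F → A}
    (ha1 : a ∈ eig F a (1, 1)) (hw : w ∈ eig F a (0, 0)) (he : ∀ s ∈ T, e s ∈ eig F a s)
    (hne : ∀ s ∈ T, e s ≠ 0) (hT0 : ∀ s ∈ T, s ≠ (0, 0)) (hT1 : ∀ s ∈ T, s ≠ (1, 1))
    (hspan : ∀ x, ∃ (p q : F) (k : F × F → F), x = p • a + q • w + ∑ s ∈ T, k s • e s) :
    (T : Set (F × F)) = pairsO F a := by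
  obtain ⟨-, -, -, h⟩ := eig_of_span ha ha1 hw he hT0 hT1 hspan
  ext s
  refine ⟨fun hs => ⟨mem_pairs (he s hs) (hne s hs) (hT0 s hs) (hT1 s hs), fun hb => ?_⟩,
    fun hs => ?_⟩
  · have := he s hs
    rw [hb] at this
    exact hne s hs (by simpa using this)
  · by_contra hsT
    exact hs.2 (h s hsT hs.1.2.2.1 hs.1.2.2.2)

theorem finrank_eig_of_span {a : A} (ha : IsAxis F a) {w : A} {T : Finset (F × F)}
    {e : F × F → A}
    (ha1 : a ∈ eig F a (1, 1)) (hw : w ∈ eig F a (0, 0)) (he : ∀ s ∈ T, e s ∈ eig F a s)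
    (hT0 : ∀ s ∈ T, s ≠ (0, 0)) (hT1 : ∀ s ∈ T, s ≠ (1, 1))
    (hspan : ∀ x, ∃ (p q : F) (k : F × F → F), x = p • a + q • w + ∑ s ∈ T, k s • e s)
    (s : F × F) (hs : eig F a s ≠ ⊥) : Module.finrank F (eig F a s) = 1 := by
  obtain ⟨h1, h0, h2, h3⟩ := eig_of_span ha ha1 hw he hT0 hT1 hspan
  have key : ∀ x : A, eig F a s = Submodule.span F {x} → Module.finrank F (eig F a s) = 1 := by
    intro x hx
    rw [hx]
    refine finrank_span_singleton fun h => hs ?_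
    rw [hx, h, Submodule.span_zero_singleton]
  by_cases hsT : s ∈ T
  · exact key _ (h2 s hsT)
  by_cases hs0 : s = (0, 0)
  · subst hs0; exact key _ h0
  by_cases hs1 : s = (1, 1)
  · subst hs1; exact key _ h1
  exact absurd (h3 s hsT hs0 hs1) hs

/-- A spanning set closed under products modulo its span, whose span contains generators,
spans the algebra. -/
theorem span_eq_top_of_mul_mem {a b : A}
    (hgen : NonUnitalAlgebra.adjoin F ({a, b} : Set A) = ⊤) (X : Set A)
    (hX : ∀ x ∈ X, ∀ y ∈ X, x * y ∈ Submodule.span F X) (ha : a ∈ Submodule.span F X)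
    (hb : b ∈ Submodule.span F X) : Submodule.span F X = ⊤ := by
  have hmul : ∀ x ∈ Submodule.span F X, ∀ y ∈ Submodule.span F X, x * y ∈ Submodule.span F X := by
    intro x hx y hy
    induction hx using Submodule.span_induction with
    | zero => simp
    | add x x' _ _ h h' => rw [add_mul]; exact add_mem h h'
    | smul c x _ h => rw [smul_mul_assoc]; exact Submodule.smul_mem _ _ h
    | mem x hx =>
      induction hy using Submodule.span_induction with
      | zero => simp
      | add x x' _ _ h h' => rw [mul_add]; exact add_mem h h'
      | smul c x _ h => rw [mul_smul_comm]; exact Submodule.smul_mem _ _ h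
      | mem y hy => exact hX x hx y hy
  let B : NonUnitalSubalgebra F A :=
    { Submodule.span F X with mul_mem' := fun {x y} hx hy => hmul x hx y hy }
  have hB : NonUnitalAlgebra.adjoin F ({a, b} : Set A) ≤ B := by
    rw [NonUnitalAlgebra.adjoin_le_iff]
    rintro x (rfl | rfl)
    · exact ha
    · exact hb
  rw [hgen] at hB
  rw [eq_top_iff]
  intro x _
  exact hB (show x ∈ (⊤ : NonUnitalSubalgebra F A) from trivial)

theorem mul_comm_of_span {X : Set A} (hX : Submodule.span F X = ⊤)
    (h : ∀ x ∈ X, ∀ y ∈ X, x * y = y * x) (x y : A) : x * y = y * x := by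
  have hx : x ∈ Submodule.span F X := hX ▸ trivial
  have hy : y ∈ Submodule.span F X := hX ▸ trivial
  induction hx using Submodule.span_induction with
  | zero => simp
  | add x x' _ _ h h' => rw [add_mul, mul_add, h, h']
  | smul c x _ h => rw [smul_mul_assoc, mul_smul_comm, h]
  | mem x hx =>
    induction hy using Submodule.span_induction with
    | zero => simp
    | add x x' _ _ h h' => rw [add_mul, mul_add, h, h']
    | smul c x _ h => rw [smul_mul_assoc, mul_smul_comm, h]
    | mem y hy => exact h x hx y hy

end Eig

/-! ### The axis identities for `b`, component by component along `a` -/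

section Components

variable {F : Type*} {A : Type*} [Field F] [NonUnitalNonAssocRing A] [Module F A]
  [IsScalarTower F A A] [SMulCommClass F A A]

/-- The components `h` (even) and `v s` of an idempotent axis `b` with respect to the axis `a`,
where `h` has `a`-coefficient `α`. -/
structure IsSplit (a b : A) (S : Finset (F × F)) (α : F) (h : A) (v : F × F → A) : Prop where
  axis_a : IsAxis F a
  fus_a : FusionRules F a
  axis_b : IsAxis F b
  comm_even : ∀ x ∈ evenPart F a, ∀ y ∈ evenPart F a, x * y = y * x
  even : h ∈ evenPart F a
  a_mul_h : a * h = α • a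
  mem : ∀ s ∈ S, v s ∈ eig F a s
  ne : ∀ s ∈ S, v s ≠ 0
  off : ∀ s, s ∉ S → v s = 0
  ne_zero : ∀ s ∈ S, s ≠ (0, 0)
  ne_one : ∀ s ∈ S, s ≠ (1, 1)
  eq_sum : b = h + ∑ s ∈ S, v s

theorem IsAxis.mem_eig {a : A} (ha : IsAxis F a) : a ∈ eig F a (1, 1) := by
  rw [WeakAxial.mem_eig]; simp [ha.idem]

theorem IsAxis.mem_even {a : A} (ha : IsAxis F a) : a ∈ evenPart F a :=
  eig_one_le ha.mem_eig

theorem IsAxis.components_eq {a : A} (ha : IsAxis F a) {S : Finset (F × F)}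
    (h0 : ∀ s ∈ S, s ≠ (0, 0)) (h1 : ∀ s ∈ S, s ≠ (1, 1)) {e e' : A} {y y' : F × F → A}
    (he : e ∈ evenPart F a) (he' : e' ∈ evenPart F a) (hy : ∀ s ∈ S, y s ∈ eig F a s)
    (hy' : ∀ s ∈ S, y' s ∈ eig F a s) (h : e + ∑ s ∈ S, y s = e' + ∑ s ∈ S, y' s) :
    e = e' ∧ ∀ s ∈ S, y s = y' s := by
  obtain ⟨π, hπ⟩ := ha.exists_isProj
  have key : ∀ s ∈ S, y s = y' s := by
    intro s hs
    have h2 := congrArg (π s) h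
    have hez : ∀ x ∈ evenPart F a, π s x = 0 := by
      intro x hx
      obtain ⟨p, hp, q, hq, rfl⟩ := mem_evenPart.1 hx
      rw [map_add, hπ.zero hp (h1 s hs), hπ.zero hq (h0 s hs), add_zero]
    have hsum : ∀ z : F × F → A, (∀ s ∈ S, z s ∈ eig F a s) → π s (∑ t ∈ S, z t) = z s := by
      intro z hz
      rw [map_sum, Finset.sum_eq_single s (fun t ht hts => hπ.zero (hz t ht) hts.symm)
        (fun h => absurd hs h), hπ.id (hz s hs)]
    rwa [map_add, map_add, hez _ he, hez _ he', hsum y hy, hsum y' hy', zero_add, zero_add] at h2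
  refine ⟨?_, key⟩
  rw [Finset.sum_congr rfl key] at h
  exact add_right_cancel h

variable {a b h : A} {S : Finset (F × F)} {α : F} {v : F × F → A}

namespace IsSplit

theorem h_mul_a (H : IsSplit a b S α h v) : h * a = α • a := by
  rw [← H.a_mul_h]
  exact (even_comm H.even).symm

theorem mem_pairs (H : IsSplit a b S α h v) {s : F × F} (hs : s ∈ S) : s ∈ pairs F a :=
  WeakAxial.mem_pairs (H.mem s hs) (H.ne s hs) (H.ne_zero s hs) (H.ne_one s hs)

theorem a_mul (H : IsSplit a b S α h v) {s : F × F} (hs : s ∈ S) : a * v s = s.1 • v s :=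
  (mem_eig.1 (H.mem s hs)).1

theorem mul_a (H : IsSplit a b S α h v) {s : F × F} (hs : s ∈ S) : v s * a = s.2 • v s :=
  (mem_eig.1 (H.mem s hs)).2

theorem v_mul_of_ne (H : IsSplit a b S α h v) {s t : F × F} (hs : s ∈ S) (ht : t ∈ S)
    (hst : s ≠ t) : v s * v t = 0 :=
  H.fus_a.mul_of_ne s (H.mem_pairs hs) t (H.mem_pairs ht) hst _ (H.mem s hs) _ (H.mem t ht)

theorem sq_mem (H : IsSplit a b S α h v) {s : F × F} (hs : s ∈ S) : v s * v s ∈ evenPart F a :=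
  H.fus_a.sq_mem (H.mem s hs) (H.mem s hs)

theorem h_mul_mem (H : IsSplit a b S α h v) {s : F × F} (hs : s ∈ S) : h * v s ∈ eig F a s :=
  H.fus_a.even_mul s (H.mem_pairs hs) _ H.even _ (H.mem s hs)

theorem mul_h_mem (H : IsSplit a b S α h v) {s : F × F} (hs : s ∈ S) : v s * h ∈ eig F a s :=
  H.fus_a.mul_even s (H.mem_pairs hs) _ (H.mem s hs) _ H.even

theorem b_mul (H : IsSplit a b S α h v) {s : F × F} (hs : s ∈ S) {x : A} (hx : x ∈ eig F a s) :
    b * x = h * x + v s * x := by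
  rw [H.eq_sum, add_mul, Finset.sum_mul, Finset.sum_eq_single s]
  · exact fun t ht hts => H.fus_a.mul_of_ne t (H.mem_pairs ht) s (H.mem_pairs hs) hts _
      (H.mem t ht) _ hx
  · exact fun h => absurd hs h

theorem mul_b (H : IsSplit a b S α h v) {s : F × F} (hs : s ∈ S) {x : A} (hx : x ∈ eig F a s) :
    x * b = x * h + x * v s := by
  rw [H.eq_sum, mul_add, Finset.mul_sum, Finset.sum_eq_single s]
  · exact fun t ht hts => H.fus_a.mul_of_ne s (H.mem_pairs hs) t (H.mem_pairs ht) hts.symm _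
      hx _ (H.mem t ht)
  · exact fun h => absurd hs h

theorem a_mul_b (H : IsSplit a b S α h v) : a * b = α • a + ∑ s ∈ S, s.1 • v s := by
  rw [H.eq_sum, mul_add, Finset.mul_sum, H.a_mul_h]
  congr 1
  exact Finset.sum_congr rfl fun s hs => H.a_mul hs

theorem b_mul_a (H : IsSplit a b S α h v) : b * a = α • a + ∑ s ∈ S, s.2 • v s := by
  rw [H.eq_sum, add_mul, Finset.sum_mul, H.h_mul_a]
  congr 1
  exact Finset.sum_congr rfl fun s hs => H.mul_a hs

/-- The components of `b * b = b`. -/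
theorem idem (H : IsSplit a b S α h v) :
    h * h + ∑ s ∈ S, v s * v s = h ∧ ∀ s ∈ S, v s * h + h * v s = v s := by
  apply H.axis_a.components_eq H.ne_zero H.ne_one (S := S) (y := fun s => v s * h + h * v s)
  · exact add_mem (H.fus_a.even_mul_even _ H.even _ H.even)
      (Submodule.sum_mem _ fun s hs => H.sq_mem hs)
  · exact H.even
  · exact fun s hs => add_mem (H.mul_h_mem hs) (H.h_mul_mem hs)
  · exact H.mem
  · have h1 := H.axis_b.idem
    nth_rw 2 [H.eq_sum] at h1
    rw [mul_add, Finset.mul_sum, Finset.sum_congr rfl fun s hs => H.b_mul hs (H.mem s hs)] at h1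
    nth_rw 1 [H.eq_sum] at h1
    rw [add_mul, Finset.sum_mul, Finset.sum_add_distrib] at h1
    rw [← H.eq_sum]
    refine Eq.trans ?_ h1
    rw [Finset.sum_add_distrib]
    abel

/-- The components of `b * (a * b) = (b * a) * b`. -/
theorem comm_a (H : IsSplit a b S α h v) :
    ∑ s ∈ S, (s.1 - s.2) • (v s * v s) = 0 ∧
      ∀ s ∈ S, α • s.2 • v s + s.1 • (h * v s) = α • s.1 • v s + s.2 • (v s * h) := by
  have hl : b * (a * b) = (α • α • a + ∑ s ∈ S, s.1 • (v s * v s)) +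
      ∑ s ∈ S, (α • s.2 • v s + s.1 • (h * v s)) := by
    have h1 : ∀ s ∈ S, b * s.1 • v s = s.1 • (h * v s) + s.1 • (v s * v s) := fun s hs => by
      rw [mul_smul_comm, H.b_mul hs (H.mem s hs), smul_add]
    rw [H.a_mul_b, mul_add, mul_smul_comm, H.b_mul_a, Finset.mul_sum, Finset.sum_congr rfl h1,
      Finset.sum_add_distrib, Finset.sum_add_distrib, smul_add, Finset.smul_sum]
    abel
  have hr : (b * a) * b = (α • α • a + ∑ s ∈ S, s.2 • (v s * v s)) +
      ∑ s ∈ S, (α • s.1 • v s + s.2 • (v s * h)) := by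
    have h1 : ∀ s ∈ S, s.2 • v s * b = s.2 • (v s * h) + s.2 • (v s * v s) := fun s hs => by
      rw [smul_mul_assoc, H.mul_b hs (H.mem s hs), smul_add]
    rw [H.b_mul_a, add_mul, smul_mul_assoc, H.a_mul_b, Finset.sum_mul, Finset.sum_congr rfl h1,
      Finset.sum_add_distrib, Finset.sum_add_distrib, smul_add, Finset.smul_sum]
    abel
  have hev : ∀ k : F × F → F,
      α • α • a + ∑ s ∈ S, k s • (v s * v s) ∈ evenPart F a := fun k =>
    add_mem (Submodule.smul_mem _ _ (Submodule.smul_mem _ _ H.axis_a.mem_even))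
      (Submodule.sum_mem _ fun s hs => Submodule.smul_mem _ _ (H.sq_mem hs))
  obtain ⟨h1, h2⟩ := H.axis_a.components_eq H.ne_zero H.ne_one (hev fun s => s.1)
    (hev fun s => s.2)
    (fun s hs => add_mem (Submodule.smul_mem _ _ (Submodule.smul_mem _ _ (H.mem s hs)))
      (Submodule.smul_mem _ _ (H.h_mul_mem hs)))
    (fun s hs => add_mem (Submodule.smul_mem _ _ (Submodule.smul_mem _ _ (H.mem s hs)))
      (Submodule.smul_mem _ _ (H.mul_h_mem hs)))
    ((hl.symm.trans (H.axis_b.comm a)).trans hr)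
  refine ⟨?_, h2⟩
  rw [add_right_inj] at h1
  simp only [sub_smul, Finset.sum_sub_distrib, h1, sub_self]

/-- The components of `b * (v s * b) = (b * v s) * b`. -/
theorem comm_v (H : IsSplit a b S α h v) {s : F × F} (hs : s ∈ S) :
    v s * (v s * h) = (h * v s) * v s ∧
      ∀ t ∈ S, t ≠ s → v t * (v s * v s) = (v s * v s) * v t := by
  classical
  -- The term `h * (v s * h)` again has label `s`; the `if` assigns it to that component, so that
  -- the others show only `v t` against the square.
  have hl : b * (v s * b) = (v s * (v s * h) + h * (v s * v s)) +
      ∑ t ∈ S, (v t * (v s * v s) + if t = s then h * (v s * h) else 0) := by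
    rw [H.mul_b hs (H.mem s hs), mul_add, H.b_mul hs (H.mul_h_mem hs), Finset.sum_add_distrib,
      Finset.sum_ite_eq' S s, if_pos hs, H.eq_sum, add_mul, Finset.sum_mul]
    abel
  have hr : (b * v s) * b = ((h * v s) * v s + (v s * v s) * h) +
      ∑ t ∈ S, ((v s * v s) * v t + if t = s then (h * v s) * h else 0) := by
    rw [H.b_mul hs (H.mem s hs), add_mul, H.mul_b hs (H.h_mul_mem hs), Finset.sum_add_distrib,
      Finset.sum_ite_eq' S s, if_pos hs, H.eq_sum, mul_add, Finset.mul_sum]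
    abel
  have hl' : ∀ t ∈ S, (if t = s then h * (v s * h) else 0) ∈ eig F a t := by
    intro t ht
    split_ifs with hts
    · exact hts ▸ H.fus_a.even_mul s (H.mem_pairs hs) _ H.even _ (H.mul_h_mem hs)
    · exact zero_mem _
  have hr' : ∀ t ∈ S, (if t = s then (h * v s) * h else 0) ∈ eig F a t := by
    intro t ht
    split_ifs with hts
    · exact hts ▸ H.fus_a.mul_even s (H.mem_pairs hs) _ (H.h_mul_mem hs) _ H.even
    · exact zero_mem _
  obtain ⟨h1, h2⟩ := H.axis_a.components_eq H.ne_zero H.ne_one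
    (add_mem (H.fus_a.mul_same s (H.mem_pairs hs) _ (H.mem s hs) _ (H.mul_h_mem hs))
      (H.fus_a.even_mul_even _ H.even _ (H.sq_mem hs)))
    (add_mem (H.fus_a.mul_same s (H.mem_pairs hs) _ (H.h_mul_mem hs) _ (H.mem s hs))
      (H.fus_a.even_mul_even _ (H.sq_mem hs) _ H.even))
    (fun t ht => add_mem
      (H.fus_a.mul_even t (H.mem_pairs ht) _ (H.mem t ht) _ (H.sq_mem hs)) (hl' t ht))
    (fun t ht => add_mem
      (H.fus_a.even_mul t (H.mem_pairs ht) _ (H.sq_mem hs) _ (H.mem t ht)) (hr' t ht))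
    ((hl.symm.trans (H.axis_b.comm (v s))).trans hr)
  refine ⟨?_, fun t ht hts => ?_⟩
  · rw [H.comm_even _ H.even _ (H.sq_mem hs)] at h1
    exact add_right_cancel h1
  · have := h2 t ht
    simpa [hts] using this

/-- If the `v t` all have square zero, then `α ≠ 1/2`. -/
theorem false_of_sq (H : IsSplit a b S α h v) (hbf : FusionRules F b)
    (ha0 : a ≠ 0) (hα : 2 * α = 1) (hsq : ∀ t ∈ S, v t * v t = 0) : False := by
  -- This operator kills every `v t` when the squares vanish, and for `2 α = 1` it sends `a` into
  -- their span. Thus `Q (Q a) = 0`, and semisimplicity gives `Q a = 0`.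
  let Q : A →ₗ[F] A := LinearMap.mulLeft F b + LinearMap.mulRight F b - LinearMap.id
  have hQ : ∀ x, Q x = b * x + x * b - x := fun x => rfl
  have hQv : ∀ t ∈ S, Q (v t) = 0 := by
    intro t ht
    rw [hQ, H.b_mul ht (H.mem t ht), H.mul_b ht (H.mem t ht), hsq t ht, add_zero, add_zero,
      add_comm, H.idem.2 t ht, sub_self]
  have hQa : Q a = ∑ s ∈ S, (s.1 + s.2) • v s := by
    rw [hQ, H.b_mul_a, H.a_mul_b]
    simp only [add_smul, Finset.sum_add_distrib]
    have : a = α • a + α • a := by rw [← add_smul, ← two_mul, hα, one_smul]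
    nth_rw 3 [this]
    abel
  have hQQa : Q (Q a) = 0 := by
    rw [hQa, map_sum]
    exact Finset.sum_eq_zero fun t ht => by rw [map_smul, hQv t ht, smul_zero]
  have hQa0 : Q a = 0 := H.axis_b.semisimple Q 1 1 1 (fun x => by simp [hQ]) hQQa
  obtain ⟨π, hπ⟩ := H.axis_b.exists_isProj
  obtain ⟨T, hT⟩ := hπ.exists_sum a
  have hQπ : ∀ s x, Q (π s x) = (s.1 + s.2 - 1) • π s x := by
    intro s x
    have := mem_eig.1 (hπ.mem s x)
    rw [hQ, this.1, this.2]
    module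
  have hcomp : ∀ s, (s.1 + s.2 - 1) • π s a = 0 := by
    intro s
    have h1 : ∀ x, π s (Q x) = Q (π s x) := by
      intro x
      refine H.axis_b.induction (LinearMap.eqLocus (π s ∘ₗ Q) (Q ∘ₗ π s)) (fun t y hy => ?_) x
      have hy2 := mem_eig.1 hy
      have hQy : Q y = (t.1 + t.2 - 1) • y := by
        rw [hQ, hy2.1, hy2.2]; module
      by_cases h : s = t
      · subst h
        simp [hQy, hπ.id hy]
      · simp [hQy, hπ.zero hy h]
    rw [← hQπ, ← h1, hQa0, map_zero]
  -- All components of `a` along `b` have labels with `ρ + ξ = 1`, hence different from `(0,0)` and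
  -- `(1,1)`. Their products are even or zero, which makes `a = a * a` even for `b`.
  have hmul : ∀ s t, π s a * π t a ∈ evenPart F b := by
    intro s t
    by_cases hs : π s a = 0
    · simp [hs]
    by_cases ht : π t a = 0
    · simp [ht]
    have hs' := (smul_eq_zero.1 (hcomp s)).resolve_right hs
    have ht' := (smul_eq_zero.1 (hcomp t)).resolve_right ht
    have h0 : ∀ u : F × F, u.1 + u.2 - 1 = 0 → u ≠ (0, 0) := by
      rintro u hu rfl; simp at hu
    have h1 : ∀ u : F × F, u.1 + u.2 - 1 = 0 → u ≠ (1, 1) := by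
      rintro u hu rfl; simp at hu
    by_cases hst : s = t
    · subst hst
      exact hbf.sq_mem (hπ.mem s a) (hπ.mem s a)
    · rw [hbf.mul_eq_zero (hπ.mem s a) (hπ.mem t a) hst (h0 s hs') (h1 s hs') (h0 t ht')
        (h1 t ht')]
      exact zero_mem _
  have hae : a ∈ evenPart F b := by
    rw [← H.axis_a.idem, hT T subset_rfl, Finset.sum_mul_sum]
    exact Submodule.sum_mem _ fun s _ => Submodule.sum_mem _ fun t _ => hmul s t
  have h1 : b * a + b * a = a := by
    have : b * a + a * b - a = 0 := hQa0
    rw [← even_comm hae] at this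
    exact sub_eq_zero.1 this
  have h2 := even_mul_mul hae
  -- On the even part `L_b` is idempotent, which is incompatible with `2 (b * a) = a` unless `b * a
  -- = 0`.
  have h3 : b * a = 0 := by
    have h4 : b * (b * a + b * a) = b * a := by rw [h1]
    rw [mul_add, h2] at h4
    simpa using h4
  rw [h3] at h1
  exact ha0 (by simpa using h1.symm)

/-- `v s` is an eigenvector of left and right multiplication by the even part of `b`, provided
that the even part of the algebra is spanned by `a` and `h`. -/
theorem exists_eigenvalue (hchar : (2 : F) ≠ 0) (H : IsSplit a b S α h v)
    (hbf : FusionRules F b) (ha0 : a ≠ 0)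
    (hE : ∀ x ∈ evenPart F a, ∃ p q : F, x = p • a + q • h) {s : F × F} (hs : s ∈ S) :
    ∃ c : F, h * v s = c • v s := by
  have h2 := H.idem.2 s hs
  have h3 := H.comm_a.2 s hs
  have hR : v s * h = v s - h * v s := eq_sub_of_add_eq h2
  -- After `v s * h` is eliminated, the relation determines `(μ + ν) • (h * v s)`. It fails to
  -- settle the claim only for `μ + ν = 0`, and then it forces `2 α = 1`.
  by_cases hσ : s.1 + s.2 = 0
  · have hs2 : s.2 = -s.1 := by linear_combination hσ
    have hμ : s.1 ≠ 0 := by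
      intro h0
      apply H.ne_zero s hs
      rw [h0, neg_zero] at hs2
      exact Prod.ext h0 hs2
    have hα : 2 * α = 1 := by
      rw [hR, hs2] at h3
      have h4 : (s.1 * (1 - 2 * α)) • v s = 0 := by
        rw [← sub_eq_zero] at h3
        rw [← h3]
        module
      rcases mul_eq_zero.1 ((smul_eq_zero.1 h4).resolve_right (H.ne s hs)) with h5 | h5
      · exact absurd h5 hμ
      · linear_combination -h5
    -- If `v s` is not an eigenvector of `h`, commuting with `v s` forces every other square to
    -- vanish. The sum of the `(μ - ν) • v t * v t` then leaves only `v s * v s`, with the nonzero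
    -- coefficient `2 μ`, so all squares vanish, which is impossible for `2 α = 1`.
    by_contra hc
    push Not at hc
    refine H.false_of_sq hbf ha0 hα ?_
    have hsqt : ∀ t ∈ S, t ≠ s → v t * v t = 0 := by
      intro t ht hts
      obtain ⟨p, q, hpq⟩ := hE _ (H.sq_mem ht)
      have h4 := (H.comm_v ht).2 s hs hts.symm
      rw [hpq, mul_add, add_mul, mul_smul_comm, mul_smul_comm, smul_mul_assoc, smul_mul_assoc,
        H.mul_a hs, H.a_mul hs, hR, hs2] at h4
      have h5 : (2 * q) • (h * v s) = (q - 2 * p * s.1) • v s := by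
        rw [← sub_eq_zero] at h4 ⊢
        rw [← neg_eq_zero, ← h4]
        module
      have hq : q = 0 := by
        by_contra hq
        apply hc ((2 * q)⁻¹ * (q - 2 * p * s.1))
        rw [mul_smul, ← h5, smul_smul, inv_mul_cancel₀ (mul_ne_zero hchar hq), one_smul]
      rw [hq, mul_zero, zero_smul, zero_sub, eq_comm, smul_eq_zero] at h5
      have h6 := h5.resolve_right (H.ne s hs)
      have hp : p = 0 := by
        have : (2 * s.1) * p = 0 := by linear_combination -h6
        exact (mul_eq_zero.1 this).resolve_left (mul_ne_zero hchar hμ)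
      rw [hpq, hp, hq, zero_smul, zero_smul, add_zero]
    intro t ht
    by_cases hts : t = s
    · subst hts
      have h4 := H.comm_a.1
      rw [Finset.sum_eq_single t (fun u hu hut => by rw [hsqt u hu hut, smul_zero])
        (fun h => absurd hs h)] at h4
      refine (smul_eq_zero.1 h4).resolve_left ?_
      rw [hs2]
      intro h5
      exact mul_ne_zero hchar hμ (by linear_combination h5)
    · exact hsqt t ht hts
  · refine ⟨(s.1 + s.2)⁻¹ * (α * s.1 + s.2 - α * s.2), ?_⟩
    rw [hR] at h3
    have h4 : (s.1 + s.2) • (h * v s) = (α * s.1 + s.2 - α * s.2) • v s := by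
      rw [← sub_eq_zero] at h3 ⊢
      rw [← h3]
      module
    rw [mul_smul, ← h4, smul_smul, inv_mul_cancel₀ hσ, one_smul]

end IsSplit

end Components

/-! ### Bases from coefficient statements -/

section Basis

variable {F : Type*} {A : Type*} [Field F] [NonUnitalNonAssocRing A] [Module F A]

theorem isBasisOf_sum {x y : A} {S : Finset (F × F)} {v : F × F → A}
    (hind : ∀ (p q : F) (k : F × F → F), p • x + q • y + ∑ s ∈ S, k s • v s = 0 →
      p = 0 ∧ q = 0 ∧ ∀ s ∈ S, k s = 0)
    (hspan : ∀ z, ∃ (p q : F) (k : F × F → F), z = p • x + q • y + ∑ s ∈ S, k s • v s) :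
    IsBasisOf F (Sum.elim ![x, y] (fun s : S => v s)) := by
  classical
  constructor
  · rw [Fintype.linearIndependent_iff]
    intro g hg
    have h := hind (g (Sum.inl 0)) (g (Sum.inl 1))
      (fun s => if hs : s ∈ S then g (Sum.inr ⟨s, hs⟩) else 0) (by
        rw [← hg, Fintype.sum_sum_type, Fin.sum_univ_two, ← Finset.sum_coe_sort S]
        simp)
    rintro (i | ⟨s, hs⟩)
    · fin_cases i
      · exact h.1
      · exact h.2.1
    · simpa [hs] using h.2.2 s hs
  · rw [eq_top_iff]
    intro z _
    obtain ⟨p, q, k, rfl⟩ := hspan z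
    refine add_mem (add_mem ?_ ?_) (Submodule.sum_mem _ fun s hs => ?_)
    · exact Submodule.smul_mem _ _ (Submodule.subset_span ⟨Sum.inl 0, by simp⟩)
    · exact Submodule.smul_mem _ _ (Submodule.subset_span ⟨Sum.inl 1, by simp⟩)
    · exact Submodule.smul_mem _ _ (Submodule.subset_span ⟨Sum.inr ⟨s, hs⟩, by simp⟩)

theorem isBasisOf_option {x : A} {S : Finset (F × F)} {v : F × F → A}
    (hind : ∀ (p : F) (k : F × F → F), p • x + ∑ s ∈ S, k s • v s = 0 →
      p = 0 ∧ ∀ s ∈ S, k s = 0)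
    (hspan : ∀ z, ∃ (p : F) (k : F × F → F), z = p • x + ∑ s ∈ S, k s • v s) :
    IsBasisOf F (fun o : Option S => o.elim x (fun s => v s)) := by
  classical
  constructor
  · rw [Fintype.linearIndependent_iff]
    intro g hg
    have h := hind (g none)
      (fun s => if hs : s ∈ S then g (some ⟨s, hs⟩) else 0) (by
        rw [← hg, Fintype.sum_option, ← Finset.sum_coe_sort S]
        simp)
    rintro (_ | ⟨s, hs⟩)
    · exact h.1
    · simpa [hs] using h.2 s hs
  · rw [eq_top_iff]
    intro z _
    obtain ⟨p, k, rfl⟩ := hspan z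
    refine add_mem ?_ (Submodule.sum_mem _ fun s hs => ?_)
    · exact Submodule.smul_mem _ _ (Submodule.subset_span ⟨none, by simp⟩)
    · exact Submodule.smul_mem _ _ (Submodule.subset_span ⟨some ⟨s, hs⟩, by simp⟩)

theorem exists_coeffs {x y : A} {S : Finset (F × F)} {v : F × F → A}
    (h : Submodule.span F ({x, y} ∪ v '' S) = ⊤) (z : A) :
    ∃ (p q : F) (k : F × F → F), z = p • x + q • y + ∑ s ∈ S, k s • v s := by
  classical
  have hz : z ∈ Submodule.span F ({x, y} ∪ v '' S) := h ▸ trivial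
  induction hz using Submodule.span_induction with
  | zero => exact ⟨0, 0, 0, by simp⟩
  | add u w _ _ hu hw =>
    obtain ⟨p, q, k, rfl⟩ := hu
    obtain ⟨p', q', k', rfl⟩ := hw
    refine ⟨p + p', q + q', k + k', ?_⟩
    simp only [Pi.add_apply, add_smul, Finset.sum_add_distrib]
    abel
  | smul c u _ hu =>
    obtain ⟨p, q, k, rfl⟩ := hu
    refine ⟨c * p, c * q, c • k, ?_⟩
    simp only [smul_add, Finset.smul_sum, Pi.smul_apply, smul_eq_mul, mul_smul]
  | mem u hu =>
    rcases hu with (rfl | rfl) | ⟨s, hs, rfl⟩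
    · exact ⟨1, 0, 0, by simp⟩
    · exact ⟨0, 1, 0, by simp⟩
    · refine ⟨0, 0, Pi.single s 1, ?_⟩
      rw [Finset.sum_eq_single s (fun t _ hts => by simp [hts]) (fun h => absurd hs h)]
      simp

end Basis

/-! ### Splitting `b` along `a`; the case `b₀ = 0`; coordinates when `b₀ ≠ 0` -/

section Split

variable {F : Type*} {A : Type*} [Field F] [NonUnitalNonAssocRing A] [Module F A]
  [IsScalarTower F A A] [SMulCommClass F A A]

theorem exists_isSplit {a b : A} (ha : IsAxis F a) (hap : WeaklyPrimitive F a)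
    (haf : FusionRules F a) (ha0 : Module.rank F (eig F a (0, 0)) ≤ 1) (hb : IsAxis F b) :
    ∃ (S : Finset (F × F)) (α : F) (b₀ : A) (v : F × F → A), b₀ ∈ eig F a (0, 0) ∧
      IsSplit a b S α (α • a + b₀) v := by
  classical
  obtain ⟨π, hπ⟩ := ha.exists_isProj
  obtain ⟨T, hT⟩ := hπ.exists_sum b
  have h1 : π (1, 1) b ∈ Submodule.span F {a} := hap ▸ hπ.mem _ b
  obtain ⟨α, hα⟩ := Submodule.mem_span_singleton.1 h1
  obtain ⟨z, hz⟩ := (rank_submodule_le_one_iff' _).1 ha0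
  have h01 : ((0, 0) : F × F) ≠ (1, 1) := by simp
  set P : F × F → Prop := fun s => π s b ≠ 0 ∧ s ≠ (0, 0) ∧ s ≠ (1, 1) with hP
  refine ⟨T.filter P, α, π (0, 0) b, fun s => if s ∈ T.filter P then π s b else 0,
    hπ.mem _ b, ?_⟩
  have hb0 := mem_eig.1 (hπ.mem (0, 0) b)
  simp only [zero_smul] at hb0
  refine
    { axis_a := ha
      fus_a := haf
      axis_b := hb
      comm_even := ?_
      even := add_mem (Submodule.smul_mem _ _ ha.mem_even) (eig_zero_le (hπ.mem _ b))
      a_mul_h := ?_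
      mem := fun s hs => by simpa only [if_pos hs] using hπ.mem s b
      ne := fun s hs => by simpa only [if_pos hs] using (Finset.mem_filter.1 hs).2.1
      off := fun s hs => if_neg hs
      ne_zero := fun s hs => (Finset.mem_filter.1 hs).2.2.1
      ne_one := fun s hs => (Finset.mem_filter.1 hs).2.2.2
      eq_sum := ?_ }
  -- The rank bound enters here: elements of `A_0(a)` are multiples of one `z`, so they commute with
  -- each other, and `a` annihilates them on both sides.
  · have key : ∀ x ∈ evenPart F a, ∃ c d : F, ∃ y, c • a + y = x ∧ d • z = y ∧
        y ∈ eig F a (0, 0) := by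
      intro x hx
      obtain ⟨y, hy, w, hw, rfl⟩ := mem_evenPart.1 hx
      obtain ⟨c, rfl⟩ := Submodule.mem_span_singleton.1 (hap ▸ hy : y ∈ Submodule.span F {a})
      obtain ⟨d, hd⟩ := Submodule.mem_span_singleton.1 (hz hw)
      exact ⟨c, d, w, rfl, hd, hw⟩
    intro x hx y hy
    obtain ⟨c, d, x, rfl, hxz, hx⟩ := key x hx
    obtain ⟨c', d', y, rfl, hyz, hy⟩ := key y hy
    have hx' := mem_eig.1 hx
    have hy' := mem_eig.1 hy
    have hxy : x * y = y * x := by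
      rw [← hxz, ← hyz, smul_mul_assoc, mul_smul_comm, smul_mul_assoc, mul_smul_comm,
        smul_comm]
    simp only [zero_smul] at hx' hy'
    rw [add_mul, mul_add, mul_add, add_mul, mul_add, mul_add, hxy]
    simp only [smul_mul_assoc, mul_smul_comm, hx'.1, hx'.2, hy'.1, hy'.2, ha.idem, smul_zero,
      add_zero, zero_add]
    rw [smul_comm]
  · rw [mul_add, mul_smul_comm, ha.idem, hb0.1, add_zero]
  · have h2 := hT (T ∪ {(0, 0), (1, 1)}) Finset.subset_union_left
    conv_lhs => rw [h2]
    rw [hα]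
    have h3 : ∑ s ∈ T.filter P, (if s ∈ T.filter P then π s b else 0) =
        ∑ s ∈ T.filter P, π s b := Finset.sum_congr rfl fun s hs => if_pos hs
    rw [h3, ← Finset.sum_pair h01.symm (f := fun s => π s b), ← Finset.sum_union]
    · symm
      apply Finset.sum_subset_zero_on_sdiff
      · intro s hs
        simp only [Finset.mem_union, Finset.mem_filter, Finset.mem_insert,
          Finset.mem_singleton] at hs ⊢
        tauto
      · intro s hs
        simp only [Finset.mem_union, Finset.mem_filter, Finset.mem_insert, Finset.mem_sdiff,
          Finset.mem_singleton, hP] at hs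
        tauto
      · exact fun _ _ => rfl
    · rw [Finset.disjoint_left]
      intro s hs hs'
      simp only [Finset.mem_filter, Finset.mem_insert, Finset.mem_singleton, hP] at hs hs'
      tauto

variable {a b h b₀ : A} {S : Finset (F × F)} {α : F} {v : F × F → A}

namespace IsSplit

theorem independent (H : IsSplit a b S α h v) (ha0 : a ≠ 0) {z : A} (hz : z ∈ eig F a (0, 0))
    {p q : F} {k : F × F → F} (hk : p • a + q • z + ∑ s ∈ S, k s • v s = 0) :
    p = 0 ∧ q • z = 0 ∧ ∀ s ∈ S, k s = 0 := by
  obtain ⟨h1, h2⟩ := H.axis_a.components_eq H.ne_zero H.ne_one (e' := 0) (y' := 0)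
    (add_mem (Submodule.smul_mem _ p H.axis_a.mem_even)
      (Submodule.smul_mem _ q (eig_zero_le hz))) (zero_mem _)
    (fun s hs => Submodule.smul_mem _ (k s) (H.mem s hs)) (fun s _ => zero_mem _)
    (by simpa using hk)
  have h3 : p • a = 0 := by
    have := congrArg (a * ·) h1
    simpa [mul_add, mul_smul_comm, H.axis_a.idem, (mem_eig.1 hz).1] using this
  have h4 := (smul_eq_zero.1 h3).resolve_right ha0
  refine ⟨h4, by simpa [h4] using h1, fun s hs => ?_⟩
  exact (smul_eq_zero.1 (h2 s hs)).resolve_right (H.ne s hs)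

theorem pairsO_eq (H : IsSplit a b S α h v) {z : A} (hz : z ∈ eig F a (0, 0))
    (hspan : Submodule.span F ({a, z} ∪ v '' S) = ⊤) : (S : Set (F × F)) = pairsO F a :=
  pairsO_of_span H.axis_a H.axis_a.mem_eig hz H.mem H.ne H.ne_zero H.ne_one
    (exists_coeffs hspan)

/-- If `b` has no component in `A_0(a)`, the products of the `v s` vanish. -/
theorem isNull (H : IsSplit a b S α (α • a) v)
    (hgen : NonUnitalAlgebra.adjoin F ({a, b} : Set A) = ⊤)
    (hnc : ∃ x y : A, x * y ≠ y * x) (ha0 : a ≠ 0) :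
    eig F a (0, 0) = ⊥ ∧ (S : Set (F × F)) = pairsO F a ∧ α = 1 ∧ IsNull a b S v := by
  have hσ : ∀ s ∈ S, α * (s.1 + s.2) = 1 := by
    intro s hs
    have h2 := H.idem.2 s hs
    rw [mul_smul_comm, smul_mul_assoc, H.a_mul hs, H.mul_a hs, ← sub_eq_zero] at h2
    have h3 : (α * (s.1 + s.2) - 1) • v s = 0 := by rw [← h2]; module
    exact sub_eq_zero.1 ((smul_eq_zero.1 h3).resolve_right (H.ne s hs))
  have hα : ∀ s ∈ S, α ≠ 0 := by
    intro s hs h0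
    have := hσ s hs
    simp [h0] at this
  have hσ1 : ∀ s ∈ S, s.1 ≠ s.2 → α = 1 := by
    intro s hs hne
    have h2 := H.comm_a.2 s hs
    rw [mul_smul_comm, smul_mul_assoc, H.a_mul hs, H.mul_a hs, ← sub_eq_zero] at h2
    have h3 : (α * (s.1 - s.2) * (s.1 + s.2 - 1)) • v s = 0 := by rw [← h2]; module
    have h4 := (smul_eq_zero.1 h3).resolve_right (H.ne s hs)
    have h5 := (mul_eq_zero.1 h4).resolve_left (mul_ne_zero (hα s hs) (sub_ne_zero.2 hne))
    linear_combination hσ s hs - α * h5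
  have hsq0 : ∀ s ∈ S, s.1 ≠ s.2 → v s * v s = 0 := by
    intro s hs hne
    have h2 := (H.comm_v hs).1
    rw [mul_smul_comm, smul_mul_assoc, H.a_mul hs, H.mul_a hs, ← sub_eq_zero] at h2
    simp only [smul_mul_assoc, mul_smul_comm] at h2
    have h3 : (α * (s.2 - s.1)) • (v s * v s) = 0 := by rw [← h2]; module
    exact (smul_eq_zero.1 h3).resolve_left (mul_ne_zero (hα s hs) (sub_ne_zero.2 hne.symm))
  have hsq : ∀ s ∈ S, v s * v s = (α - α * α) • a ∨ v s * v s = 0 := by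
    intro s hs
    by_cases hne : s.1 ≠ s.2
    · exact Or.inr (hsq0 s hs hne)
    push Not at hne
    left
    -- A diagonal label satisfies `2 α μ = 1`, so at most one occurs; the even component of `b * b =
    -- b` then isolates its square.
    have h1 := H.idem.1
    rw [Finset.sum_eq_single s, smul_mul_assoc, mul_smul_comm, H.axis_a.idem] at h1
    · rw [sub_smul, mul_smul]
      exact eq_sub_of_add_eq' h1
    · intro t ht hts
      by_cases hnt : t.1 ≠ t.2
      · exact hsq0 t ht hnt
      push Not at hnt
      exfalso
      apply hts
      have h2 : 2 * α ≠ 0 := by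
        intro h0
        have := hσ s hs
        rw [hne] at this
        apply one_ne_zero (α := F)
        rw [← this]
        linear_combination s.2 * h0
      have h3 : t.1 = s.1 := by
        apply mul_left_cancel₀ h2
        linear_combination hσ t ht - hσ s hs + α * hnt - α * hne
      exact Prod.ext h3 (by rw [← hnt, ← hne, h3])
    · exact fun h => absurd hs h
  -- The `0` stands in the place of `b₀`, so that the two-vector form of `exists_coeffs` applies.
  have hX : Submodule.span F ({a, 0} ∪ v '' S) = ⊤ := by
    have hmem : ∀ x ∈ ({a, 0} : Set A) ∪ v '' S, x ∈ Submodule.span F ({a, 0} ∪ v '' S) :=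
      fun x hx => Submodule.subset_span hx
    have haX := hmem a (by simp)
    have hvX : ∀ s ∈ S, v s ∈ Submodule.span F ({a, 0} ∪ v '' S) := fun s hs =>
      hmem _ (Or.inr ⟨s, hs, rfl⟩)
    refine span_eq_top_of_mul_mem hgen _ ?_ haX ?_
    · rintro x ((rfl | rfl) | ⟨s, hs, rfl⟩) y ((rfl | rfl) | ⟨t, ht, rfl⟩)
      · rw [H.axis_a.idem]; exact haX
      · simp
      · rw [H.a_mul ht]; exact Submodule.smul_mem _ _ (hvX t ht)
      · simp
      · simp
      · simp
      · rw [H.mul_a hs]; exact Submodule.smul_mem _ _ (hvX s hs)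
      · simp
      · by_cases hst : s = t
        · subst hst
          rcases hsq s hs with h1 | h1 <;> rw [h1]
          · exact Submodule.smul_mem _ _ haX
          · exact zero_mem _
        · rw [H.v_mul_of_ne hs ht hst]; exact zero_mem _
    · rw [H.eq_sum]
      exact add_mem (Submodule.smul_mem _ _ haX) (Submodule.sum_mem _ hvX)
  have hdag : ∃ s ∈ S, s.1 ≠ s.2 := by
    by_contra hcon
    push Not at hcon
    obtain ⟨x, y, hxy⟩ := hnc
    refine hxy (mul_comm_of_span hX ?_ x y)
    rintro x ((rfl | rfl) | ⟨s, hs, rfl⟩) y ((rfl | rfl) | ⟨t, ht, rfl⟩)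
    · rfl
    · simp
    · rw [H.a_mul ht, H.mul_a ht, hcon t ht]
    · simp
    · simp
    · simp
    · rw [H.a_mul hs, H.mul_a hs, hcon s hs]
    · simp
    · by_cases hst : s = t
      · rw [hst]
      · rw [H.v_mul_of_ne hs ht hst, H.v_mul_of_ne ht hs (Ne.symm hst)]
  -- An off-diagonal label gives `α = 1`, and with it `α - α * α = 0`, so the remaining diagonal
  -- square vanishes as well.
  obtain ⟨t, ht, htne⟩ := hdag
  have hα1 := hσ1 t ht htne
  subst hα1
  obtain ⟨h1, h0, -, -⟩ := eig_of_span H.axis_a H.axis_a.mem_eig (zero_mem _) H.mem H.ne_zero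
    H.ne_one (exists_coeffs hX)
  refine ⟨by simpa using h0, H.pairsO_eq (zero_mem _) hX, rfl, ?_⟩
  exact
    { sum_one := fun s hs => by simpa using hσ s hs
      dagger := ⟨t, ht, htne⟩
      basis := isBasisOf_option
        (fun p k hk => by
          obtain ⟨h1, -, h2⟩ := H.independent ha0 (zero_mem _) (q := 0) (p := p) (k := k)
            (by simpa using hk)
          exact ⟨h1, h2⟩)
        (fun z => by
          obtain ⟨p, q, k, hk⟩ := exists_coeffs hX z
          exact ⟨p, k, by simpa using hk⟩)
      b_eq := by simpa using H.eq_sum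
      a_mul_a := H.axis_a.idem
      a_mul := fun s hs => H.a_mul hs
      mul_a := fun s hs => H.mul_a hs
      mul := fun s hs t ht => by
        by_cases hst : s = t
        · subst hst
          rcases hsq s hs with h1 | h1 <;> simp [h1]
        · exact H.v_mul_of_ne hs ht hst }

end IsSplit

/-- Coordinates `fa`, `f0`, `fs s` with respect to a basis `a`, `b₀`, `v s`, together with the
multiplication of `A` in these coordinates. -/
structure Frame (a b b₀ : A) (S : Finset (F × F)) (v : F × F → A) (α ε ω : F)
    (p q φ ψ : F × F → F) (fa f0 : A →ₗ[F] F) (fs : F × F → A →ₗ[F] F) : Prop where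
  two_ne : (2 : F) ≠ 0
  axis_b : IsAxis F b
  fus_b : FusionRules F b
  ne_zero : ∀ s ∈ S, s ≠ (0, 0)
  ne_one : ∀ s ∈ S, s ≠ (1, 1)
  expand : ∀ x, x = fa x • a + f0 x • b₀ + ∑ s ∈ S, fs s x • v s
  fa_a : fa a = 1
  f0_a : f0 a = 0
  fs_a : ∀ s ∈ S, fs s a = 0
  fa_b₀ : fa b₀ = 0
  f0_b₀ : f0 b₀ = 1
  fs_b₀ : ∀ s ∈ S, fs s b₀ = 0
  fa_v : ∀ s ∈ S, fa (v s) = 0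
  f0_v : ∀ s ∈ S, f0 (v s) = 0
  fs_v : ∀ s ∈ S, fs s (v s) = 1
  fs_v_ne : ∀ s ∈ S, ∀ t ∈ S, s ≠ t → fs s (v t) = 0
  b_eq : b = α • a + b₀ + ∑ s ∈ S, v s
  fa_mul : ∀ x y, fa (x * y) = fa x * fa y + ε * (f0 x * f0 y) + ∑ s ∈ S, φ s * (fs s x * fs s y)
  f0_mul : ∀ x y, f0 (x * y) = ω * (f0 x * f0 y) + ∑ s ∈ S, ψ s * (fs s x * fs s y)
  fs_mul : ∀ s ∈ S, ∀ x y, fs s (x * y) = s.1 * (fa x * fs s y) + s.2 * (fs s x * fa y) +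
    p s * (f0 x * fs s y) + q s * (fs s x * f0 y)
  not_comm : ∃ x y : A, x * y ≠ y * x

/-- As `b₀` spans `A_0(a)` and every `v s` is an eigenvector for both multiplications by `b₀`, the
span of `a`, `b₀` and the `v s` is closed under products. It contains the generators, so these
vectors form a basis. -/
theorem IsSplit.exists_frame (hchar : (2 : F) ≠ 0) (H : IsSplit a b S α (α • a + b₀) v)
    (hb₀ : b₀ ∈ eig F a (0, 0)) (hne : b₀ ≠ 0) (hap : WeaklyPrimitive F a)
    (ha0 : Module.rank F (eig F a (0, 0)) ≤ 1) (hbf : FusionRules F b)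
    (hgen : NonUnitalAlgebra.adjoin F ({a, b} : Set A) = ⊤)
    (hnc : ∃ x y : A, x * y ≠ y * x) (hane : a ≠ 0) :
    ∃ (ε ω : F) (p q φ ψ : F × F → F) (fa f0 : A →ₗ[F] F) (fs : F × F → A →ₗ[F] F),
      Frame a b b₀ S v α ε ω p q φ ψ fa f0 fs := by
  classical
  obtain ⟨z, hz⟩ := (rank_submodule_le_one_iff' _).1 ha0
  have hE0 : ∀ x ∈ eig F a (0, 0), ∃ c : F, c • b₀ = x := by
    intro x hx
    obtain ⟨c, hc⟩ := Submodule.mem_span_singleton.1 (hz hb₀)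
    obtain ⟨d, hd⟩ := Submodule.mem_span_singleton.1 (hz hx)
    have hc0 : c ≠ 0 := by
      rintro rfl
      exact hne (by rw [← hc, zero_smul])
    exact ⟨d * c⁻¹, by rw [← hc, smul_smul, mul_assoc, inv_mul_cancel₀ hc0, mul_one, hd]⟩
  have hE : ∀ x ∈ evenPart F a, ∃ p q : F, x = p • a + q • b₀ := by
    intro x hx
    obtain ⟨y, hy, w, hw, rfl⟩ := mem_evenPart.1 hx
    obtain ⟨c, rfl⟩ := Submodule.mem_span_singleton.1 (hap ▸ hy : y ∈ Submodule.span F {a})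
    obtain ⟨d, rfl⟩ := hE0 w hw
    exact ⟨c, d, rfl⟩
  have hEh : ∀ x ∈ evenPart F a, ∃ p q : F, x = p • a + q • (α • a + b₀) := by
    intro x hx
    obtain ⟨p, q, rfl⟩ := hE x hx
    exact ⟨p - q * α, q, by module⟩
  have hc : ∀ s, ∃ c : F, s ∈ S → (α • a + b₀) * v s = c • v s := by
    intro s
    by_cases hs : s ∈ S
    · obtain ⟨c, hc⟩ := H.exists_eigenvalue hchar hbf hane hEh hs
      exact ⟨c, fun _ => hc⟩
    · exact ⟨0, fun h => absurd h hs⟩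
  choose c hc using hc
  -- Subtract the contribution of `α • a` from the eigenvalue `c s` of `h`; the right-hand
  -- eigenvalue comes from `v s * h + h * v s = v s`.
  have hb₀v : ∀ s ∈ S, b₀ * v s = (c s - α * s.1) • v s := by
    intro s hs
    have := hc s hs
    rw [add_mul, smul_mul_assoc, H.a_mul hs] at this
    rw [sub_smul, ← this]
    module
  have hvb₀ : ∀ s ∈ S, v s * b₀ = (1 - c s - α * s.2) • v s := by
    intro s hs
    have := H.idem.2 s hs
    rw [hc s hs, mul_add, mul_smul_comm, H.mul_a hs] at this
    rw [← sub_eq_zero] at this ⊢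
    rw [← this]
    module
  have hsq : ∀ s, ∃ p q : F, s ∈ S → v s * v s = p • a + q • b₀ := by
    intro s
    by_cases hs : s ∈ S
    · obtain ⟨p, q, h⟩ := hE _ (H.sq_mem hs)
      exact ⟨p, q, fun _ => h⟩
    · exact ⟨0, 0, fun h => absurd h hs⟩
  choose φ ψ hsq using hsq
  obtain ⟨ε, ω, hεω⟩ := hE _ (H.fus_a.even_mul_even _ (eig_zero_le hb₀) _ (eig_zero_le hb₀))
  have hab₀ : a * b₀ = 0 := by simpa using (mem_eig.1 hb₀).1
  have hb₀a : b₀ * a = 0 := by simpa using (mem_eig.1 hb₀).2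
  have hX : Submodule.span F ({a, b₀} ∪ v '' S) = ⊤ := by
    have hmem : ∀ x ∈ ({a, b₀} : Set A) ∪ v '' S, x ∈ Submodule.span F ({a, b₀} ∪ v '' S) :=
      fun x hx => Submodule.subset_span hx
    have haX := hmem a (by simp)
    have hbX := hmem b₀ (by simp)
    have hvX : ∀ s ∈ S, v s ∈ Submodule.span F ({a, b₀} ∪ v '' S) := fun s hs =>
      hmem _ (Or.inr ⟨s, hs, rfl⟩)
    refine span_eq_top_of_mul_mem hgen _ ?_ haX ?_
    · rintro x ((rfl | rfl) | ⟨s, hs, rfl⟩) y ((rfl | rfl) | ⟨t, ht, rfl⟩)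
      · rw [H.axis_a.idem]; exact haX
      · rw [hab₀]; exact zero_mem _
      · rw [H.a_mul ht]; exact Submodule.smul_mem _ _ (hvX t ht)
      · rw [hb₀a]; exact zero_mem _
      · rw [hεω]; exact add_mem (Submodule.smul_mem _ _ haX) (Submodule.smul_mem _ _ hbX)
      · rw [hb₀v t ht]; exact Submodule.smul_mem _ _ (hvX t ht)
      · rw [H.mul_a hs]; exact Submodule.smul_mem _ _ (hvX s hs)
      · rw [hvb₀ s hs]; exact Submodule.smul_mem _ _ (hvX s hs)
      · by_cases hst : s = t
        · subst hst
          rw [hsq s hs]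
          exact add_mem (Submodule.smul_mem _ _ haX) (Submodule.smul_mem _ _ hbX)
        · rw [H.v_mul_of_ne hs ht hst]; exact zero_mem _
    · rw [H.eq_sum]
      exact add_mem (add_mem (Submodule.smul_mem _ _ haX) hbX) (Submodule.sum_mem _ hvX)
  obtain ⟨hli, hsp⟩ := isBasisOf_sum (x := a) (y := b₀) (S := S) (v := v)
    (fun p q k hk => by
      obtain ⟨h1, h2, h3⟩ := H.independent hane hb₀ hk
      exact ⟨h1, (smul_eq_zero.1 h2).resolve_right hne, h3⟩) (exists_coeffs hX)
  let B := Module.Basis.mk hli hsp.ge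
  let fa := B.coord (Sum.inl 0)
  let f0 := B.coord (Sum.inl 1)
  let fs : F × F → A →ₗ[F] F := fun s => if hs : s ∈ S then B.coord (Sum.inr ⟨s, hs⟩) else 0
  have hBa : B (Sum.inl 0) = a := by simp [B]
  have hB0 : B (Sum.inl 1) = b₀ := by simp [B]
  have hBv : ∀ s (hs : s ∈ S), B (Sum.inr ⟨s, hs⟩) = v s := by simp [B]
  have hfs : ∀ s (hs : s ∈ S), fs s = B.coord (Sum.inr ⟨s, hs⟩) := fun s hs => dif_pos hs
  have hexp : ∀ x, x = fa x • a + f0 x • b₀ + ∑ s ∈ S, fs s x • v s := by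
    intro x
    conv_lhs => rw [← B.sum_repr x]
    rw [Fintype.sum_sum_type, Fin.sum_univ_two, hBa, hB0, ← Finset.sum_coe_sort S]
    congr 1
    refine Finset.sum_congr rfl fun s _ => ?_
    rw [hBv, hfs s.1 s.2]
    rfl
  have fa_a : fa a = 1 := by rw [← hBa]; simp [fa]
  have f0_a : f0 a = 0 := by rw [← hBa]; simp [f0]
  have fs_a : ∀ s ∈ S, fs s a = 0 := fun s hs => by rw [← hBa, hfs s hs]; simp
  have fa_b : fa b₀ = 0 := by rw [← hB0]; simp [fa]
  have f0_b : f0 b₀ = 1 := by rw [← hB0]; simp [f0]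
  have fs_b : ∀ s ∈ S, fs s b₀ = 0 := fun s hs => by rw [← hB0, hfs s hs]; simp
  have fa_v : ∀ s ∈ S, fa (v s) = 0 := fun s hs => by rw [← hBv s hs]; simp [fa]
  have f0_v : ∀ s ∈ S, f0 (v s) = 0 := fun s hs => by rw [← hBv s hs]; simp [f0]
  have fs_v : ∀ s ∈ S, fs s (v s) = 1 := fun s hs => by rw [← hBv s hs, hfs s hs]; simp
  have fs_v_ne : ∀ s ∈ S, ∀ t ∈ S, s ≠ t → fs s (v t) = 0 := fun s hs t ht hst => by
    rw [← hBv t ht, hfs s hs]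
    simp [Ne.symm hst]
  have hay : ∀ (g : A →ₗ[F] F) y, g (a * y) = fa y * g a + ∑ s ∈ S, s.1 * fs s y * g (v s) := by
    intro g y
    conv_lhs => rw [hexp y]
    rw [mul_add, mul_add, mul_smul_comm, mul_smul_comm, hab₀, H.axis_a.idem, Finset.mul_sum]
    simp only [map_add, map_smul, map_sum, smul_eq_mul, smul_zero, add_zero]
    congr 1
    refine Finset.sum_congr rfl fun s hs => ?_
    rw [mul_smul_comm, H.a_mul hs, map_smul, map_smul, smul_eq_mul, smul_eq_mul]
    ring
  have hb₀y : ∀ (g : A →ₗ[F] F) y, g (b₀ * y) = f0 y * (ε * g a + ω * g b₀) +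
      ∑ s ∈ S, (c s - α * s.1) * fs s y * g (v s) := by
    intro g y
    conv_lhs => rw [hexp y]
    rw [mul_add, mul_add, mul_smul_comm, mul_smul_comm, hb₀a, hεω, Finset.mul_sum]
    simp only [map_add, map_smul, map_sum, smul_eq_mul, smul_zero, zero_add]
    congr 1
    refine Finset.sum_congr rfl fun s hs => ?_
    rw [mul_smul_comm, hb₀v s hs, map_smul, map_smul, smul_eq_mul, smul_eq_mul]
    ring
  have hvy : ∀ (g : A →ₗ[F] F) y, ∀ s ∈ S, g (v s * y) = fs s y * (φ s * g a + ψ s * g b₀) +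
      (s.2 * fa y + (1 - c s - α * s.2) * f0 y) * g (v s) := by
    intro g y s hs
    conv_lhs => rw [hexp y]
    rw [mul_add, mul_add, mul_smul_comm, mul_smul_comm, H.mul_a hs, hvb₀ s hs, Finset.mul_sum,
      Finset.sum_eq_single s (fun t ht hts => by
        rw [mul_smul_comm, H.v_mul_of_ne hs ht hts.symm, smul_zero]) (fun h => absurd hs h),
      mul_smul_comm, hsq s hs]
    simp only [map_add, map_smul, smul_eq_mul]
    ring
  have hxy : ∀ (g : A →ₗ[F] F) x y, g (x * y) = fa x * g (a * y) + f0 x * g (b₀ * y) +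
      ∑ s ∈ S, fs s x * g (v s * y) := by
    intro g x y
    conv_lhs => rw [hexp x]
    rw [add_mul, add_mul, smul_mul_assoc, smul_mul_assoc, Finset.sum_mul]
    simp only [map_add, map_smul, map_sum, smul_eq_mul, smul_mul_assoc]
  refine ⟨ε, ω, fun s => c s - α * s.1, fun s => 1 - c s - α * s.2, φ, ψ, fa, f0, fs,
    hchar, H.axis_b, hbf, H.ne_zero, H.ne_one, hexp, fa_a, f0_a, fs_a, fa_b, f0_b, fs_b, fa_v,
    f0_v, fs_v, fs_v_ne, H.eq_sum, fun x y => ?_, fun x y => ?_, fun t ht x y => ?_, hnc⟩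
  · rw [hxy, hay, hb₀y, Finset.sum_eq_zero fun s hs => by rw [fa_v s hs, mul_zero],
      Finset.sum_eq_zero fun s hs => by rw [fa_v s hs, mul_zero], fa_a, fa_b,
      Finset.sum_congr rfl fun s hs => by rw [hvy fa y s hs, fa_v s hs, fa_a, fa_b]]
    have : ∀ s, fs s x * (fs s y * (φ s * 1 + ψ s * 0) +
        (s.2 * fa y + (1 - c s - α * s.2) * f0 y) * 0) = φ s * (fs s x * fs s y) := by
      intro s; ring
    simp only [this]
    ring
  · rw [hxy, hay, hb₀y, Finset.sum_eq_zero fun s hs => by rw [f0_v s hs, mul_zero],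
      Finset.sum_eq_zero fun s hs => by rw [f0_v s hs, mul_zero], f0_a, f0_b,
      Finset.sum_congr rfl fun s hs => by rw [hvy f0 y s hs, f0_v s hs, f0_a, f0_b]]
    have : ∀ s, fs s x * (fs s y * (φ s * 0 + ψ s * 1) +
        (s.2 * fa y + (1 - c s - α * s.2) * f0 y) * 0) = ψ s * (fs s x * fs s y) := by
      intro s; ring
    simp only [this]
    ring
  · rw [hxy, hay, hb₀y, fs_a t ht, fs_b t ht,
      Finset.sum_eq_single t (fun s hs hst => by rw [fs_v_ne t ht s hs hst.symm, mul_zero])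
        (fun h => absurd ht h),
      Finset.sum_eq_single t (fun s hs hst => by rw [fs_v_ne t ht s hs hst.symm, mul_zero])
        (fun h => absurd ht h),
      Finset.sum_eq_single t (fun s hs hst => by
        rw [hvy _ y s hs, fs_v_ne t ht s hs hst.symm, fs_a t ht, fs_b t ht]; ring)
        (fun h => absurd ht h), hvy _ y t ht, fs_v t ht, fs_a t ht, fs_b t ht]
    ring

end Split

/-! ### Relations between the structure constants -/

section FrameTheory

variable {F : Type*} {A : Type*} [Field F] [NonUnitalNonAssocRing A] [Module F A]
  [IsScalarTower F A A] [SMulCommClass F A A]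
  {a b b₀ : A} {S : Finset (F × F)} {v : F × F → A} {α ε ω : F}
  {p q φ ψ : F × F → F} {fa f0 : A →ₗ[F] F} {fs : F × F → A →ₗ[F] F}

namespace Frame

theorem ext (H : Frame a b b₀ S v α ε ω p q φ ψ fa f0 fs) {x y : A} (h1 : fa x = fa y)
    (h0 : f0 x = f0 y) (hs : ∀ s ∈ S, fs s x = fs s y) : x = y := by
  rw [H.expand x, H.expand y, h1, h0, Finset.sum_congr rfl fun s hs' => by rw [hs s hs']]

theorem sum_v (H : Frame a b b₀ S v α ε ω p q φ ψ fa f0 fs) (k : F × F → F) {t : F × F}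
    (ht : t ∈ S) : ∑ s ∈ S, k s * fs s (v t) = k t := by
  rw [Finset.sum_eq_single t (fun s hs hst => by rw [H.fs_v_ne s hs t ht hst, mul_zero])
    (fun h => absurd ht h), H.fs_v t ht, mul_one]

theorem fa_b (H : Frame a b b₀ S v α ε ω p q φ ψ fa f0 fs) : fa b = α := by
  rw [H.b_eq, map_add, map_add, map_smul, H.fa_a, H.fa_b₀, map_sum,
    Finset.sum_eq_zero fun s hs => H.fa_v s hs, smul_eq_mul]
  ring

theorem f0_b (H : Frame a b b₀ S v α ε ω p q φ ψ fa f0 fs) : f0 b = 1 := by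
  rw [H.b_eq, map_add, map_add, map_smul, H.f0_a, H.f0_b₀, map_sum,
    Finset.sum_eq_zero fun s hs => H.f0_v s hs, smul_eq_mul]
  ring

theorem fs_b (H : Frame a b b₀ S v α ε ω p q φ ψ fa f0 fs) {s : F × F} (hs : s ∈ S) :
    fs s b = 1 := by
  rw [H.b_eq, map_add, map_add, map_smul, H.fs_a s hs, H.fs_b₀ s hs, map_sum,
    Finset.sum_eq_single s (fun t ht hts => H.fs_v_ne s hs t ht hts.symm)
      (fun h => absurd hs h), H.fs_v s hs, smul_eq_mul]
  ring

theorem fa_b_mul (H : Frame a b b₀ S v α ε ω p q φ ψ fa f0 fs) (x : A) :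
    fa (b * x) = α * fa x + ε * f0 x + ∑ s ∈ S, φ s * fs s x := by
  rw [H.fa_mul, H.fa_b, H.f0_b, one_mul]
  congr 1
  exact Finset.sum_congr rfl fun s hs => by rw [H.fs_b hs, one_mul]

theorem fa_mul_b (H : Frame a b b₀ S v α ε ω p q φ ψ fa f0 fs) (x : A) :
    fa (x * b) = α * fa x + ε * f0 x + ∑ s ∈ S, φ s * fs s x := by
  rw [H.fa_mul, H.fa_b, H.f0_b, mul_one, mul_comm α]
  congr 1
  exact Finset.sum_congr rfl fun s hs => by rw [H.fs_b hs, mul_one]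

theorem f0_b_mul (H : Frame a b b₀ S v α ε ω p q φ ψ fa f0 fs) (x : A) :
    f0 (b * x) = ω * f0 x + ∑ s ∈ S, ψ s * fs s x := by
  rw [H.f0_mul, H.f0_b, one_mul]
  congr 1
  exact Finset.sum_congr rfl fun s hs => by rw [H.fs_b hs, one_mul]

theorem f0_mul_b (H : Frame a b b₀ S v α ε ω p q φ ψ fa f0 fs) (x : A) :
    f0 (x * b) = ω * f0 x + ∑ s ∈ S, ψ s * fs s x := by
  rw [H.f0_mul, H.f0_b, mul_one]
  congr 1
  exact Finset.sum_congr rfl fun s hs => by rw [H.fs_b hs, mul_one]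

theorem fs_b_mul (H : Frame a b b₀ S v α ε ω p q φ ψ fa f0 fs) {s : F × F} (hs : s ∈ S)
    (x : A) : fs s (b * x) = (α * s.1 + p s) * fs s x + s.2 * fa x + q s * f0 x := by
  rw [H.fs_mul s hs, H.fa_b, H.f0_b, H.fs_b hs]
  ring

theorem fs_mul_b (H : Frame a b b₀ S v α ε ω p q φ ψ fa f0 fs) {s : F × F} (hs : s ∈ S)
    (x : A) : fs s (x * b) = (α * s.2 + q s) * fs s x + s.1 * fa x + p s * f0 x := by
  rw [H.fs_mul s hs, H.fa_b, H.f0_b, H.fs_b hs]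
  ring

theorem sum_φ (H : Frame a b b₀ S v α ε ω p q φ ψ fa f0 fs) :
    α * α + ε + ∑ s ∈ S, φ s = α := by
  have h := H.fa_b_mul b
  rw [H.axis_b.idem, H.fa_b, H.f0_b, Finset.sum_congr rfl fun s hs => by rw [H.fs_b hs]] at h
  simpa using h.symm

theorem sum_ψ (H : Frame a b b₀ S v α ε ω p q φ ψ fa f0 fs) : ω + ∑ s ∈ S, ψ s = 1 := by
  have h := H.f0_b_mul b
  rw [H.axis_b.idem, H.f0_b, Finset.sum_congr rfl fun s hs => by rw [H.fs_b hs]] at h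
  simpa using h.symm

theorem p_add_q (H : Frame a b b₀ S v α ε ω p q φ ψ fa f0 fs) {s : F × F} (hs : s ∈ S) :
    α * (s.1 + s.2) + p s + q s = 1 := by
  have h := H.fs_b_mul hs b
  rw [H.axis_b.idem, H.fa_b, H.f0_b, H.fs_b hs] at h
  linear_combination -h

/-- This is the coordinate at `v s` of `b (a b) = (b a) b`. -/
theorem rel (H : Frame a b b₀ S v α ε ω p q φ ψ fa f0 fs) {s : F × F} (hs : s ∈ S) :
    α * (s.1 - s.2) * (s.1 + s.2 - 1) + s.1 * p s - s.2 * q s = 0 := by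
  have hfaa : fa (a * b) = α := by
    rw [H.fa_mul_b, H.fa_a, H.f0_a, Finset.sum_eq_zero fun s hs => by rw [H.fs_a s hs, mul_zero]]
    ring
  have hfba : fa (b * a) = α := by
    rw [H.fa_b_mul, H.fa_a, H.f0_a, Finset.sum_eq_zero fun s hs => by rw [H.fs_a s hs, mul_zero]]
    ring
  have hf0a : f0 (a * b) = 0 := by
    rw [H.f0_mul_b, H.f0_a, Finset.sum_eq_zero fun s hs => by rw [H.fs_a s hs, mul_zero]]
    ring
  have hf0b : f0 (b * a) = 0 := by
    rw [H.f0_b_mul, H.f0_a, Finset.sum_eq_zero fun s hs => by rw [H.fs_a s hs, mul_zero]]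
    ring
  have h := congrArg (fs s) (H.axis_b.comm a)
  rw [H.fs_b_mul hs (a * b), H.fs_mul_b hs (b * a), H.fs_b_mul hs, H.fs_mul_b hs, H.fs_a s hs,
    H.f0_a, H.fa_a,
    hfaa, hfba, hf0a, hf0b] at h
  linear_combination h

theorem fa_b_v (H : Frame a b b₀ S v α ε ω p q φ ψ fa f0 fs) {s : F × F} (hs : s ∈ S) :
    fa (b * v s) = φ s := by
  rw [H.fa_b_mul, H.fa_v s hs, H.f0_v s hs, H.sum_v _ hs]; ring

theorem fa_v_b (H : Frame a b b₀ S v α ε ω p q φ ψ fa f0 fs) {s : F × F} (hs : s ∈ S) :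
    fa (v s * b) = φ s := by
  rw [H.fa_mul_b, H.fa_v s hs, H.f0_v s hs, H.sum_v _ hs]; ring

theorem f0_b_v (H : Frame a b b₀ S v α ε ω p q φ ψ fa f0 fs) {s : F × F} (hs : s ∈ S) :
    f0 (b * v s) = ψ s := by
  rw [H.f0_b_mul, H.f0_v s hs, H.sum_v _ hs]; ring

theorem f0_v_b (H : Frame a b b₀ S v α ε ω p q φ ψ fa f0 fs) {s : F × F} (hs : s ∈ S) :
    f0 (v s * b) = ψ s := by
  rw [H.f0_mul_b, H.f0_v s hs, H.sum_v _ hs]; ring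

theorem fs_b_v (H : Frame a b b₀ S v α ε ω p q φ ψ fa f0 fs) {s t : F × F} (hs : s ∈ S)
    (ht : t ∈ S) : fs t (b * v s) = (α * t.1 + p t) * fs t (v s) := by
  rw [H.fs_b_mul ht, H.fa_v s hs, H.f0_v s hs]; ring

theorem fs_v_b (H : Frame a b b₀ S v α ε ω p q φ ψ fa f0 fs) {s t : F × F} (hs : s ∈ S)
    (ht : t ∈ S) : fs t (v s * b) = (α * t.2 + q t) * fs t (v s) := by
  rw [H.fs_mul_b ht, H.fa_v s hs, H.f0_v s hs]; ring

/-- Compare the coordinates at `a` and `b₀` in `b (v s b) = (b v s) b`. A nonzero square requires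
left and right multiplication by `α a + b₀` to have the same eigenvalue on `v s`, necessarily `1/2`.
The coordinates at the other `v t` give `cross_rel`. -/
theorem sq_rel (H : Frame a b b₀ S v α ε ω p q φ ψ fa f0 fs) {s : F × F} (hs : s ∈ S) :
    φ s * (1 - 2 * (α * s.1 + p s)) = 0 ∧ ψ s * (1 - 2 * (α * s.1 + p s)) = 0 := by
  have hc := H.axis_b.comm (v s)
  have hpq := H.p_add_q hs
  have hl : ∀ k : F × F → F, ∑ t ∈ S, k t * fs t (b * v s) = k s * (α * s.1 + p s) := by
    intro k
    rw [← H.sum_v (fun t => k t * (α * t.1 + p t)) hs]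
    exact Finset.sum_congr rfl fun t ht => by rw [H.fs_b_v hs ht]; ring
  have hr : ∀ k : F × F → F, ∑ t ∈ S, k t * fs t (v s * b) = k s * (α * s.2 + q s) := by
    intro k
    rw [← H.sum_v (fun t => k t * (α * t.2 + q t)) hs]
    exact Finset.sum_congr rfl fun t ht => by rw [H.fs_v_b hs ht]; ring
  have h1 := congrArg fa hc
  have h2 := congrArg f0 hc
  rw [H.fa_b_mul (v s * b), H.fa_mul_b (b * v s), H.fa_b_v hs, H.fa_v_b hs, H.f0_b_v hs,
    H.f0_v_b hs, hl, hr] at h1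
  rw [H.f0_b_mul (v s * b), H.f0_mul_b (b * v s), H.f0_b_v hs, H.f0_v_b hs, hl, hr] at h2
  constructor
  · linear_combination h1 - φ s * hpq
  · linear_combination h2 - ψ s * hpq

theorem cross_rel (H : Frame a b b₀ S v α ε ω p q φ ψ fa f0 fs) {s t : F × F} (hs : s ∈ S)
    (ht : t ∈ S) (hst : t ≠ s) : φ s * (t.1 - t.2) + ψ s * (p t - q t) = 0 := by
  have h := congrArg (fs t) (H.axis_b.comm (v s))
  rw [H.fs_b_mul ht (v s * b), H.fs_mul_b ht (b * v s), H.fa_b_v hs, H.fa_v_b hs, H.f0_b_v hs, H.f0_v_b hs,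
    H.fs_v_b hs ht, H.fs_b_v hs ht, H.fs_v_ne t ht s hs hst] at h
  linear_combination -h

/-- The image of `D = L_b - R_b` has no coordinates at `a` and `b₀`, while the hypothesis makes the
`s`-coordinate of `D x` depend on those two alone. So `D (D x)` has zero `s`-coordinate, and
diagonalizability gives the same for `D x`. Evaluating at `a` compares the two entries of `s`. -/
theorem eq_of_half (H : Frame a b b₀ S v α ε ω p q φ ψ fa f0 fs) {s : F × F} (hs : s ∈ S)
    (hc : 2 * (α * s.1 + p s) = 1) : s.1 = s.2 := by
  have hpq := H.p_add_q hs
  let D : A →ₗ[F] A := LinearMap.mulLeft F b - LinearMap.mulRight F b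
  have hD : ∀ x, D x = b * x - x * b := fun x => rfl
  have hfs : ∀ x, fs s (D x) = (s.2 - s.1) * fa x + (q s - p s) * f0 x := by
    intro x
    rw [hD, map_sub, H.fs_b_mul hs, H.fs_mul_b hs]
    linear_combination fs s x * (hc - hpq)
  have hfa : ∀ x, fa (D x) = 0 := fun x => by
    rw [hD, map_sub, H.fa_b_mul, H.fa_mul_b, sub_self]
  have hf0 : ∀ x, f0 (D x) = 0 := fun x => by
    rw [hD, map_sub, H.f0_b_mul, H.f0_mul_b, sub_self]
  have key : ∀ x, x ∈ LinearMap.ker (fs s ∘ₗ D) := by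
    refine H.axis_b.induction _ fun r x hx => ?_
    have hDx : D x = (r.1 - r.2) • x := by
      have := mem_eig.1 hx
      rw [hD, this.1, this.2, sub_smul]
    have h1 : fs s (D (D x)) = 0 := by rw [hfs, hfa, hf0]; ring
    rw [LinearMap.mem_ker, LinearMap.comp_apply]
    rw [hDx, map_smul, hDx, map_smul, map_smul, smul_eq_mul, smul_eq_mul] at h1
    rw [hDx, map_smul, smul_eq_mul]
    rcases mul_eq_zero.1 h1 with h | h
    · rw [h, zero_mul]
    · exact h
  have h := key a
  rw [LinearMap.mem_ker, LinearMap.comp_apply, hfs, H.fa_a, H.f0_a] at h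
  linear_combination -h

theorem fst_ne_zero_of_diag (H : Frame a b b₀ S v α ε ω p q φ ψ fa f0 fs) {s : F × F}
    (hs : s ∈ S) (hd : s.1 = s.2) : s.1 ≠ 0 := fun h =>
  H.ne_zero s hs (Prod.ext h (hd ▸ h))

theorem fst_ne_one_of_diag (H : Frame a b b₀ S v α ε ω p q φ ψ fa f0 fs) {s : F × F}
    (hs : s ∈ S) (hd : s.1 = s.2) : s.1 ≠ 1 := fun h =>
  H.ne_one s hs (Prod.ext h (hd ▸ h))

theorem diag (H : Frame a b b₀ S v α ε ω p q φ ψ fa f0 fs) {s : F × F} (hs : s ∈ S)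
    (hd : s.1 = s.2) : p s = q s ∧ 2 * (α * s.1 + p s) = 1 := by
  have h1 := H.rel hs
  have h2 := H.p_add_q hs
  rw [← hd] at h1 h2
  have h3 : s.1 * (p s - q s) = 0 := by linear_combination h1
  have h4 := sub_eq_zero.1 ((mul_eq_zero.1 h3).resolve_left (H.fst_ne_zero_of_diag hs hd))
  exact ⟨h4, by linear_combination h2 + h4⟩

theorem sq_dagger (H : Frame a b b₀ S v α ε ω p q φ ψ fa f0 fs) {s : F × F} (hs : s ∈ S)
    (hd : s.1 ≠ s.2) : φ s = 0 ∧ ψ s = 0 := by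
  have h := H.sq_rel hs
  have hne : 1 - 2 * (α * s.1 + p s) ≠ 0 := fun h0 =>
    hd (H.eq_of_half hs (sub_eq_zero.1 h0).symm)
  exact ⟨(mul_eq_zero.1 h.1).resolve_right hne, (mul_eq_zero.1 h.2).resolve_right hne⟩

/-- On the diagonal `p = q`, so with diagonal labels only the multiplication table would be
symmetric. -/
theorem exists_dagger (H : Frame a b b₀ S v α ε ω p q φ ψ fa f0 fs) :
    ∃ s ∈ S, s.1 ≠ s.2 := by
  by_contra hcon
  push Not at hcon
  obtain ⟨x, y, hxy⟩ := H.not_comm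
  apply hxy
  apply H.ext
  · rw [H.fa_mul, H.fa_mul, Finset.sum_congr rfl fun s _ => by rw [mul_comm (fs s x)]]
    ring
  · rw [H.f0_mul, H.f0_mul, Finset.sum_congr rfl fun s _ => by rw [mul_comm (fs s x)]]
    ring
  · intro s hs
    rw [H.fs_mul s hs, H.fs_mul s hs, (H.diag hs (hcon s hs)).1, hcon s hs]
    ring

theorem mem_eig_iff (H : Frame a b b₀ S v α ε ω p q φ ψ fa f0 fs) {x : A} {r : F × F} :
    x ∈ eig F b r ↔ (fa (b * x) = r.1 * fa x ∧ fa (x * b) = r.2 * fa x) ∧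
      (f0 (b * x) = r.1 * f0 x ∧ f0 (x * b) = r.2 * f0 x) ∧
      ∀ s ∈ S, fs s (b * x) = r.1 * fs s x ∧ fs s (x * b) = r.2 * fs s x := by
  rw [mem_eig]
  constructor
  · rintro ⟨h1, h2⟩
    simp [h1, h2]
  · rintro ⟨⟨h1, h2⟩, ⟨h3, h4⟩, h5⟩
    constructor
    · apply H.ext
      · simpa using h1
      · simpa using h3
      · intro s hs; simpa using (h5 s hs).1
    · apply H.ext
      · simpa using h2
      · simpa using h4
      · intro s hs; simpa using (h5 s hs).2

theorem v_mem_eig (H : Frame a b b₀ S v α ε ω p q φ ψ fa f0 fs) {s : F × F} (hs : s ∈ S)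
    (hφ : φ s = 0) (hψ : ψ s = 0) : v s ∈ eig F b (α * s.1 + p s, α * s.2 + q s) := by
  rw [H.mem_eig_iff, H.fa_b_v hs, H.fa_v_b hs, H.f0_b_v hs, H.f0_v_b hs, H.fa_v s hs,
    H.f0_v s hs, hφ, hψ]
  refine ⟨by simp, by simp, fun t ht => ?_⟩
  rw [H.fs_b_v hs ht, H.fs_v_b hs ht]
  by_cases hst : t = s
  · subst hst; simp
  · simp [H.fs_v_ne t ht s hs hst]

/-- The functionals `fa` and `f0` do not distinguish `b * x` from `x * b`. -/
theorem coords_of_ne (H : Frame a b b₀ S v α ε ω p q φ ψ fa f0 fs) {x : A} {r : F × F}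
    (hx : x ∈ eig F b r) (hr : r.1 ≠ r.2) : fa x = 0 ∧ f0 x = 0 := by
  obtain ⟨⟨h1, h2⟩, ⟨h3, h4⟩, -⟩ := H.mem_eig_iff.1 hx
  rw [H.fa_b_mul] at h1
  rw [H.fa_mul_b, h1] at h2
  rw [H.f0_b_mul] at h3
  rw [H.f0_mul_b, h3] at h4
  have hr' := sub_ne_zero.2 hr
  constructor
  · apply (mul_eq_zero.1 (_ : (r.1 - r.2) * fa x = 0)).resolve_left hr'
    linear_combination h2
  · apply (mul_eq_zero.1 (_ : (r.1 - r.2) * f0 x = 0)).resolve_left hr'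
    linear_combination h4

theorem dagger_label (H : Frame a b b₀ S v α ε ω p q φ ψ fa f0 fs) {s : F × F} (hs : s ∈ S)
    (hd : s.1 ≠ s.2) : α * s.1 + p s ≠ α * s.2 + q s := by
  intro h
  apply hd
  apply H.eq_of_half hs
  linear_combination h + H.p_add_q hs

/-- The coordinates of an eigenvector with respect to `a` and `b₀`, if the fusion rules make it
annihilate some `v s`. -/
theorem coords_of_annihilate (H : Frame a b b₀ S v α ε ω p q φ ψ fa f0 fs) (hα : α ≠ 1)
    {s : F × F} (hs : s ∈ S) (hd : s.1 ≠ s.2) {x y : F} (h1 : s.1 * x + p s * y = 0)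
    (h2 : s.2 * x + q s * y = 0) : x = 0 ∧ y = 0 := by
  have hpq := H.p_add_q hs
  have hrel := H.rel hs
  -- The determinant of the two equations; this is where `α ≠ 1` is needed.
  have hdet : s.1 * q s - s.2 * p s = (1 - α) * (s.1 - s.2) := by
    linear_combination (s.1 - s.2) * hpq - hrel
  have hne : (1 - α) * (s.1 - s.2) ≠ 0 :=
    mul_ne_zero (sub_ne_zero.2 hα.symm) (sub_ne_zero.2 hd)
  constructor
  · apply (mul_eq_zero.1 (_ : ((1 - α) * (s.1 - s.2)) * x = 0)).resolve_left hne
    rw [← hdet]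
    linear_combination q s * h1 - p s * h2
  · apply (mul_eq_zero.1 (_ : ((1 - α) * (s.1 - s.2)) * y = 0)).resolve_left hne
    rw [← hdet]
    linear_combination s.1 * h2 - s.2 * h1

/-- For a diagonal label the fusion rules of `b` make both products with an off-diagonal `v s` zero,
which is a nonsingular linear system in the two coordinates. -/
theorem coords_of_odd (H : Frame a b b₀ S v α ε ω p q φ ψ fa f0 fs) (hα : α ≠ 1) {x : A}
    {r : F × F} (hx : x ∈ eig F b r) (hr0 : r ≠ (0, 0)) (hr1 : r ≠ (1, 1)) :
    fa x = 0 ∧ f0 x = 0 := by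
  by_cases hr : r.1 = r.2
  · obtain ⟨s, hs, hd⟩ := H.exists_dagger
    have hv := H.v_mem_eig hs (H.sq_dagger hs hd).1 (H.sq_dagger hs hd).2
    have hl := H.dagger_label hs hd
    have hne : ∀ t : F × F, t.1 = t.2 → (α * s.1 + p s, α * s.2 + q s) ≠ t := by
      rintro t ht rfl
      exact hl ht
    have h1 := congrArg (fs s) (H.fus_b.mul_eq_zero hx hv (hne r hr).symm hr0 hr1
      (hne _ rfl) (hne _ rfl))
    have h2 := congrArg (fs s) (H.fus_b.mul_eq_zero hv hx (hne r hr) (hne _ rfl)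
      (hne _ rfl) hr0 hr1)
    rw [H.fs_mul s hs, H.fs_v s hs, H.fa_v s hs, H.f0_v s hs, map_zero] at h1 h2
    exact H.coords_of_annihilate hα hs hd (by linear_combination h1) (by linear_combination h2)
  · exact H.coords_of_ne hx hr

/-- Eigenvectors for `b` outside its even part are killed by `L_b + R_b - 1`. -/
theorem odd_sum_one (H : Frame a b b₀ S v α ε ω p q φ ψ fa f0 fs) (hα : α ≠ 1) {x : A}
    {r : F × F} (hx : x ∈ eig F b r) (hr0 : r ≠ (0, 0)) (hr1 : r ≠ (1, 1)) :
    b * x + x * b = x := by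
  obtain ⟨h1, h0⟩ := H.coords_of_odd hα hx hr0 hr1
  have hx' := H.mem_eig_iff.1 hx
  apply H.ext
  · rw [map_add, hx'.1.1, hx'.1.2, h1]; ring
  · rw [map_add, hx'.2.1.1, hx'.2.1.2, h0]; ring
  · intro s hs
    rw [map_add, H.fs_b_mul hs, H.fs_mul_b hs, h1, h0]
    linear_combination fs s x * H.p_add_q hs

/-- Even vectors for `b` with trivial coordinates at `a` and `b₀` vanish. -/
theorem even_eq_zero (H : Frame a b b₀ S v α ε ω p q φ ψ fa f0 fs) (hα : α ≠ 1) {x y : A}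
    (hx : x ∈ eig F b (1, 1)) (hy : y ∈ eig F b (0, 0)) (h1 : fa x + fa y = 0)
    (h0 : f0 x + f0 y = 0) : x = 0 ∧ y = 0 := by
  obtain ⟨-, -, hx⟩ := H.mem_eig_iff.1 hx
  obtain ⟨-, -, hy⟩ := H.mem_eig_iff.1 hy
  -- `L_b + R_b - 1` is `1` on `A_1(b)` and `-1` on `A_0(b)`, and its `s`-coordinate involves only
  -- `fa` and `f0`.
  have hk : ∀ s ∈ S, fs s x = (s.1 + s.2) * fa x + (p s + q s) * f0 x ∧
      fs s y = fs s x := by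
    intro s hs
    have hx' := hx s hs
    have hy' := hy s hs
    rw [H.fs_b_mul hs, H.fs_mul_b hs] at hx' hy'
    have hpq := H.p_add_q hs
    constructor
    · linear_combination -hx'.1 - hx'.2 + fs s x * hpq
    · linear_combination hy'.1 + hy'.2 - fs s y * hpq + (hx'.1 + hx'.2 - fs s x * hpq)
        - (s.1 + s.2) * h1 - (p s + q s) * h0
  have hz : fa x = 0 ∧ f0 x = 0 := by
    obtain ⟨s, hs, hd⟩ := H.exists_dagger
    have hx' := hx s hs
    have hy' := hy s hs
    rw [H.fs_b_mul hs, H.fs_mul_b hs] at hx' hy'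
    have hpq := H.p_add_q hs
    have hk' := (hk s hs).2
    have hl := H.dagger_label hs hd
    -- Adding the left equations for `x` and `y` cancels `fa` and `f0` and leaves `2 (α μ + p) - 1`
    -- as factor. By `p_add_q` this is the difference of the two eigenvalues of `b` on `v s`,
    -- nonzero off the diagonal.
    have h2 : fs s x = 0 := by
      apply (mul_eq_zero.1 (_ : (α * s.1 + p s - (α * s.2 + q s)) * fs s x = 0)).resolve_left
        (sub_ne_zero.2 hl)
      rw [hk'] at hy'
      linear_combination hx'.1 + hy'.1 - s.2 * h1 - q s * h0 - fs s x * hpq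
    rw [h2] at hx'
    exact H.coords_of_annihilate hα hs hd (by linear_combination hx'.2)
      (by linear_combination hx'.1)
  have hk0 : ∀ s ∈ S, fs s x = 0 := by
    intro s hs
    rw [(hk s hs).1, hz.1, hz.2]; ring
  constructor
  · apply H.ext
    · simp [hz.1]
    · simp [hz.2]
    · intro s hs; simp [hk0 s hs]
  · apply H.ext
    · rw [hz.1] at h1; simpa using h1
    · rw [hz.2] at h0; simpa using h0
    · intro s hs; simp [(hk s hs).2, hk0 s hs]

/-- The odd components of `v s` along `b` have no `a`- and `b₀`-coordinates, so the even components
have none in total and vanish. Therefore `L_b + R_b - 1` kills `v s`, but its values at `a` and `b₀`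
are `2 φ` and `2 ψ`. -/
theorem sq_eq_zero (H : Frame a b b₀ S v α ε ω p q φ ψ fa f0 fs) (hα : α ≠ 1) {s : F × F}
    (hs : s ∈ S) : φ s = 0 ∧ ψ s = 0 := by
  let P : Submodule F A := LinearMap.ker fa ⊓ LinearMap.ker f0 ⊓
    LinearMap.ker (LinearMap.mulLeft F b + LinearMap.mulRight F b - LinearMap.id)
  have hmem : v s ∈ evenPart F b ⊔ P := by
    refine H.axis_b.induction _ (fun r x hx => ?_) (v s)
    by_cases hr1 : r = (1, 1)
    · exact le_sup_left (a := evenPart F b) (eig_one_le (hr1 ▸ hx))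
    by_cases hr0 : r = (0, 0)
    · exact le_sup_left (a := evenPart F b) (eig_zero_le (hr0 ▸ hx))
    · refine le_sup_right (b := P) ⟨H.coords_of_odd hα hx hr0 hr1, ?_⟩
      simp [H.odd_sum_one hα hx hr0 hr1]
  obtain ⟨e, he, x, hx, hex⟩ := Submodule.mem_sup.1 hmem
  obtain ⟨y, hy, z, hz, rfl⟩ := mem_evenPart.1 he
  obtain ⟨⟨hxa, hx0⟩, hxQ⟩ := hx
  simp only [SetLike.mem_coe, LinearMap.mem_ker] at hxa hx0 hxQ
  have h1 := congrArg fa hex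
  have h0 := congrArg f0 hex
  rw [map_add, map_add, hxa, H.fa_v s hs, add_zero] at h1
  rw [map_add, map_add, hx0, H.f0_v s hs, add_zero] at h0
  obtain ⟨rfl, rfl⟩ := H.even_eq_zero hα hy hz h1 h0
  rw [add_zero, zero_add] at hex
  subst hex
  have hxQ' : b * v s + v s * b - v s = 0 := hxQ
  have h3 := congrArg fa hxQ'
  have h4 := congrArg f0 hxQ'
  rw [map_sub, map_add, H.fa_b_v hs, H.fa_v_b hs, H.fa_v s hs, map_zero] at h3
  rw [map_sub, map_add, H.f0_b_v hs, H.f0_v_b hs, H.f0_v s hs, map_zero] at h4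
  constructor
  · exact (mul_eq_zero.1 (by linear_combination h3 : (2 : F) * φ s = 0)).resolve_left H.two_ne
  · exact (mul_eq_zero.1 (by linear_combination h4 : (2 : F) * ψ s = 0)).resolve_left H.two_ne

/-- Once the squares vanish, `ε = α - α²` and `ω = 1`, so `fa - α f0` is an eigenfunctional of `L_b`
with eigenvalue `α`. It vanishes on odd eigenvectors and, as `α ≠ 1`, on `A_1(b)`; it cannot vanish
on `A_0(b)` too, since its value at `a` is `1`. -/
theorem alpha_eq_zero (H : Frame a b b₀ S v α ε ω p q φ ψ fa f0 fs) (hα : α ≠ 1) :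
    α = 0 := by
  have hε := H.sum_φ
  have hω := H.sum_ψ
  rw [Finset.sum_eq_zero fun s hs => (H.sq_eq_zero hα hs).1] at hε
  rw [Finset.sum_eq_zero fun s hs => (H.sq_eq_zero hα hs).2] at hω
  let g : A →ₗ[F] F := fa - α • f0
  have hg : ∀ x, g x = fa x - α * f0 x := fun x => rfl
  have hgb : ∀ x, g (b * x) = α * g x := by
    intro x
    rw [hg, hg, H.fa_b_mul, H.f0_b_mul,
      Finset.sum_eq_zero fun s hs => by rw [(H.sq_eq_zero hα hs).1, zero_mul],
      Finset.sum_eq_zero fun s hs => by rw [(H.sq_eq_zero hα hs).2, zero_mul]]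
    linear_combination f0 x * hε - α * f0 x * hω
  have key : ∀ x, x ∈ LinearMap.ker (α • g) := by
    refine H.axis_b.induction _ fun r x hx => ?_
    rw [LinearMap.mem_ker, LinearMap.smul_apply, smul_eq_mul]
    by_cases hr0 : r = (0, 0)
    · rw [← hgb, (mem_eig.1 hx).1, hr0, zero_smul, map_zero]
    by_cases hr1 : r = (1, 1)
    · have h1 := hgb x
      rw [(mem_eig.1 hx).1, hr1, one_smul] at h1
      have h2 : (1 - α) * g x = 0 := by linear_combination h1
      rw [(mul_eq_zero.1 h2).resolve_left (sub_ne_zero.2 hα.symm), mul_zero]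
    · obtain ⟨h1, h0⟩ := H.coords_of_odd hα hx hr0 hr1
      rw [hg, h1, h0]; ring
  have h := key a
  rw [LinearMap.mem_ker, LinearMap.smul_apply, smul_eq_mul, hg, H.fa_a, H.f0_a] at h
  linear_combination h

theorem fa_comb (H : Frame a b b₀ S v α ε ω p q φ ψ fa f0 fs) (x y : F) (k : F × F → F) :
    fa (x • a + y • b₀ + ∑ s ∈ S, k s • v s) = x := by
  simp only [map_add, map_smul, map_sum, H.fa_a, H.fa_b₀]
  rw [Finset.sum_eq_zero fun s hs => by rw [H.fa_v s hs, smul_zero]]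
  simp

theorem f0_comb (H : Frame a b b₀ S v α ε ω p q φ ψ fa f0 fs) (x y : F) (k : F × F → F) :
    f0 (x • a + y • b₀ + ∑ s ∈ S, k s • v s) = y := by
  simp only [map_add, map_smul, map_sum, H.f0_a, H.f0_b₀]
  rw [Finset.sum_eq_zero fun s hs => by rw [H.f0_v s hs, smul_zero]]
  simp

theorem fs_comb (H : Frame a b b₀ S v α ε ω p q φ ψ fa f0 fs) (x y : F) (k : F × F → F)
    {s : F × F} (hs : s ∈ S) : fs s (x • a + y • b₀ + ∑ s ∈ S, k s • v s) = k s := by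
  simp only [map_add, map_smul, map_sum, H.fs_a s hs, H.fs_b₀ s hs]
  rw [Finset.sum_eq_single s (fun t ht hts => by rw [H.fs_v_ne s hs t ht hts.symm, smul_zero])
    (fun h => absurd hs h), H.fs_v s hs]
  simp

/-! ### Coefficient `α = 0`: the exceptional algebra -/

theorem exceptional_scalars (H : Frame a b b₀ S v 0 ε ω p q φ ψ fa f0 fs) : ε = 0 ∧ ω = 1 := by
  have hφ := H.sum_φ
  have hψ := H.sum_ψ
  rw [Finset.sum_eq_zero fun s hs => (H.sq_eq_zero zero_ne_one hs).1] at hφ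
  rw [Finset.sum_eq_zero fun s hs => (H.sq_eq_zero zero_ne_one hs).2] at hψ
  exact ⟨by linear_combination hφ, by linear_combination hψ⟩

theorem exceptional_zero_mem (H : Frame a b b₀ S v 0 ε ω p q φ ψ fa f0 fs) :
    a - ∑ s ∈ S, (s.1 + s.2) • v s ∈ eig F b (0, 0) := by
  obtain ⟨hε, hω⟩ := H.exceptional_scalars
  have hw : a - ∑ s ∈ S, (s.1 + s.2) • v s =
      (1 : F) • a + (0 : F) • b₀ + ∑ s ∈ S, (-(s.1 + s.2)) • v s := by
    simp only [neg_smul, Finset.sum_neg_distrib, one_smul, zero_smul, add_zero, sub_eq_add_neg]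
  rw [hw, H.mem_eig_iff, H.fa_b_mul, H.fa_mul_b, H.f0_b_mul, H.f0_mul_b, H.fa_comb, H.f0_comb,
    Finset.sum_eq_zero fun s hs => by rw [(H.sq_eq_zero zero_ne_one hs).1, zero_mul],
    Finset.sum_eq_zero fun s hs => by rw [(H.sq_eq_zero zero_ne_one hs).2, zero_mul]]
  refine ⟨by simp, by simp, fun s hs => ?_⟩
  rw [H.fs_b_mul hs, H.fs_mul_b hs, H.fa_comb, H.f0_comb,
    H.fs_comb _ _ (fun s => -(s.1 + s.2)) hs]
  have h1 := H.rel hs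
  have h2 := H.p_add_q hs
  constructor
  · linear_combination -h1 - s.2 * h2
  · linear_combination h1 - s.1 * h2

/-- The square of `w ∈ A_0(b)` is even for `b`. With `σ = μ + ν`, commuting with `b` gives `(1 -
σ)(μ - ν) = 0` at each `v s`. If `σ ≠ 1` the label is diagonal, and idempotency of `L_b` on `w * w`
gives `p = 1`, against `2 p = 1`. -/
theorem exceptional_sum_one (H : Frame a b b₀ S v 0 ε ω p q φ ψ fa f0 fs) {s : F × F}
    (hs : s ∈ S) : s.1 + s.2 = 1 ∧ p s = s.2 ∧ q s = s.1 := by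
  obtain ⟨hε, hω⟩ := H.exceptional_scalars
  have h1 := H.rel hs
  have h2 := H.p_add_q hs
  have hw : a - ∑ s ∈ S, (s.1 + s.2) • v s =
      (1 : F) • a + (0 : F) • b₀ + ∑ s ∈ S, (-(s.1 + s.2)) • v s := by
    simp only [neg_smul, Finset.sum_neg_distrib, one_smul, zero_smul, add_zero, sub_eq_add_neg]
  have hmem := H.exceptional_zero_mem
  rw [hw] at hmem
  set w := (1 : F) • a + (0 : F) • b₀ + ∑ s ∈ S, (-(s.1 + s.2)) • v s with hwdef
  have hwa : fa w = 1 := H.fa_comb _ _ _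
  have hw0 : f0 w = 0 := H.f0_comb _ _ _
  have hws : fs s w = -(s.1 + s.2) := H.fs_comb _ _ (fun s => -(s.1 + s.2)) hs
  have he := H.fus_b.sq_mem hmem hmem
  have hφ0 : ∀ k : F × F → F, ∑ s ∈ S, φ s * k s = 0 := fun k =>
    Finset.sum_eq_zero fun s hs => by rw [(H.sq_eq_zero zero_ne_one hs).1, zero_mul]
  have hψ0 : ∀ k : F × F → F, ∑ s ∈ S, ψ s * k s = 0 := fun k =>
    Finset.sum_eq_zero fun s hs => by rw [(H.sq_eq_zero zero_ne_one hs).2, zero_mul]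
  have ha2 : fa (w * w) = 1 := by rw [H.fa_mul, hφ0, hwa, hw0]; ring
  have h02 : f0 (w * w) = 0 := by rw [H.f0_mul, hψ0, hw0]; ring
  have hs2 : fs s (w * w) = -(s.1 + s.2) ^ 2 := by
    rw [H.fs_mul s hs, hwa, hw0, hws]; ring
  have ha3 : fa (b * (w * w)) = 0 := by rw [H.fa_b_mul, hφ0, ha2, h02]; ring
  have h03 : f0 (b * (w * w)) = 0 := by rw [H.f0_b_mul, hψ0, h02]; ring
  have hL := congrArg (fs s) (even_mul_mul he)
  have hC := congrArg (fs s) (even_comm he)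
  rw [H.fs_b_mul hs (b * (w * w)), ha3, h03, H.fs_b_mul hs, ha2, h02, hs2] at hL
  rw [H.fs_b_mul hs, H.fs_mul_b hs, ha2, h02, hs2] at hC
  have hp : (s.1 + s.2) * p s = s.2 := by linear_combination h1 + s.2 * h2
  have hq : (s.1 + s.2) * q s = s.1 := by linear_combination s.1 * h2 - h1
  have hσ : s.1 + s.2 = 1 := by
    by_contra hσ
    have hσ' : 1 - (s.1 + s.2) ≠ 0 := fun h => hσ (sub_eq_zero.1 h).symm
    have h3 : s.1 = s.2 := by
      apply mul_left_cancel₀ hσ'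
      linear_combination -hC - (s.1 + s.2) * hp + (s.1 + s.2) * hq
    obtain ⟨h4, h5⟩ := H.diag hs h3
    have h6 := H.fst_ne_zero_of_diag hs h3
    have h7 : (1 - (s.1 + s.2)) * s.1 * (1 - p s) = 0 := by
      linear_combination -hL + (s.1 + s.2) * (1 - p s) * hp + (1 - (s.1 + s.2)) * (1 - p s) * h3
    have h8 := (mul_eq_zero.1 h7).resolve_left (mul_ne_zero hσ' h6)
    exact one_ne_zero (by linear_combination h5 + 2 * h8 : (1 : F) = 0)
  exact ⟨hσ, by linear_combination hp - p s * hσ, by linear_combination hq - q s * hσ⟩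

/-! ### Coefficient `α = 1`: off-diagonal labels and the character `fa` -/

section AlphaOne

theorem sum_ne_zero (H : Frame a b b₀ S v 1 ε ω p q φ ψ fa f0 fs) {s : F × F} (hs : s ∈ S) :
    s.1 + s.2 ≠ 0 := by
  intro hσ
  have h1 := H.rel hs
  have h2 := H.p_add_q hs
  have h3 : s.1 = 0 := by
    linear_combination -h1 + s.1 * h2 + (s.1 - (s.1 + s.2) + 1 - q s) * hσ
  exact H.ne_zero s hs (Prod.ext h3 (by linear_combination hσ - h3))

theorem sum_mul_p (H : Frame a b b₀ S v 1 ε ω p q φ ψ fa f0 fs) {s : F × F} (hs : s ∈ S) :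
    (s.1 + s.2) * p s = s.1 * (1 - (s.1 + s.2)) := by
  linear_combination H.rel hs + s.2 * H.p_add_q hs

theorem sum_mul_q (H : Frame a b b₀ S v 1 ε ω p q φ ψ fa f0 fs) {s : F × F} (hs : s ∈ S) :
    (s.1 + s.2) * q s = s.2 * (1 - (s.1 + s.2)) := by
  linear_combination -H.rel hs + s.1 * H.p_add_q hs

/-- Multiply `cross_rel` by `σ`, the sum of the entries of `t`, use `σ (p - q) = (μ - ν)(1 - σ)` and
cancel `μ - ν`. -/
theorem phi_rel (H : Frame a b b₀ S v 1 ε ω p q φ ψ fa f0 fs) {s t : F × F} (hs : s ∈ S)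
    (ht : t ∈ S) (hd : t.1 ≠ t.2) : (t.1 + t.2) * φ s = (t.1 + t.2 - 1) * ψ s := by
  by_cases hst : t = s
  · subst hst
    rw [(H.sq_dagger ht hd).1, (H.sq_dagger ht hd).2]; ring
  · apply mul_left_cancel₀ (sub_ne_zero.2 hd)
    linear_combination (t.1 + t.2) * H.cross_rel hs ht hst - ψ s * H.sum_mul_p ht +
      ψ s * H.sum_mul_q ht

theorem sum_phi_rel (H : Frame a b b₀ S v 1 ε ω p q φ ψ fa f0 fs) {t : F × F}
    (ht : t ∈ S) (hd : t.1 ≠ t.2) (k : F × F → F) :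
    (t.1 + t.2) * ∑ s ∈ S, φ s * k s = (t.1 + t.2 - 1) * ∑ s ∈ S, ψ s * k s := by
  rw [Finset.mul_sum, Finset.mul_sum]
  exact Finset.sum_congr rfl fun s hs => by
    rw [← mul_assoc, H.phi_rel hs ht hd, mul_assoc]

theorem eps_rel (H : Frame a b b₀ S v 1 ε ω p q φ ψ fa f0 fs) {t : F × F}
    (ht : t ∈ S) (hd : t.1 ≠ t.2) : (t.1 + t.2) * ε = (t.1 + t.2 - 1) * (ω - 1) := by
  have h := H.sum_phi_rel ht hd 1
  simp only [Pi.one_apply, mul_one] at h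
  linear_combination (t.1 + t.2) * H.sum_φ - h - (t.1 + t.2 - 1) * H.sum_ψ

/-- A diagonal eigenvector of `b` has its coordinate at `v t`, for `t` off the diagonal,
determined by the first two coordinates. -/
theorem fs_of_diag_eig (H : Frame a b b₀ S v 1 ε ω p q φ ψ fa f0 fs) {t : F × F} (ht : t ∈ S)
    (hd : t.1 ≠ t.2) {x : A} {r : F × F} (hx : x ∈ eig F b r) (hr : r.1 = r.2) :
    fs t x - (t.1 + t.2) * fa x + (t.1 + t.2 - 1) * f0 x = 0 := by
  obtain ⟨⟨h1, h2⟩, ⟨h3, h4⟩, h5⟩ := H.mem_eig_iff.1 hx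
  obtain ⟨h6, h7⟩ := h5 t ht
  have hp := H.sum_mul_p ht
  have hq := H.sum_mul_q ht
  have hpq := H.p_add_q ht
  have hs := H.sum_phi_rel ht hd (fun s => fs s x)
  have he := H.eps_rel ht hd
  rw [H.fa_b_mul] at h1
  rw [H.fa_mul_b] at h2
  rw [H.f0_b_mul] at h3
  rw [H.f0_mul_b] at h4
  rw [H.fs_b_mul ht] at h6
  rw [H.fs_mul_b ht] at h7
  have hl := H.dagger_label ht hd
  apply (mul_eq_zero.1 (_ : (1 * t.1 + p t - (1 * t.2 + q t)) * _ = 0)).resolve_left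
    (sub_ne_zero.2 hl)
  -- The functional in question is an eigenfunctional of both `L_b` and `R_b`, with the two
  -- eigenvalues of `v t`. These differ, so it vanishes wherever `L_b` and `R_b` act by the same
  -- scalar.
  have e1 : (1 * t.1 + p t) * (fs t x - (t.1 + t.2) * fa x + (t.1 + t.2 - 1) * f0 x) =
      r.1 * (fs t x - (t.1 + t.2) * fa x + (t.1 + t.2 - 1) * f0 x) := by
    linear_combination h6 - (t.1 + t.2) * h1 + (t.1 + t.2 - 1) * h3 + hs + f0 x * he -
      fa x * hp - f0 x * hpq + f0 x * hp
  have e2 : (1 * t.2 + q t) * (fs t x - (t.1 + t.2) * fa x + (t.1 + t.2 - 1) * f0 x) =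
      r.1 * (fs t x - (t.1 + t.2) * fa x + (t.1 + t.2 - 1) * f0 x) := by
    rw [hr]
    linear_combination h7 - (t.1 + t.2) * h2 + (t.1 + t.2 - 1) * h4 + hs + f0 x * he -
      fa x * hq - f0 x * hpq + f0 x * hq
  rw [sub_mul, e1, e2, sub_self]

/-- The functional of `fs_of_diag_eig` kills a diagonal eigenvector `x` of `b` and also its square,
which is even. With `σ = t.1 + t.2` this reads `σ (σ - 1)(fa x - f0 x)² = 0`. For `σ ≠ 1` the
functionals `fa` and `f0` would agree on all eigenvectors, but they differ at `a`. -/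
theorem dagger_sum_one (H : Frame a b b₀ S v 1 ε ω p q φ ψ fa f0 fs) {t : F × F} (ht : t ∈ S)
    (hd : t.1 ≠ t.2) : t.1 + t.2 = 1 := by
  by_contra hσ
  have key : ∀ x, x ∈ LinearMap.ker (fa - f0) := by
    refine H.axis_b.induction _ fun r x hx => ?_
    rw [LinearMap.mem_ker, LinearMap.sub_apply]
    by_cases hr : r.1 = r.2
    · have h1 := H.fs_of_diag_eig ht hd hx hr
      obtain ⟨y, hy, z, hz, hyz⟩ := mem_evenPart.1 (H.fus_b.sq_mem hx hx)
      have h2 := H.fs_of_diag_eig ht hd hy rfl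
      have h3 := H.fs_of_diag_eig ht hd hz rfl
      have h4 : fs t (x * x) - (t.1 + t.2) * fa (x * x) + (t.1 + t.2 - 1) * f0 (x * x) = 0 := by
        rw [← hyz, map_add, map_add, map_add]
        linear_combination h2 + h3
      rw [H.fs_mul t ht, H.fa_mul, H.f0_mul] at h4
      have h5 := H.sum_phi_rel ht hd (fun s => fs s x * fs s x)
      have he := H.eps_rel ht hd
      have hpq := H.p_add_q ht
      have h6 : ((t.1 + t.2) * (t.1 + t.2 - 1)) * (fa x - f0 x) ^ 2 = 0 := by
        linear_combination h4 + h5 + f0 x ^ 2 * he - fs t x * f0 x * hpq -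
          ((t.1 + t.2) * fa x - (t.1 + t.2 - 1) * f0 x) * h1
      exact pow_eq_zero_iff two_ne_zero |>.1
        ((mul_eq_zero.1 h6).resolve_left (mul_ne_zero (H.sum_ne_zero ht) (sub_ne_zero.2 hσ)))
    · obtain ⟨h1, h2⟩ := H.coords_of_ne hx hr
      rw [h1, h2, sub_zero]
  have := key a
  rw [LinearMap.mem_ker, LinearMap.sub_apply, H.fa_a, H.f0_a, sub_zero] at this
  exact one_ne_zero this

theorem dagger_p (H : Frame a b b₀ S v 1 ε ω p q φ ψ fa f0 fs) {t : F × F} (ht : t ∈ S)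
    (hd : t.1 ≠ t.2) : p t = 0 ∧ q t = 0 := by
  have h1 := H.sum_mul_p ht
  have h2 := H.sum_mul_q ht
  rw [H.dagger_sum_one ht hd] at h1 h2
  exact ⟨by linear_combination h1, by linear_combination h2⟩

theorem phi_eq_zero (H : Frame a b b₀ S v 1 ε ω p q φ ψ fa f0 fs) {s : F × F} (hs : s ∈ S) :
    φ s = 0 := by
  obtain ⟨t, ht, hd⟩ := H.exists_dagger
  have h := H.phi_rel hs ht hd
  rw [H.dagger_sum_one ht hd] at h
  linear_combination h

theorem eps_eq_zero (H : Frame a b b₀ S v 1 ε ω p q φ ψ fa f0 fs) : ε = 0 := by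
  have h := H.sum_φ
  rw [Finset.sum_eq_zero fun s hs => H.phi_eq_zero hs] at h
  linear_combination h

theorem q_eq_p (H : Frame a b b₀ S v 1 ε ω p q φ ψ fa f0 fs) {s : F × F} (hs : s ∈ S) :
    q s = p s := by
  by_cases hd : s.1 = s.2
  · exact (H.diag hs hd).1.symm
  · rw [(H.dagger_p hs hd).1, (H.dagger_p hs hd).2]

theorem diag_p (H : Frame a b b₀ S v 1 ε ω p q φ ψ fa f0 fs) {s : F × F} (hs : s ∈ S)
    (hd : s.1 = s.2) : 2 * p s = 1 - 2 * s.1 := by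
  linear_combination (H.diag hs hd).2

/-- So `fa` is a character with value `1` at `b`, and it kills every eigenvector of `b` outside
`A_1(b)`. -/
theorem fa_mul_one (H : Frame a b b₀ S v 1 ε ω p q φ ψ fa f0 fs) (x y : A) :
    fa (x * y) = fa x * fa y := by
  rw [H.fa_mul, H.eps_eq_zero, Finset.sum_eq_zero fun s hs => by
    rw [H.phi_eq_zero hs, zero_mul]]
  ring

theorem fa_eq_zero_of_eig (H : Frame a b b₀ S v 1 ε ω p q φ ψ fa f0 fs) {x : A} {r : F × F}
    (hx : x ∈ eig F b r) (hr : r ≠ (1, 1)) : fa x = 0 := by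
  obtain ⟨⟨h1, h2⟩, -, -⟩ := H.mem_eig_iff.1 hx
  rw [H.fa_mul_one, H.fa_b] at h1 h2
  by_contra h
  exact hr (Prod.ext (mul_right_cancel₀ h (by rw [← h1]))
    (mul_right_cancel₀ h (by rw [← h2, mul_comm])))

theorem fs_dagger_of_eig (H : Frame a b b₀ S v 1 ε ω p q φ ψ fa f0 fs) {t : F × F}
    (ht : t ∈ S) (hd : t.1 ≠ t.2) {x : A} {r : F × F} (hx : x ∈ eig F b r) (hr : r.1 = r.2) :
    fs t x = fa x := by
  have h := H.fs_of_diag_eig ht hd hx hr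
  rw [H.dagger_sum_one ht hd] at h
  linear_combination h

end AlphaOne

end Frame

end FrameTheory

/-! ### Coefficient `α = 1`: even vectors of `b` in the kernel of the character -/

section FrameTheory

variable {F : Type*} {A : Type*} [Field F] [NonUnitalNonAssocRing A] [Module F A]
  [IsScalarTower F A A] [SMulCommClass F A A]
  {a b b₀ : A} {S : Finset (F × F)} {v : F × F → A} {ε ω : F}
  {p q φ ψ : F × F → F} {fa f0 : A →ₗ[F] F} {fs : F × F → A →ₗ[F] F}

namespace Frame

theorem mem_eig_diag_iff (H : Frame a b b₀ S v 1 ε ω p q φ ψ fa f0 fs) {x : A}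
    (hxa : fa x = 0) (hxt : ∀ t ∈ S, t.1 ≠ t.2 → fs t x = 0) {l : F} :
    x ∈ eig F b (l, l) ↔ ω * f0 x + ∑ s ∈ S, ψ s * fs s x = l * f0 x ∧
      ∀ s ∈ S, s.1 = s.2 → p s * f0 x + 1 / 2 * fs s x = l * fs s x := by
  have hs : ∀ s ∈ S, s.1 = s.2 →
      fs s (b * x) = p s * f0 x + 1 / 2 * fs s x ∧ fs s (x * b) = fs s (b * x) := by
    intro s hs hd
    have h2 := (H.diag hs hd).2
    have h3 := H.q_eq_p hs
    have h4 : 1 * s.1 + p s = 1 / 2 := by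
      rw [eq_div_iff H.two_ne]; linear_combination h2
    rw [H.fs_b_mul hs, H.fs_mul_b hs, hxa, ← hd, h3, h4]
    exact ⟨by ring, rfl⟩
  rw [H.mem_eig_iff, H.fa_mul_one, H.fa_mul_one, hxa, H.f0_b_mul, H.f0_mul_b]
  constructor
  · rintro ⟨-, ⟨h, -⟩, h'⟩
    exact ⟨h, fun s hs' hd => by rw [← (hs s hs' hd).1]; exact (h' s hs').1⟩
  · rintro ⟨h, h'⟩
    refine ⟨by simp, ⟨h, h⟩, fun s hs' => ?_⟩
    by_cases hd : s.1 = s.2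
    · rw [(hs s hs' hd).2, (hs s hs' hd).1]
      exact ⟨h' s hs' hd, h' s hs' hd⟩
    · rw [H.fs_b_mul hs', H.fs_mul_b hs', hxa, hxt s hs' hd, (H.dagger_p hs' hd).1,
        (H.dagger_p hs' hd).2]
      simp

/-- The even part of `b` inside the kernel of `fa`. -/
theorem even_split (H : Frame a b b₀ S v 1 ε ω p q φ ψ fa f0 fs) {z : A}
    (hz : z ∈ evenPart F b) (hza : fa z = 0) :
    ∃ x ∈ eig F b (1, 1), ∃ y ∈ eig F b (0, 0), x + y = z ∧ fa x = 0 := by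
  obtain ⟨x, hx, y, hy, hxy⟩ := mem_evenPart.1 hz
  refine ⟨x, hx, y, hy, hxy, ?_⟩
  have h := H.fa_eq_zero_of_eig hy (by simp)
  rw [← hxy, map_add, h, add_zero] at hza
  exact hza

theorem even_dagger (H : Frame a b b₀ S v 1 ε ω p q φ ψ fa f0 fs) {z : A}
    (hz : z ∈ evenPart F b) (hza : fa z = 0) : ∀ t ∈ S, t.1 ≠ t.2 → fs t z = 0 := by
  intro t ht hd
  obtain ⟨x, hx, y, hy, rfl⟩ := mem_evenPart.1 hz
  have h1 := H.fs_dagger_of_eig ht hd hx rfl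
  have h2 := H.fs_dagger_of_eig ht hd hy rfl
  rw [map_add] at hza ⊢
  rw [h1, h2, hza]

/-- At a diagonal label, `L_b` has `s`-coordinate `p f0 + 1/2 fs` on the kernel of `fa`. Solving `b
(b z) = b z` there gives the constant `G`, the same for all `s`. -/
theorem even_fs (H : Frame a b b₀ S v 1 ε ω p q φ ψ fa f0 fs) {z : A}
    (hz : z ∈ evenPart F b) (hza : fa z = 0) : ∃ G : F, ∀ s ∈ S, fs s z = p s * G := by
  refine ⟨4 * (ω * f0 z + ∑ s ∈ S, ψ s * fs s z - 1 / 2 * f0 z), fun s hs => ?_⟩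
  by_cases hd : s.1 = s.2
  · have h := congrArg (fs s) (even_mul_mul hz)
    have h2 := (H.diag hs hd).2
    have h3 := H.q_eq_p hs
    have h4 : 1 * s.1 + p s = 1 / 2 := by
      rw [eq_div_iff H.two_ne]; linear_combination h2
    have h5 : fa (b * z) = 0 := by rw [H.fa_mul_one, hza, mul_zero]
    rw [H.fs_b_mul hs (b * z), H.fs_b_mul hs, h4, h5, H.f0_b_mul, hza, h3] at h
    have h2' := H.two_ne
    field_simp at h ⊢
    linear_combination (-2 : F) * h
  · rw [H.even_dagger hz hza s hs hd, (H.dagger_p hs hd).1, zero_mul]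

/-- The even part of `b` meets the kernel of `fa`. -/
theorem exists_even (H : Frame a b b₀ S v 1 ε ω p q φ ψ fa f0 fs)
    (h1 : ∀ x ∈ eig F b (1, 1), fa x = 0 → x = 0) (h0 : ∀ x ∈ eig F b (0, 0), x = 0) : False := by
  have hb1 := H.axis_b.mem_eig
  have heig1 : ∀ x ∈ eig F b (1, 1), x = fa x • b := by
    intro x hx
    refine sub_eq_zero.1 (h1 _ (sub_mem hx (Submodule.smul_mem _ _ hb1)) ?_)
    rw [map_sub, map_smul, H.fa_b, smul_eq_mul, mul_one, sub_self]
  have heven : ∀ x ∈ evenPart F b, fa x = 0 → x = 0 := by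
    intro z hz hza
    obtain ⟨x, hx, y, hy, rfl, hxa⟩ := H.even_split hz hza
    rw [h1 x hx hxa, h0 y hy, add_zero]
  -- Under the assumptions the even part of `b` is `F b`, so an even product lying in the kernel of
  -- `fa` is zero; `y` survives only against multiples of `b`.
  have hodd : ∀ l : F, (l, l) ≠ ((0, 0) : F × F) → (l, l) ≠ ((1, 1) : F × F) →
      ∀ y ∈ eig F b (l, l), ∀ x, y * x = (l * fa x) • y := by
    intro l hl0 hl1 y hy x
    have hya := H.fa_eq_zero_of_eig hy hl1
    refine H.axis_b.induction
      (LinearMap.eqLocus (LinearMap.mulLeft F y) ((l • fa).smulRight y)) (fun r x hx => ?_) x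
    simp only [LinearMap.mem_eqLocus, LinearMap.mulLeft_apply, LinearMap.smulRight_apply,
      LinearMap.smul_apply, smul_eq_mul]
    by_cases hr1 : r = (1, 1)
    · rw [heig1 x (hr1 ▸ hx), mul_smul_comm, (mem_eig.1 hy).2, map_smul, H.fa_b, smul_smul]
      congr 1
      simp only [smul_eq_mul]
      ring
    by_cases hr0 : r = (0, 0)
    · rw [h0 x (hr0 ▸ hx)]; simp
    rw [H.fa_eq_zero_of_eig hx hr1, mul_zero, zero_smul]
    by_cases hrl : (l, l) = r
    · apply heven _ (H.fus_b.sq_mem hy (hrl ▸ hx))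
      rw [H.fa_mul_one, hya, zero_mul]
    · exact H.fus_b.mul_eq_zero hy hx hrl hl0 hl1 hr0 hr1
  -- Such `x` lie in the span of `b₀` and the diagonal `v s`. On it any product with left factor in
  -- the kernel of `fa` vanishes; in particular `b₀² = 0` and the diagonal squares vanish,
  -- contradicting `sum_ψ`.
  have hcore : ∀ x, fa x = 0 → (∀ t ∈ S, t.1 ≠ t.2 → fs t x = 0) →
      ∀ y, y * x = fa y • (b * x) := by
    intro x hxa hxt y
    refine H.axis_b.induction
      (LinearMap.eqLocus (LinearMap.mulRight F x) (fa.smulRight (b * x))) (fun r y hy => ?_) y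
    simp only [LinearMap.mem_eqLocus, LinearMap.mulRight_apply, LinearMap.smulRight_apply]
    by_cases hr1 : r = (1, 1)
    · rw [heig1 y (hr1 ▸ hy), smul_mul_assoc, map_smul, H.fa_b]
      simp
    have hya := H.fa_eq_zero_of_eig hy hr1
    rw [hya, zero_smul]
    by_cases hr : r.1 = r.2
    · have hr' : r = (r.1, r.1) := Prod.ext rfl hr.symm
      by_cases hr0 : r = (0, 0)
      · rw [h0 y (hr0 ▸ hy), zero_mul]
      · rw [hr'] at hy hr0 hr1
        rw [hodd r.1 hr0 hr1 y hy x, hxa, mul_zero, zero_smul]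
    · obtain ⟨-, hy0⟩ := H.coords_of_ne hy hr
      have hyd : ∀ s ∈ S, s.1 = s.2 → fs s y = 0 := by
        intro s hs hd
        have h5 := (H.mem_eig_iff.1 hy).2.2 s hs
        rw [H.fs_b_mul hs, H.fs_mul_b hs, hya, hy0, ← hd, H.q_eq_p hs] at h5
        apply (mul_eq_zero.1 (_ : (r.1 - r.2) * fs s y = 0)).resolve_left (sub_ne_zero.2 hr)
        linear_combination h5.2 - h5.1
      apply H.ext
      · rw [H.fa_mul_one, hya, zero_mul, map_zero]
      · rw [H.f0_mul, hy0, map_zero, Finset.sum_eq_zero fun s hs => by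
          by_cases hd : s.1 = s.2
          · rw [hyd s hs hd, zero_mul, mul_zero]
          · rw [hxt s hs hd, mul_zero, mul_zero]]
        ring
      · intro s hs
        rw [H.fs_mul s hs, hya, hxa, hy0, map_zero]
        by_cases hd : s.1 = s.2
        · rw [hyd s hs hd]; ring
        · rw [(H.dagger_p hs hd).2]; ring
  have hω : ω = 0 := by
    have h := congrArg f0 (hcore b₀ H.fa_b₀ (fun t ht _ => H.fs_b₀ t ht) b₀)
    rw [H.fa_b₀, zero_smul, map_zero, H.f0_mul, H.f0_b₀, Finset.sum_eq_zero fun s hs => by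
      rw [H.fs_b₀ s hs, zero_mul, mul_zero]] at h
    linear_combination h
  have hψ : ∀ s ∈ S, ψ s = 0 := by
    intro s hs
    by_cases hd : s.1 = s.2
    · have h := congrArg f0 (hcore (v s) (H.fa_v s hs) (fun t ht hdt =>
        H.fs_v_ne t ht s hs (by rintro rfl; exact hdt hd)) (v s))
      rw [H.fa_v s hs, zero_smul, map_zero, H.f0_mul, H.f0_v s hs,
        Finset.sum_eq_single s (fun t ht hts => by
          rw [H.fs_v_ne t ht s hs hts, zero_mul, mul_zero]) (fun h => absurd hs h),
        H.fs_v s hs] at h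
      linear_combination h
    · exact (H.sq_dagger hs hd).2
  have h := H.sum_ψ
  rw [Finset.sum_eq_zero hψ, hω, add_zero] at h
  exact zero_ne_one h

/-- The vector with coordinates `2 l p s` at `v s` and `1` at `b₀`. -/
def evenVector (b₀ : A) (S : Finset (F × F)) (v : F × F → A) (p : F × F → F) (l : F) : A :=
  (0 : F) • a + (1 : F) • b₀ + ∑ s ∈ S, (2 * l * p s) • v s

/-- Eigenvectors of `b` for the eigenvalue `1` or `0` (with `l = 1` or `l = -1`) in the kernel of
`fa` are multiples of `evenVector`. -/
theorem evenVector_mem (H : Frame a b b₀ S v 1 ε ω p q φ ψ fa f0 fs) {z : A} {l e : F}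
    (hl : l * l = 1) (he : 2 * e = 1 + l) (hz : z ∈ eig F b (e, e)) (hza : fa z = 0)
    (hz0 : z ≠ 0) : evenVector (a := a) b₀ S v p l ∈ eig F b (e, e) := by
  -- The equation `p y + k / 2 = e k` with `e = (1 + l) / 2` says `l k = 2 p y`, and `l` is its own
  -- inverse.
  have hfs : ∀ s ∈ S, fs s z = f0 z * (2 * l * p s) := by
    intro s hs
    by_cases hd : s.1 = s.2
    · have h := ((H.mem_eig_diag_iff hza
        (fun t ht hd => by rw [H.fs_dagger_of_eig ht hd hz rfl, hza])).1 hz).2 s hs hd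
      have h2 := H.two_ne
      field_simp at h
      linear_combination -l * h - (fs s z) * hl - l * fs s z * he
    · rw [H.fs_dagger_of_eig hs hd hz rfl, hza, (H.dagger_p hs hd).1]; ring
  have hf0 : f0 z ≠ 0 := by
    intro h
    apply hz0
    apply H.ext
    · rw [hza, map_zero]
    · rw [h, map_zero]
    · intro s hs; rw [hfs s hs, h, zero_mul, map_zero]
  have : evenVector (a := a) b₀ S v p l = (f0 z)⁻¹ • z := by
    apply H.ext
    · rw [evenVector, H.fa_comb, map_smul, hza, smul_zero]
    · rw [evenVector, H.f0_comb, map_smul, smul_eq_mul, inv_mul_cancel₀ hf0]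
    · intro s hs
      rw [evenVector, H.fs_comb _ _ (fun s => 2 * l * p s) hs, map_smul, smul_eq_mul, hfs s hs,
        inv_mul_cancel_left₀ hf0]
  rw [this]
  exact Submodule.smul_mem _ _ hz

theorem exists_evenVector (H : Frame a b b₀ S v 1 ε ω p q φ ψ fa f0 fs) :
    evenVector (a := a) b₀ S v p 1 ∈ eig F b (1, 1) ∨
      evenVector (a := a) b₀ S v p (-1) ∈ eig F b (0, 0) := by
  by_contra hcon
  push Not at hcon
  refine H.exists_even (fun x hx hxa => ?_) (fun x hx => ?_)
  · by_contra hx0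
    exact hcon.1 (H.evenVector_mem (by ring) (by ring) hx hxa hx0)
  · by_contra hx0
    exact hcon.2 (H.evenVector_mem (by ring) (by ring) hx
      (H.fa_eq_zero_of_eig hx (by simp)) hx0)

/-- The square of an even `evenVector` is even; by `even_fs` its coordinates satisfy `4 l p² = p G`.
Since `p = 1/2 - μ` on the diagonal, equal values of `p` mean equal labels. -/
theorem p_eq_of_ne_zero (H : Frame a b b₀ S v 1 ε ω p q φ ψ fa f0 fs) :
    ∃ G : F, ∀ s ∈ S, p s ≠ 0 → p s = G := by
  have key : ∀ l e : F, l * l = 1 → evenVector (a := a) b₀ S v p l ∈ eig F b (e, e) →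
      ∃ G : F, ∀ s ∈ S, p s ≠ 0 → p s = G := by
    intro l e hl hz
    set z := evenVector (a := a) b₀ S v p l with hzdef
    have hza : fa z = 0 := H.fa_comb _ _ _
    have hz0 : f0 z = 1 := H.f0_comb _ _ _
    have hzs : ∀ s ∈ S, fs s z = 2 * l * p s := fun s hs =>
      H.fs_comb _ _ (fun s => 2 * l * p s) hs
    obtain ⟨G, hG⟩ := H.even_fs (H.fus_b.sq_mem hz hz) (by rw [H.fa_mul_one, hza, zero_mul])
    refine ⟨l * G / 4, fun s hs hps => ?_⟩
    have h := hG s hs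
    rw [H.fs_mul s hs, hza, hz0, hzs s hs, H.q_eq_p hs] at h
    have h4 : (4 : F) ≠ 0 := by
      have := mul_ne_zero H.two_ne H.two_ne
      norm_num at this
      exact this
    rw [eq_div_iff h4]
    apply mul_left_cancel₀ hps
    linear_combination l * h - 4 * p s * p s * hl
  rcases H.exists_evenVector with h | h
  · exact key 1 1 (by ring) h
  · exact key (-1) 0 (by ring) h

theorem eq_of_p_ne_zero (H : Frame a b b₀ S v 1 ε ω p q φ ψ fa f0 fs) {s t : F × F}
    (hs : s ∈ S) (ht : t ∈ S) (hps : p s ≠ 0) (hpt : p t ≠ 0) : s = t := by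
  obtain ⟨G, hG⟩ := H.p_eq_of_ne_zero
  have hds : s.1 = s.2 := by
    by_contra hd; exact hps (H.dagger_p hs hd).1
  have hdt : t.1 = t.2 := by
    by_contra hd; exact hpt (H.dagger_p ht hd).1
  have h1 : s.1 = t.1 := by
    apply mul_left_cancel₀ H.two_ne
    linear_combination H.diag_p hs hds - H.diag_p ht hdt - 2 * hG s hs hps + 2 * hG t ht hpt
  exact Prod.ext h1 (by rw [← hds, ← hdt, h1])

theorem eq_half_of_p_eq_zero (H : Frame a b b₀ S v 1 ε ω p q φ ψ fa f0 fs) {s : F × F}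
    (hs : s ∈ S) (hd : s.1 = s.2) (hps : p s = 0) : s = (1 / 2, 1 / 2) := by
  have h := H.diag_p hs hd
  have h1 : s.1 = 1 / 2 := by
    rw [eq_div_iff H.two_ne]
    linear_combination h - 2 * hps
  exact Prod.ext h1 (by rw [← hd, h1])

theorem sum_one_of_p_eq_zero (H : Frame a b b₀ S v 1 ε ω p q φ ψ fa f0 fs) {s : F × F}
    (hs : s ∈ S) (hps : p s = 0) : s.1 + s.2 = 1 := by
  by_cases hd : s.1 = s.2
  · linear_combination H.diag_p hs hd - 2 * hps - hd
  · exact H.dagger_sum_one hs hd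

/-- The case where `b₀` annihilates all `v s`. -/
theorem of_p_eq_zero (H : Frame a b b₀ S v 1 ε ω p q φ ψ fa f0 fs) (hp : ∀ s ∈ S, p s = 0) :
    (ω = 1 ∧ ∀ s ∈ S, ψ s = 0) ∨
    (ω = 0 ∧ ((1 / 2, 1 / 2) : F × F) ∈ S ∧ ψ (1 / 2, 1 / 2) = 1) := by
  have hψ : ∀ s ∈ S, s ≠ (1 / 2, 1 / 2) → ψ s = 0 := by
    intro s hs hne
    by_cases hd : s.1 = s.2
    · exact absurd (H.eq_half_of_p_eq_zero hs hd (hp s hs)) hne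
    · exact (H.sq_dagger hs hd).2
  -- Here `evenVector` is just `b₀`, so `ω` is its eigenvalue.
  have hωe : ω = 0 ∨ ω = 1 := by
    have key : ∀ l e : F, evenVector (a := a) b₀ S v p l ∈ eig F b (e, e) → ω = e := by
      intro l e hz
      have hza : fa (evenVector (a := a) b₀ S v p l) = 0 := H.fa_comb _ _ _
      have h := (H.mem_eig_iff.1 hz).2.1.1
      rw [H.f0_b_mul, evenVector, H.f0_comb, Finset.sum_eq_zero fun s hs => by
        rw [H.fs_comb _ _ (fun s => 2 * l * p s) hs, hp s hs, mul_zero, mul_zero]] at h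
      linear_combination h
    rcases H.exists_evenVector with h | h
    · exact Or.inr (key _ _ h)
    · exact Or.inl (key _ _ h)
  have hsum := H.sum_ψ
  by_cases hm : ((1 / 2, 1 / 2) : F × F) ∈ S
  · rw [Finset.sum_eq_single _ (fun s hs hne => hψ s hs hne) (fun h => absurd hm h)] at hsum
    rcases hωe with h | h
    · exact Or.inr ⟨h, hm, by linear_combination hsum - h⟩
    · refine Or.inl ⟨h, fun s hs => ?_⟩
      by_cases hne : s = (1 / 2, 1 / 2)
      · rw [hne]; linear_combination hsum - h
      · exact hψ s hs hne
  · have hψ' : ∀ s ∈ S, ψ s = 0 := fun s hs => hψ s hs (fun h => hm (h ▸ hs))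
    rw [Finset.sum_eq_zero hψ', add_zero] at hsum
    exact Or.inl ⟨hsum, hψ'⟩

/-! ### The plane spanned by `b₀` and the one `v s` with `p ≠ 0` -/

section Plane

/-- Products in the plane spanned by `b₀` and `v s`, where `s` is the only label on which `p`
does not vanish. -/
theorem plane_coords (H : Frame a b b₀ S v 1 ε ω p q φ ψ fa f0 fs) {s : F × F} (hs : s ∈ S)
    (y k : F) : fa (y • b₀ + k • v s) = 0 ∧ f0 (y • b₀ + k • v s) = y ∧
      fs s (y • b₀ + k • v s) = k ∧ ∀ t ∈ S, t ≠ s → fs t (y • b₀ + k • v s) = 0 := by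
  refine ⟨?_, ?_, ?_, fun t ht hts => ?_⟩
  · simp [H.fa_b₀, H.fa_v s hs]
  · simp [H.f0_b₀, H.f0_v s hs]
  · simp [H.fs_b₀ s hs, H.fs_v s hs]
  · simp [H.fs_b₀ t ht, H.fs_v_ne t ht s hs hts]

/-- On this plane both multiplications by `b` have rows `(ω, ψ)` and `(p, 1/2)`, with trace `ω +
1/2`. -/
theorem plane_mem_eig_iff (H : Frame a b b₀ S v 1 ε ω p q φ ψ fa f0 fs) {s : F × F}
    (hs : s ∈ S) (hd : s.1 = s.2) (hp : ∀ t ∈ S, t ≠ s → p t = 0) {y k l : F} :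
    y • b₀ + k • v s ∈ eig F b (l, l) ↔
      ω * y + ψ s * k = l * y ∧ p s * y + 1 / 2 * k = l * k := by
  obtain ⟨h1, h2, h3, h4⟩ := H.plane_coords hs y k
  rw [H.mem_eig_diag_iff h1 (fun t ht hdt => h4 t ht (by rintro rfl; exact hdt hd)), h2,
    Finset.sum_eq_single s (fun t ht hts => by rw [h4 t ht hts, mul_zero])
      (fun h => absurd hs h), h3]
  refine and_congr_right fun _ => ⟨fun h => by have := h s hs hd; rwa [h3] at this,
    fun h t ht hdt => ?_⟩
  by_cases hts : t = s
  · subst hts; rw [h3]; exact h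
  · rw [h4 t ht hts, hp t ht hts]; ring

theorem plane_sq (H : Frame a b b₀ S v 1 ε ω p q φ ψ fa f0 fs) {s : F × F}
    (hs : s ∈ S) (y k : F) : (y • b₀ + k • v s) * (y • b₀ + k • v s) =
      (ω * y ^ 2 + ψ s * k ^ 2) • b₀ + (2 * p s * y * k) • v s := by
  obtain ⟨h1, h2, h3, h4⟩ := H.plane_coords hs y k
  obtain ⟨g1, g2, g3, g4⟩ := H.plane_coords hs (ω * y ^ 2 + ψ s * k ^ 2) (2 * p s * y * k)
  apply H.ext
  · rw [H.fa_mul_one, h1, g1, zero_mul]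
  · rw [H.f0_mul, h2, g2,
      Finset.sum_eq_single s (fun t ht hts => by rw [h4 t ht hts, zero_mul, mul_zero])
      (fun h => absurd hs h), h3]
    ring
  · intro t ht
    rw [H.fs_mul t ht, h1, h2]
    by_cases hts : t = s
    · subst hts; rw [h3, g3, H.q_eq_p ht]; ring
    · rw [h4 t ht hts, g4 t ht hts]; ring

theorem b_mul_plane (H : Frame a b b₀ S v 1 ε ω p q φ ψ fa f0 fs) {s : F × F}
    (hs : s ∈ S) (hd : s.1 = s.2) : b * v s = ψ s • b₀ + (1 / 2 : F) • v s := by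
  obtain ⟨g1, g2, g3, g4⟩ := H.plane_coords hs (ψ s) (1 / 2)
  apply H.ext
  · rw [H.fa_mul_one, H.fa_v s hs, g1, mul_zero]
  · rw [H.f0_b_v hs, g2]
  · intro t ht
    rw [H.fs_b_v hs ht]
    by_cases hts : t = s
    · subst hts
      rw [g3, H.fs_v t ht, eq_div_iff H.two_ne]
      linear_combination (H.diag ht hd).2
    · rw [g4 t ht hts, H.fs_v_ne t ht s hs hts, mul_zero]

omit [IsScalarTower F A A] [SMulCommClass F A A] in
theorem _root_.WeakAxial.evenVector_eq {s : F × F}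
    (hs : s ∈ S) (hp : ∀ t ∈ S, t ≠ s → p t = 0) (l : F) :
    evenVector (a := a) b₀ S v p l = (1 : F) • b₀ + (2 * l * p s) • v s := by
  rw [evenVector, zero_smul, zero_add, Finset.sum_eq_single s (fun t ht hts => by
    rw [hp t ht hts, mul_zero, zero_smul]) (fun h => absurd hs h)]

/-- If `0` is not an eigenvalue of `b` on the kernel of `fa`, the even vectors there are fixed by
`b`. -/
theorem sq_mem_one (H : Frame a b b₀ S v 1 ε ω p q φ ψ fa f0 fs)
    (h0 : evenVector (a := a) b₀ S v p (-1) ∉ eig F b (0, 0)) {z : A}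
    (hz : z ∈ evenPart F b) (hza : fa z = 0) : z ∈ eig F b (1, 1) := by
  obtain ⟨x, hx, y, hy, rfl, -⟩ := H.even_split hz hza
  by_cases hy0 : y = 0
  · rwa [hy0, add_zero]
  · exact absurd (H.evenVector_mem (by ring) (by ring) hy
      (H.fa_eq_zero_of_eig hy (by simp)) hy0) h0

theorem sq_mem_zero (H : Frame a b b₀ S v 1 ε ω p q φ ψ fa f0 fs)
    (h1 : evenVector (a := a) b₀ S v p 1 ∉ eig F b (1, 1)) {z : A}
    (hz : z ∈ evenPart F b) (hza : fa z = 0) : z ∈ eig F b (0, 0) := by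
  obtain ⟨x, hx, y, hy, rfl, hxa⟩ := H.even_split hz hza
  by_cases hx0 : x = 0
  · rwa [hx0, zero_add]
  · exact absurd (H.evenVector_mem (by ring) (by ring) hx hxa hx0) h1

variable {s : F × F}

/-- The square of the eigenvector for `1` lies in `A_1(b)`, which gives `ω (1 - 2 p) = 0`, hence `ω
= 0` because `1 - 2 p = 2 μ`. The other eigenvalue is then `-1/2`, and the square of its eigenvector
cannot lie in `A_1(b)` unless `3 = 0`. -/
theorem false_of_one (H : Frame a b b₀ S v 1 ε ω p q φ ψ fa f0 fs) (hs : s ∈ S)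
    (hd : s.1 = s.2) (hps : p s ≠ 0) (hp : ∀ t ∈ S, t ≠ s → p t = 0)
    (h1 : evenVector (a := a) b₀ S v p 1 ∈ eig F b (1, 1))
    (h0 : evenVector (a := a) b₀ S v p (-1) ∉ eig F b (0, 0)) : False := by
  have h2 := H.two_ne
  have hm := H.diag_p hs hd
  have hμ := H.fst_ne_zero_of_diag hs hd
  rw [evenVector_eq hs hp] at h1
  have hsq := H.sq_mem_one h0 (H.fus_b.sq_mem h1 h1)
    (by rw [H.fa_mul_one, (H.plane_coords hs _ _).1, zero_mul])
  rw [H.plane_sq hs, H.plane_mem_eig_iff hs hd hp] at hsq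
  have e1 := ((H.plane_mem_eig_iff hs hd hp).1 h1).1
  have e2 : 2 * p s = ω + 4 * p s ^ 2 * ψ s := by
    have h := hsq.2
    field_simp at h
    linear_combination -h
  have hω : ω = 0 := by
    have h3 : (2 * s.1) * ω = 0 := by
      linear_combination ω * hm - e2 - 2 * p s * e1
    exact (mul_eq_zero.1 h3).resolve_left (mul_ne_zero h2 hμ)
  have hψ : 2 * p s * ψ s = 1 := by linear_combination e1 - hω
  have hψ0 : ψ s ≠ 0 := by
    intro h
    rw [h, mul_zero] at hψ
    exact zero_ne_one hψ
  have hz : ψ s • b₀ + (-(1 / 2) : F) • v s ∈ eig F b (-(1 / 2), -(1 / 2)) := by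
    rw [H.plane_mem_eig_iff hs hd hp]
    constructor
    · linear_combination ψ s * hω
    · field_simp
      linear_combination 2 * hψ
  have hT : b * v s - v s = ψ s • b₀ + (-(1 / 2) : F) • v s := by
    rw [H.b_mul_plane hs hd]
    have : (-(1 / 2) : F) = 1 / 2 - 1 := by field_simp; ring
    rw [this]
    module
  -- In characteristic 3 the two eigenvalues coincide and `L_b` would have a Jordan block on the
  -- plane.
  by_cases h3 : (-(1 / 2) : F) = 1
  · have h4 := H.axis_b.semisimple (LinearMap.mulLeft F b - (LinearMap.id : A →ₗ[F] A)) 1 0 1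
      (fun x => by simp) (x := v s) (by
        have : (LinearMap.mulLeft F b - (LinearMap.id : A →ₗ[F] A)) (v s) = b * v s - v s := rfl
        rw [this, hT]
        have h5 := (mem_eig.1 hz).1
        simp only [h3, one_smul] at h5
        rw [h3, one_smul]
        exact sub_eq_zero.2 h5)
    have h5 : b * v s - v s = 0 := h4
    rw [hT] at h5
    have h6 := (H.plane_coords hs (ψ s) (-(1 / 2))).2.1
    rw [h5, map_zero] at h6
    exact hψ0 h6.symm
  · have hsq := H.sq_mem_one h0 (H.fus_b.sq_mem hz hz)
      (by rw [H.fa_mul_one, (H.plane_coords hs _ _).1, zero_mul])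
    rw [H.plane_sq hs, H.plane_mem_eig_iff hs hd hp] at hsq
    have h := hsq.2
    rw [hω] at h
    apply h3
    field_simp at h ⊢
    linear_combination -h

/-- The eigenvalues are `0` and `1`, so `ω = 1/2`, `4 p ψ = 1` and `v s` is even for `b`. If no
other square contributes, `sum_ψ` gives `ψ = 1/2`, so `p = 1/2` and `μ = 0`, which is excluded. -/
theorem false_of_both (H : Frame a b b₀ S v 1 ε ω p q φ ψ fa f0 fs) (hs : s ∈ S)
    (hd : s.1 = s.2) (hps : p s ≠ 0) (hp : ∀ t ∈ S, t ≠ s → p t = 0)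
    (h1 : evenVector (a := a) b₀ S v p 1 ∈ eig F b (1, 1))
    (h0 : evenVector (a := a) b₀ S v p (-1) ∈ eig F b (0, 0)) : False := by
  have h2 := H.two_ne
  have hm := H.diag_p hs hd
  have hμ := H.fst_ne_zero_of_diag hs hd
  rw [evenVector_eq hs hp] at h1 h0
  have e1 := ((H.plane_mem_eig_iff hs hd hp).1 h1).1
  have e0 := ((H.plane_mem_eig_iff hs hd hp).1 h0).1
  have hψ : 4 * p s * ψ s = 1 := by linear_combination e1 - e0
  have hψ0 : ψ s ≠ 0 := by
    intro h
    rw [h, mul_zero] at hψ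
    exact zero_ne_one hψ
  have h4 : (4 : F) * p s ≠ 0 := by
    intro h
    rw [h, zero_mul] at hψ
    exact zero_ne_one hψ
  have hv : v s ∈ evenPart F b := by
    have h : (4 * p s) • v s = ((1 : F) • b₀ + (2 * 1 * p s) • v s) -
        ((1 : F) • b₀ + (2 * (-1) * p s) • v s) := by module
    have h' : v s = (4 * p s)⁻¹ • ((4 * p s) • v s) := by
      rw [smul_smul, inv_mul_cancel₀ h4, one_smul]
    rw [h', h]
    exact Submodule.smul_mem _ _ (sub_mem (eig_one_le h1) (eig_zero_le h0))
  have hrest : ∀ t ∈ S, t ≠ s → ψ t = 0 := by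
    intro t ht hts
    by_cases hdt : t.1 = t.2
    -- The combination is chosen so that multiplying by `b` produces no `b₀`; it lies in
    -- `A_{1/2,1/2}(b)`. Its product with the even vector `v s` must stay there but is a multiple of
    -- `b₀`, which is impossible unless `ψ t = 0`.
    · have c1 : fa (ψ s • v t - ψ t • v s) = 0 := by
        simp [H.fa_v t ht, H.fa_v s hs]
      have c0 : f0 (ψ s • v t - ψ t • v s) = 0 := by
        simp [H.f0_v t ht, H.f0_v s hs]
      have ct : fs t (ψ s • v t - ψ t • v s) = ψ s := by
        simp [H.fs_v t ht, H.fs_v_ne t ht s hs hts]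
      have cs : fs s (ψ s • v t - ψ t • v s) = -ψ t := by
        simp [H.fs_v s hs, H.fs_v_ne s hs t ht hts.symm]
      have cu : ∀ u ∈ S, u.1 ≠ u.2 → fs u (ψ s • v t - ψ t • v s) = 0 := by
        intro u hu hdu
        have hut : u ≠ t := by rintro rfl; exact hdu hdt
        have hus : u ≠ s := by rintro rfl; exact hdu hd
        simp [H.fs_v_ne u hu t ht hut, H.fs_v_ne u hu s hs hus]
      have hk : ψ s • v t - ψ t • v s ∈ eig F b (1 / 2, 1 / 2) := by
        rw [H.mem_eig_diag_iff c1 cu, c0]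
        refine ⟨?_, fun u _ _ => by ring⟩
        have : ∀ u ∈ S, ψ u * fs u (ψ s • v t - ψ t • v s) =
            ψ s * (ψ u * fs u (v t)) - ψ t * (ψ u * fs u (v s)) := by
          intro u _
          simp only [map_sub, map_smul, smul_eq_mul]
          ring
        rw [Finset.sum_congr rfl this, Finset.sum_sub_distrib, ← Finset.mul_sum,
          ← Finset.mul_sum, H.sum_v _ ht, H.sum_v _ hs]
        ring
      have hk0 : ψ s • v t - ψ t • v s ≠ 0 := by
        intro h
        rw [h, map_zero] at ct
        exact hψ0 ct.symm
      have hhalf : (1 / 2 : F) ≠ 0 := one_div_ne_zero h2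
      have hhalf1 : (1 / 2 : F) ≠ 1 := by
        intro h
        rw [div_eq_iff h2] at h
        exact one_ne_zero (by linear_combination -h : (1 : F) = 0)
      have hprod := H.fus_b.even_mul _ (mem_pairs hk hk0 (by simp [h2]) (by
        intro h
        exact hhalf1 (congrArg Prod.fst h))) _ hv _ hk
      have d1 : fa (v s * (ψ s • v t - ψ t • v s)) = 0 := by
        rw [H.fa_mul_one, c1, mul_zero]
      have ds : ∀ u ∈ S, fs u (v s * (ψ s • v t - ψ t • v s)) = 0 := by
        intro u hu
        rw [H.fs_mul u hu, c1, c0, H.fa_v s hs, H.f0_v s hs]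
        ring
      have d0 : f0 (v s * (ψ s • v t - ψ t • v s)) = -(ψ s * ψ t) := by
        rw [H.f0_mul, c0, Finset.sum_eq_single s (fun u hu hus => by
          rw [H.fs_v_ne u hu s hs hus, zero_mul, mul_zero]) (fun h => absurd hs h),
          H.fs_v s hs, cs]
        ring
      have h := ((H.mem_eig_diag_iff d1 (fun u hu _ => ds u hu)).1 hprod).2 s hs hd
      rw [d0, ds s hs] at h
      have h' : (p s * ψ s) * ψ t = 0 := by linear_combination -h
      exact (mul_eq_zero.1 h').resolve_left (mul_ne_zero hps hψ0)
    · exact (H.sq_dagger ht hdt).2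
  have hsum := H.sum_ψ
  rw [Finset.sum_eq_single s (fun t ht hts => hrest t ht hts) (fun h => absurd hs h)] at hsum
  have h5 : (4 : F) * s.1 = 0 := by
    linear_combination 2 * hm + 8 * p s * hsum - 4 * p s * (e1 + e0) - 2 * hψ
  have h6 : (4 : F) ≠ 0 := left_ne_zero_of_mul h4
  exact hμ ((mul_eq_zero.1 h5).resolve_left h6)

/-- The square of the null vector `b₀ - 2 p v s` lies in `A_0(b)`, so `2 p = ω (1 + 2 p)` and `(1 +
2 p) ψ = 1`. The square of the eigenvector for the other eigenvalue `ω + 1/2` lies there too, so `4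
ω ψ = -3`. Eliminating `ω` and `ψ` leaves a quadratic in `p` with one admissible root. -/
theorem type_two_scalars (H : Frame a b b₀ S v 1 ε ω p q φ ψ fa f0 fs) (hs : s ∈ S)
    (hd : s.1 = s.2) (hps : p s ≠ 0) (hp : ∀ t ∈ S, t ≠ s → p t = 0)
    (h1 : evenVector (a := a) b₀ S v p 1 ∉ eig F b (1, 1))
    (h0 : evenVector (a := a) b₀ S v p (-1) ∈ eig F b (0, 0)) :
    s = (2, 2) ∧ p s = -(3 / 2) ∧ ω = 3 / 2 ∧ ψ s = -(1 / 2) ∧ ∀ t ∈ S, t ≠ s → ψ t = 0 := by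
  have h2 := H.two_ne
  have hm := H.diag_p hs hd
  have hμ := H.fst_ne_one_of_diag hs hd
  rw [evenVector_eq hs hp] at h0
  have hsq := H.sq_mem_zero h1 (H.fus_b.sq_mem h0 h0)
    (by rw [H.fa_mul_one, (H.plane_coords hs _ _).1, zero_mul])
  rw [H.plane_sq hs, H.plane_mem_eig_iff hs hd hp] at hsq
  have e0 : ω = 2 * p s * ψ s := by
    linear_combination ((H.plane_mem_eig_iff hs hd hp).1 h0).1
  have e1 : 2 * p s = ω * (1 + 2 * p s) := by
    have h := hsq.2
    field_simp at h
    linear_combination -h - 2 * p s * e0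
  have hne : 1 + 2 * p s ≠ 0 := by
    intro h
    have h3 : 2 * (s.1 - 1) = 0 := by linear_combination hm - h
    exact hμ (sub_eq_zero.1 ((mul_eq_zero.1 h3).resolve_left h2))
  have hψ : (1 + 2 * p s) * ψ s = 1 := by
    apply mul_left_cancel₀ (mul_ne_zero h2 hps)
    linear_combination -e1 - (1 + 2 * p s) * e0
  have hψ0 : ψ s ≠ 0 := right_ne_zero_of_mul (hψ.trans_ne one_ne_zero)
  have hrest : ∀ t ∈ S, t ≠ s → ψ t = 0 := by
    classical
    have hsum := H.sum_ψ
    rw [← Finset.add_sum_erase S ψ hs] at hsum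
    have hz : ∑ t ∈ S.erase s, ψ t = 0 := by
      apply mul_left_cancel₀ hne
      linear_combination (1 + 2 * p s) * hsum + e1 - hψ
    intro t ht hts
    by_cases hdt : t.1 = t.2
    · rwa [Finset.sum_eq_single t (fun u hu hut => ?_)
        (fun h => absurd (Finset.mem_erase.2 ⟨hts, ht⟩) h)] at hz
      obtain ⟨hus, hu⟩ := Finset.mem_erase.1 hu
      by_cases hdu : u.1 = u.2
      · exact absurd ((H.eq_half_of_p_eq_zero hu hdu (hp u hu hus)).trans
          (H.eq_half_of_p_eq_zero ht hdt (hp t ht hts)).symm) hut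
      · exact (H.sq_dagger hu hdu).2
    · exact (H.sq_dagger ht hdt).2
  have hz : ψ s • b₀ + (1 / 2 : F) • v s ∈ eig F b (ω + 1 / 2, ω + 1 / 2) := by
    rw [H.plane_mem_eig_iff hs hd hp]
    constructor
    · ring
    · field_simp
      linear_combination -2 * e0
  -- Otherwise `L_b` would be nilpotent and nonzero on the plane. This also rules out the root `1 +
  -- 6 p = 0` below.
  have hl0 : ω + 1 / 2 ≠ 0 := by
    intro h
    rw [h] at hz
    have h4 := H.axis_b.semisimple (LinearMap.mulLeft F b) 1 0 0
      (fun x => by simp) (x := v s) (by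
        rw [LinearMap.mulLeft_apply, LinearMap.mulLeft_apply, H.b_mul_plane hs hd,
          (mem_eig.1 hz).1, zero_smul])
    rw [LinearMap.mulLeft_apply, H.b_mul_plane hs hd] at h4
    have h6 := (H.plane_coords hs (ψ s) (1 / 2)).2.1
    rw [h4, map_zero] at h6
    exact hψ0 h6.symm
  have hsq := H.sq_mem_zero h1 (H.fus_b.sq_mem hz hz)
    (by rw [H.fa_mul_one, (H.plane_coords hs _ _).1, zero_mul])
  rw [H.plane_sq hs, H.plane_mem_eig_iff hs hd hp] at hsq
  have e2 : 4 * (ω * ψ s) = -3 := by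
    have h := hsq.2
    field_simp at h
    linear_combination h
  have e3 : (3 + 2 * p s) * (1 + 6 * p s) = 0 := by
    linear_combination (1 + 2 * p s) ^ 2 * e2 - 4 * ω * (1 + 2 * p s) * hψ + 4 * e1
  have hpe : 3 + 2 * p s = 0 := by
    refine (mul_eq_zero.1 e3).resolve_right fun h => hl0 ?_
    have h3 : 2 * ω + 1 = 0 := by
      linear_combination (-3 : F) * e1 + (-ω + 1) * h
    field_simp
    linear_combination h3
  have hpv : p s = -(3 / 2) := by field_simp; linear_combination hpe
  have hs1 : s.1 = 2 := by
    apply mul_left_cancel₀ h2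
    linear_combination hm - hpe
  refine ⟨Prod.ext hs1 (by rw [← hd, hs1]), hpv, ?_, ?_, hrest⟩
  · field_simp
    linear_combination ω * hpe - hpe + e1
  · field_simp
    linear_combination ψ s * hpe - hψ

/-- The three possibilities when the `a`-coefficient of `b` is `1`. -/
theorem trichotomy (H : Frame a b b₀ S v 1 ε ω p q φ ψ fa f0 fs) :
    ((∀ s ∈ S, p s = 0) ∧ ω = 1 ∧ ∀ s ∈ S, ψ s = 0) ∨
    ((∀ s ∈ S, p s = 0) ∧ ω = 0 ∧ ((1 / 2, 1 / 2) : F × F) ∈ S ∧ ψ (1 / 2, 1 / 2) = 1) ∨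
    ((3 : F) ≠ 0 ∧ ((2, 2) : F × F) ∈ S ∧ ω = 3 / 2 ∧ p (2, 2) = -(3 / 2) ∧
      ψ (2, 2) = -(1 / 2) ∧ ∀ s ∈ S, s ≠ (2, 2) → p s = 0 ∧ ψ s = 0) := by
  by_cases hp : ∀ s ∈ S, p s = 0
  · rcases H.of_p_eq_zero hp with h | h
    · exact Or.inl ⟨hp, h⟩
    · exact Or.inr (Or.inl ⟨hp, h⟩)
  · push Not at hp
    obtain ⟨s, hs, hps⟩ := hp
    have hp : ∀ t ∈ S, t ≠ s → p t = 0 := by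
      intro t ht hts
      by_contra h
      exact hts (H.eq_of_p_ne_zero ht hs h hps)
    have hd : s.1 = s.2 := by
      by_contra hd; exact hps (H.dagger_p hs hd).1
    by_cases h1 : evenVector (a := a) b₀ S v p 1 ∈ eig F b (1, 1)
    · by_cases h0 : evenVector (a := a) b₀ S v p (-1) ∈ eig F b (0, 0)
      · exact (H.false_of_both hs hd hps hp h1 h0).elim
      · exact (H.false_of_one hs hd hps hp h1 h0).elim
    · have h0 := H.exists_evenVector.resolve_left h1
      obtain ⟨rfl, h3, h4, h5, h6⟩ := H.type_two_scalars hs hd hps hp h1 h0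
      -- In characteristic 3 the value `-(3/2)` would be `0`, against `p ≠ 0`.
      refine Or.inr (Or.inr ⟨fun h => hps ?_, hs, h4, h3, h5, fun t ht hts =>
        ⟨hp t ht hts, h6 t ht hts⟩⟩)
      rw [h3, h]
      simp

end Plane

end Frame

end FrameTheory

/-! ### Multiplication tables, and the decomposition of `a` along `b` -/

section Final

variable {F : Type*} {A : Type*} [Field F] [NonUnitalNonAssocRing A] [Module F A]
  [IsScalarTower F A A] [SMulCommClass F A A]
  {a b b₀ : A} {S : Finset (F × F)} {v : F × F → A} {α ε ω : F}
  {p q φ ψ : F × F → F} {fa f0 : A →ₗ[F] F} {fs : F × F → A →ₗ[F] F}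

namespace Frame

theorem b₀_mul_b₀ (H : Frame a b b₀ S v α ε ω p q φ ψ fa f0 fs) :
    b₀ * b₀ = ε • a + ω • b₀ := by
  apply H.ext
  · rw [H.fa_mul, H.fa_b₀, H.f0_b₀, Finset.sum_eq_zero fun s hs => by
      rw [H.fs_b₀ s hs, mul_zero, mul_zero]]
    simp [H.fa_a, H.fa_b₀]
  · rw [H.f0_mul, H.f0_b₀, Finset.sum_eq_zero fun s hs => by
      rw [H.fs_b₀ s hs, mul_zero, mul_zero]]
    simp [H.f0_a, H.f0_b₀]
  · intro s hs
    simp [H.fs_mul s hs, H.fs_b₀ s hs, H.fs_a s hs]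

theorem b₀_mul_v (H : Frame a b b₀ S v α ε ω p q φ ψ fa f0 fs) {s : F × F} (hs : s ∈ S) :
    b₀ * v s = p s • v s := by
  apply H.ext
  · rw [H.fa_mul, H.fa_b₀, H.f0_v s hs, Finset.sum_eq_zero fun t ht => by
      rw [H.fs_b₀ t ht, zero_mul, mul_zero]]
    simp [H.fa_v s hs]
  · rw [H.f0_mul, H.f0_v s hs, Finset.sum_eq_zero fun t ht => by
      rw [H.fs_b₀ t ht, zero_mul, mul_zero]]
    simp [H.f0_v s hs]
  · intro t ht
    rw [H.fs_mul t ht, H.fs_b₀ t ht, H.fa_b₀, H.f0_b₀, map_smul, smul_eq_mul]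
    by_cases hts : t = s
    · subst hts; ring
    · rw [H.fs_v_ne t ht s hs hts]; ring

theorem v_mul_b₀ (H : Frame a b b₀ S v α ε ω p q φ ψ fa f0 fs) {s : F × F} (hs : s ∈ S) :
    v s * b₀ = q s • v s := by
  apply H.ext
  · rw [H.fa_mul, H.fa_b₀, H.f0_v s hs, Finset.sum_eq_zero fun t ht => by
      rw [H.fs_b₀ t ht, mul_zero, mul_zero]]
    simp [H.fa_v s hs]
  · rw [H.f0_mul, H.f0_v s hs, Finset.sum_eq_zero fun t ht => by
      rw [H.fs_b₀ t ht, mul_zero, mul_zero]]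
    simp [H.f0_v s hs]
  · intro t ht
    rw [H.fs_mul t ht, H.fs_b₀ t ht, H.fa_b₀, H.f0_b₀, map_smul, smul_eq_mul]
    by_cases hts : t = s
    · subst hts; ring
    · rw [H.fs_v_ne t ht s hs hts]; ring

theorem v_sq (H : Frame a b b₀ S v α ε ω p q φ ψ fa f0 fs) {s : F × F} (hs : s ∈ S) :
    v s * v s = φ s • a + ψ s • b₀ := by
  apply H.ext
  · rw [H.fa_mul, H.fa_v s hs, H.f0_v s hs, Finset.sum_eq_single s (fun t ht hts => by
      rw [H.fs_v_ne t ht s hs hts, mul_zero, mul_zero]) (fun h => absurd hs h), H.fs_v s hs]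
    simp [H.fa_a, H.fa_b₀]
  · rw [H.f0_mul, H.f0_v s hs, Finset.sum_eq_single s (fun t ht hts => by
      rw [H.fs_v_ne t ht s hs hts, mul_zero, mul_zero]) (fun h => absurd hs h), H.fs_v s hs]
    simp [H.f0_a, H.f0_b₀]
  · intro t ht
    simp [H.fs_mul t ht, H.fa_v s hs, H.f0_v s hs, H.fs_a t ht, H.fs_b₀ t ht]

theorem basis (H : Frame a b b₀ S v α ε ω p q φ ψ fa f0 fs) :
    IsBasisOf F (Sum.elim ![a, b₀] (fun s : S => v s)) :=
  isBasisOf_sum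
    (fun x y k hk =>
      ⟨by rw [← H.fa_comb x y k, hk, map_zero], by rw [← H.f0_comb x y k, hk, map_zero],
        fun s hs => by rw [← H.fs_comb x y k hs, hk, map_zero]⟩)
    (fun z => ⟨fa z, f0 z, fun s => fs s z, H.expand z⟩)

theorem isTable {h : A} (H : Frame a b b₀ S v 1 ε ω p q φ ψ fa f0 fs)
    (K : IsSplit a b S 1 h v) (hb₀ : b₀ ∈ eig F a (0, 0)) : IsTable a b S b₀ v where
  basis := H.basis
  dagger := H.exists_dagger
  b_eq := by simpa using H.b_eq
  a_mul_a := K.axis_a.idem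
  a_mul_b₀ := by simpa using (mem_eig.1 hb₀).1
  b₀_mul_a := by simpa using (mem_eig.1 hb₀).2
  a_mul := fun s hs => K.a_mul hs
  mul_a := fun s hs => K.mul_a hs
  mul_of_ne := fun s hs t ht hst => K.v_mul_of_ne hs ht hst

theorem isTwoDimOne {h : A} (H : Frame a b b₀ S v 1 ε ω p q φ ψ fa f0 fs)
    (K : IsSplit a b S 1 h v) (hb₀ : b₀ ∈ eig F a (0, 0)) (hp : ∀ s ∈ S, p s = 0) (hω : ω = 1)
    (hψ : ∀ s ∈ S, ψ s = 0) : IsTwoDimOne a b S b₀ v where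
  toIsTable := H.isTable K hb₀
  sum_one := fun s hs => H.sum_one_of_p_eq_zero hs (hp s hs)
  b₀_mul_b₀ := by rw [H.b₀_mul_b₀, H.eps_eq_zero, hω]; simp
  b₀_mul := fun s hs => by rw [H.b₀_mul_v hs, hp s hs, zero_smul]
  mul_b₀ := fun s hs => by rw [H.v_mul_b₀ hs, H.q_eq_p hs, hp s hs, zero_smul]
  sq := fun s hs => by rw [H.v_sq hs, H.phi_eq_zero hs, hψ s hs]; simp

theorem isTypeHalf {h : A} (H : Frame a b b₀ S v 1 ε ω p q φ ψ fa f0 fs)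
    (K : IsSplit a b S 1 h v) (hb₀ : b₀ ∈ eig F a (0, 0)) (hp : ∀ s ∈ S, p s = 0) (hω : ω = 0)
    (hm : ((1 / 2, 1 / 2) : F × F) ∈ S) (hψ : ψ (1 / 2, 1 / 2) = 1) :
    IsTypeHalf a b S b₀ v where
  toIsTable := H.isTable K hb₀
  half_mem := hm
  sum_one := fun s hs => H.sum_one_of_p_eq_zero hs (hp s hs)
  b₀_mul_b₀ := by rw [H.b₀_mul_b₀, H.eps_eq_zero, hω]; simp
  b₀_mul := fun s hs => by rw [H.b₀_mul_v hs, hp s hs, zero_smul]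
  mul_b₀ := fun s hs => by rw [H.v_mul_b₀ hs, H.q_eq_p hs, hp s hs, zero_smul]
  half_sq := by rw [H.v_sq hm, H.phi_eq_zero hm, hψ]; simp
  sq := fun s hs hd => by rw [H.v_sq hs, (H.sq_dagger hs hd).1, (H.sq_dagger hs hd).2]; simp

theorem isTypeTwo {h : A} (H : Frame a b b₀ S v 1 ε ω p q φ ψ fa f0 fs)
    (K : IsSplit a b S 1 h v) (hb₀ : b₀ ∈ eig F a (0, 0)) (hω : ω = 3 / 2)
    (hm : ((2, 2) : F × F) ∈ S) (hp2 : p (2, 2) = -(3 / 2)) (hψ2 : ψ (2, 2) = -(1 / 2))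
    (hpψ : ∀ s ∈ S, s ≠ (2, 2) → p s = 0 ∧ ψ s = 0) : IsTypeTwo a b S b₀ v where
  toIsTable := H.isTable K hb₀
  two_mem := hm
  sum_one := fun s hs hne => H.sum_one_of_p_eq_zero hs (hpψ s hs hne).1
  b₀_mul_b₀ := by rw [H.b₀_mul_b₀, H.eps_eq_zero, hω]; simp
  b₀_mul_two := by rw [H.b₀_mul_v hm, hp2]
  two_mul_b₀ := by rw [H.v_mul_b₀ hm, H.q_eq_p hm, hp2]
  two_sq := by rw [H.v_sq hm, H.phi_eq_zero hm, hψ2]; simp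
  b₀_mul := fun s hs hne => by rw [H.b₀_mul_v hs, (hpψ s hs hne).1, zero_smul]
  mul_b₀ := fun s hs hne => by
    rw [H.v_mul_b₀ hs, H.q_eq_p hs, (hpψ s hs hne).1, zero_smul]
  sq := fun s hs hne => by rw [H.v_sq hs, H.phi_eq_zero hs, (hpψ s hs hne).2]; simp

theorem finrank_eig_one (H : Frame a b b₀ S v 1 ε ω p q φ ψ fa f0 fs)
    (hp : ∀ s ∈ S, p s = 0) (hω : ω = 1) : Module.finrank F (eig F b (1, 1)) = 2 := by
  have hb₀ : b₀ ∈ eig F b (1, 1) := by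
    rw [H.mem_eig_diag_iff H.fa_b₀ (fun t ht _ => H.fs_b₀ t ht), H.f0_b₀, hω,
      Finset.sum_eq_zero fun s hs => by rw [H.fs_b₀ s hs, mul_zero]]
    refine ⟨by ring, fun s hs _ => ?_⟩
    rw [hp s hs, H.fs_b₀ s hs]; ring
  have heq : eig F b (1, 1) = Submodule.span F (Set.range ![b, b₀]) := by
    apply le_antisymm
    · intro x hx
      have hxe : x = fa x • b + (f0 x - fa x) • b₀ := by
        apply H.ext
        · simp [H.fa_b, H.fa_b₀]
        · simp [H.f0_b, H.f0_b₀]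
        · intro s hs
          simp only [map_add, map_smul, H.fs_b hs, H.fs_b₀ s hs, smul_eq_mul, mul_one, mul_zero,
            add_zero]
          by_cases hd : s.1 = s.2
          · have h := ((H.mem_eig_iff.1 hx).2.2 s hs).1
            rw [H.fs_b_mul hs, H.q_eq_p hs, hp s hs] at h
            have h1 := H.diag_p hs hd
            rw [hp s hs] at h1
            linear_combination -2 * h + (fs s x + fa x) * h1 - 2 * fa x * hd
          · exact H.fs_dagger_of_eig hs hd hx rfl
      rw [hxe]
      refine add_mem (Submodule.smul_mem _ _ (Submodule.subset_span ⟨0, rfl⟩))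
        (Submodule.smul_mem _ _ (Submodule.subset_span ⟨1, rfl⟩))
    · rw [Submodule.span_le]
      rintro _ ⟨i, rfl⟩
      fin_cases i
      · exact H.axis_b.mem_eig
      · exact hb₀
  have hli : LinearIndependent F ![b, b₀] := by
    rw [LinearIndependent.pair_iff]
    intro x y hxy
    have h1 := congrArg fa hxy
    have h2 := congrArg f0 hxy
    simp [H.fa_b, H.fa_b₀] at h1
    simp [H.f0_b₀, h1] at h2
    exact ⟨h1, h2⟩
  rw [heq, finrank_span_eq_card hli]
  simp

theorem isExceptional {h : A} (H : Frame a b b₀ S v 0 ε ω p q φ ψ fa f0 fs)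
    (K : IsSplit a b S 0 h v) :
    IsExceptional a b S v ∧ ∀ s ∈ S, v s ∈ eig F b (s.2, s.1) := by
  have hv : ∀ s ∈ S, v s ∈ eig F b (s.2, s.1) := by
    intro s hs
    have h1 := H.v_mem_eig hs (H.sq_eq_zero zero_ne_one hs).1 (H.sq_eq_zero zero_ne_one hs).2
    rwa [(H.exceptional_sum_one hs).2.1, (H.exceptional_sum_one hs).2.2, zero_mul, zero_mul,
      zero_add, zero_add] at h1
  refine ⟨?_, hv⟩
  exact
    { sum_one := fun s hs => (H.exceptional_sum_one hs).1
      basis := isBasisOf_sum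
        (fun x y k hk => by
          have h1 := congrArg fa hk
          have h0 := congrArg f0 hk
          simp only [map_add, map_smul, map_sum, H.fa_a, H.fa_b, map_zero] at h1
          rw [Finset.sum_eq_zero fun s hs => by rw [H.fa_v s hs, smul_zero]] at h1
          simp only [map_add, map_smul, map_sum, H.f0_a, H.f0_b, map_zero] at h0
          rw [Finset.sum_eq_zero fun s hs => by rw [H.f0_v s hs, smul_zero]] at h0
          have hx : x = 0 := by simpa using h1
          have hy : y = 0 := by simpa using h0
          refine ⟨hx, hy, fun s hs => ?_⟩
          rw [← H.fs_comb 0 0 k hs]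
          rw [hx, hy] at hk
          simpa using congrArg (fs s) hk)
        (fun z => ⟨fa z, f0 z, fun s => fs s z - f0 z, by
          rw [H.b_eq, zero_smul, zero_add]
          simp only [sub_smul, Finset.sum_sub_distrib, ← Finset.smul_sum, smul_add]
          conv_lhs => rw [H.expand z]
          abel⟩)
      a_mul_a := K.axis_a.idem
      b_mul_b := K.axis_b.idem
      a_mul_b := by rw [K.a_mul_b, zero_smul, zero_add]
      b_mul_a := by rw [K.b_mul_a, zero_smul, zero_add]
      a_mul := fun s hs => K.a_mul hs
      mul_b := fun s hs => (mem_eig.1 (hv s hs)).2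
      mul_a := fun s hs => K.mul_a hs
      b_mul := fun s hs => (mem_eig.1 (hv s hs)).1
      mul := fun s hs t ht => by
        by_cases hst : s = t
        · subst hst
          rw [H.v_sq hs, (H.sq_eq_zero zero_ne_one hs).1, (H.sq_eq_zero zero_ne_one hs).2]
          simp
        · exact K.v_mul_of_ne hs ht hst }

/-- The finer data in the exceptional case. -/
theorem exists_finer_exceptional {h : A} (H : Frame a b b₀ S v 0 ε ω p q φ ψ fa f0 fs)
    (K : IsSplit a b S 0 h v) (hb₀ : b₀ ∈ eig F a (0, 0)) :
    WeaklyPrimitive F b ∧ ∃ (T : Finset (F × F)) (β : F) (a₀ : A) (w : F × F → A),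
      IsDecomposition F b a T β a₀ w ∧ FinerData F a b S 0 b₀ v β w := by
  obtain ⟨hexc, hv⟩ := H.isExceptional K
  have hσ : ∀ s ∈ S, s.1 + s.2 = 1 := hexc.sum_one
  set z := a - ∑ s ∈ S, (s.1 + s.2) • v s with hz
  have hz0 : z ∈ eig F b (0, 0) := H.exceptional_zero_mem
  have hza : z = a - ∑ s ∈ S, v s := by
    rw [hz]
    congr 1
    exact Finset.sum_congr rfl fun s hs => by rw [hσ s hs, one_smul]
  -- In the exceptional algebra `b` acts on the `v s` with the two eigenvalues interchanged, so the
  -- labels of `b` are the swapped ones; `a = z + ∑ v s` then shows `β = 0`.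
  let T : Finset (F × F) := S.map (Equiv.prodComm F F).toEmbedding
  have hT : ∀ r, r ∈ T ↔ r.swap ∈ S := by
    intro r
    simp only [T, Finset.mem_map, Equiv.coe_toEmbedding, Equiv.prodComm_apply]
    constructor
    · rintro ⟨s, hs, rfl⟩; simpa using hs
    · intro hr; exact ⟨r.swap, hr, by simp⟩
  have hsumT : ∀ f : F × F → A, ∑ r ∈ T, f r = ∑ s ∈ S, f s.swap := by
    intro f
    simp [T, Finset.sum_map]
  have hw : ∀ r ∈ T, v r.swap ∈ eig F b r := fun r hr => hv r.swap ((hT r).1 hr)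
  have hT0 : ∀ r ∈ T, r ≠ (0, 0) := by
    rintro r hr rfl
    exact H.ne_zero _ ((hT _).1 hr) rfl
  have hT1 : ∀ r ∈ T, r ≠ (1, 1) := by
    rintro r hr rfl
    exact H.ne_one _ ((hT _).1 hr) rfl
  have hspan : ∀ x, ∃ (c d : F) (k : F × F → F), x = c • b + d • z + ∑ r ∈ T, k r • v r.swap := by
    intro x
    refine ⟨f0 x, fa x, fun r => fs r.swap x - f0 x + fa x, ?_⟩
    rw [hsumT, hza, H.b_eq, zero_smul, zero_add]
    simp only [Prod.swap_swap, sub_smul, add_smul, Finset.sum_sub_distrib,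
      Finset.sum_add_distrib, ← Finset.smul_sum, smul_add, smul_sub]
    conv_lhs => rw [H.expand x]
    abel
  obtain ⟨h1, h0, -, -⟩ := eig_of_span H.axis_b H.axis_b.mem_eig hz0 hw hT0 hT1 hspan
  have hspanA : ∀ x, ∃ (c d : F) (k : F × F → F), x = c • a + d • b₀ + ∑ r ∈ S, k r • v r :=
    fun x => ⟨fa x, f0 x, fun s => fs s x, H.expand x⟩
  obtain ⟨-, -, hA, hA'⟩ := eig_of_span K.axis_a K.axis_a.mem_eig hb₀ K.mem H.ne_zero H.ne_one
    hspanA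
  have hpairs := pairsO_of_span K.axis_a K.axis_a.mem_eig hb₀ K.mem K.ne H.ne_zero H.ne_one
    hspanA
  refine ⟨h1, T, 0, z, fun r => v r.swap, ?_, ?_⟩
  · exact
      { index := pairsO_of_span H.axis_b H.axis_b.mem_eig hz0 hw
          (fun r hr => K.ne _ ((hT r).1 hr)) hT0 hT1 hspan
        zero_part := hz0
        part := hw
        off := fun r hr => K.off _ fun h => hr ((hT r).2 h)
        eq_sum := by rw [hsumT, hza]; simp }
  · have hhalf : (0 : F) ≠ 1 / 2 := (one_div_ne_zero H.two_ne).symm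
    have hhalf1 : (1 / 2 : F) ≠ 1 := by
      intro h
      rw [div_eq_iff H.two_ne] at h
      exact one_ne_zero (by linear_combination -h : (1 : F) = 0)
    exact
      { dim_one := finrank_eig_of_span H.axis_b H.axis_b.mem_eig hz0 hw hT0 hT1 hspan
        α_ne_half := hhalf
        β_ne_half := hhalf
        sq := fun s hs => hexc.mul s (by rw [← Finset.mem_coe, hpairs]; exact hs.1) s
          (by rw [← Finset.mem_coe, hpairs]; exact hs.1)
        sum_one := fun s hs => hσ s (by rw [← Finset.mem_coe, hpairs]; exact hs.1)
        zero_eig := fun h => absurd rfl h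
        β_ne_one := fun _ => by
          refine ⟨fun s hs hd => ?_, ?_, rfl, h0, fun s hs => ⟨hexc.b_mul s hs, hexc.mul_b s hs⟩,
            hexc⟩
          · have h2 := hσ s (by rw [← Finset.mem_coe, hpairs]; exact hs)
            have h3 : s.1 = 1 / 2 := by
              rw [eq_div_iff H.two_ne]; linear_combination h2 + hd
            exact Prod.ext h3 (by rw [← hd, h3])
          · by_cases hm : ((1 / 2, 1 / 2) : F × F) ∈ S
            · exact Or.inr ⟨hA _ hm, hexc.mul _ hm _ hm⟩
            · refine Or.inl (hA' _ hm (fun h => hhalf (congrArg Prod.fst h).symm) fun h =>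
                hhalf1 (congrArg Prod.fst h))
        β_eq_one := fun h => absurd h zero_ne_one }

/-- The finer data when the `a`-coefficient of `b` is `1`. -/
theorem exists_finer_one {h : A} (H : Frame a b b₀ S v 1 ε ω p q φ ψ fa f0 fs)
    (K : IsSplit a b S 1 h v) (hb₀ : b₀ ∈ eig F a (0, 0)) {s : F × F} (hs : s ∈ S)
    (hd : s.1 = s.2) {c l : F} (hc : s.1 + s.2 - 1 = c) (hcl : 1 - c * l ≠ 0)
    (hp : ∀ t ∈ S, t ≠ s → p t = 0) (hψ : ∀ t ∈ S, t ≠ s → ψ t = 0)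
    (hz : b₀ + c • v s ∈ eig F b (0, 0)) (he : l • b₀ + v s ∈ eig F b s)
    (htype : IsTypeTwo a b S b₀ v ∨ IsTypeHalf a b S b₀ v) :
    WeaklyPrimitive F b ∧ ∃ (T : Finset (F × F)) (β : F) (a₀ : A) (w : F × F → A),
      IsDecomposition F b a T β a₀ w ∧ FinerData F a b S 1 b₀ v β w := by
  classical
  have hσ : ∀ t ∈ S, t ≠ s → t.1 + t.2 = 1 := fun t ht hts =>
    H.sum_one_of_p_eq_zero ht (hp t ht hts)
  -- An eigenbasis of `b`, together with `b` and `b₀ + c • v s`: only the vector at `s` needs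
  -- correcting by a multiple of `b₀`.
  let e : F × F → A := fun t => if t = s then l • b₀ + v s else v t
  have hes : e s = l • b₀ + v s := if_pos rfl
  have het : ∀ t, t ≠ s → e t = v t := fun t hts => if_neg hts
  have hee : ∀ t ∈ S, e t ∈ eig F b t := by
    intro t ht
    by_cases hts : t = s
    · rw [hts, hes]; exact he
    · rw [het t hts]
      have h1 := H.v_mem_eig ht (H.phi_eq_zero ht) (hψ t ht hts)
      rw [H.q_eq_p ht, hp t ht hts] at h1
      simpa using h1
  have hene : ∀ t ∈ S, e t ≠ 0 := by
    intro t ht h0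
    by_cases hts : t = s
    · rw [hts, hes] at h0
      have h1 := congrArg (fs s) h0
      simp [H.fs_b₀ s hs, H.fs_v s hs] at h1
    · rw [het t hts] at h0
      exact K.ne t ht h0
  have hsplit : ∀ k : F × F → F, ∑ t ∈ S, k t • e t = ∑ t ∈ S, k t • v t + (k s * l) • b₀ := by
    intro k
    rw [← Finset.add_sum_erase S _ hs, ← Finset.add_sum_erase S (fun t => k t • v t) hs,
      Finset.sum_congr rfl fun t ht => by rw [het t (Finset.ne_of_mem_erase ht)], hes]
    module
  have hsingle : ∀ (k : F × F → F) (x : F), ∑ t ∈ S, (k t + if t = s then x else 0) • v t =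
      ∑ t ∈ S, k t • v t + x • v s := by
    intro k x
    simp only [add_smul, Finset.sum_add_distrib, ite_smul, zero_smul, Finset.sum_ite_eq', hs,
      if_true]
  have hspan : ∀ x, ∃ (y d : F) (k : F × F → F),
      x = y • b + d • (b₀ + c • v s) + ∑ t ∈ S, k t • e t := by
    intro x
    set m := f0 x - fa x with hm
    set n := fs s x - fa x with hn
    -- After removing `fa x • b`, the coordinates at `b₀` and `v s` give a 2 × 2 system of
    -- determinant `1 - c l`.
    refine ⟨fa x, (m - l * n) / (1 - c * l),
      fun t => (fs t x - fa x) + if t = s then -c * ((m - l * n) / (1 - c * l)) else 0, ?_⟩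
    rw [hsplit, hsingle, if_pos rfl, H.b_eq]
    have hd' : (1 - c * l) * ((m - l * n) / (1 - c * l)) = m - l * n := mul_div_cancel₀ _ hcl
    set d := (m - l * n) / (1 - c * l)
    have h0 : f0 x = fa x + d + (n + -c * d) * l := by
      linear_combination -hd' - hm
    conv_lhs => rw [H.expand x, h0]
    simp only [sub_smul, Finset.sum_sub_distrib, ← Finset.smul_sum]
    module
  have hdec : a = (1 : F) • b + (-((1 - l) / (1 - c * l))) • (b₀ + c • v s) +
      ∑ t ∈ S, (-1 + if t = s then c * ((1 - l) / (1 - c * l)) else 0) • e t := by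
    rw [hsplit, hsingle, if_pos rfl, H.b_eq]
    have hd' : (1 - c * l) * ((1 - l) / (1 - c * l)) = 1 - l := mul_div_cancel₀ _ hcl
    set d := (1 - l) / (1 - c * l)
    have h0 : (0 : F) = 1 - d + (-1 + c * d) * l := by linear_combination hd'
    have h1 : (0 : A) = (1 - d + (-1 + c * d) * l) • b₀ := by rw [← h0, zero_smul]
    conv_lhs => rw [← add_zero a, h1]
    simp only [neg_smul, one_smul, Finset.sum_neg_distrib]
    module
  obtain ⟨h1, h0, -, -⟩ := eig_of_span H.axis_b H.axis_b.mem_eig hz hee H.ne_zero H.ne_one hspan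
  have hpairs := pairsO_of_span K.axis_a K.axis_a.mem_eig hb₀ K.mem K.ne H.ne_zero H.ne_one
    fun x => ⟨fa x, f0 x, fun s => fs s x, H.expand x⟩
  have hhalf : (1 : F) ≠ 1 / 2 := by
    intro h
    rw [eq_div_iff H.two_ne] at h
    exact one_ne_zero (by linear_combination h : (1 : F) = 0)
  refine ⟨h1, S, 1, (-((1 - l) / (1 - c * l))) • (b₀ + c • v s),
    fun t => (-1 + if t = s then c * ((1 - l) / (1 - c * l)) else 0) • e t, ?_, ?_⟩
  · exact
      { index := pairsO_of_span H.axis_b H.axis_b.mem_eig hz hee hene H.ne_zero H.ne_one hspan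
        zero_part := Submodule.smul_mem _ _ hz
        part := fun t ht => Submodule.smul_mem _ _ (hee t ht)
        off := fun t ht => by
          rw [het t (ne_of_mem_of_not_mem hs ht).symm, K.off t ht, smul_zero]
        eq_sum := hdec }
  · exact
      { dim_one := finrank_eig_of_span H.axis_b H.axis_b.mem_eig hz hee H.ne_zero H.ne_one hspan
        α_ne_half := hhalf
        β_ne_half := hhalf
        sq := fun t ht => by
          have ht' : t ∈ S := by rw [← Finset.mem_coe, hpairs]; exact ht.1
          rw [H.v_sq ht', (H.sq_dagger ht' ht.2).1, (H.sq_dagger ht' ht.2).2]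
          simp
        sum_one := fun t ht => H.dagger_sum_one
          (by rw [← Finset.mem_coe, hpairs]; exact ht.1) ht.2
        zero_eig := fun _ => by
          rw [h0]
          congr 2
          -- For `α = 1` the coefficient is `t.1 + t.2 - 1`, which vanishes except at `s`.
          have e1 : ∑ t ∈ S with t.1 = t.2, ((t.1 + t.2) * (2 * 1 - 1) / 1 - 1 : F) • v t =
              c • v s := by
            rw [Finset.sum_eq_single s]
            · rw [← hc]; congr 1; ring
            · intro t ht hts
              rw [hσ t (Finset.mem_filter.1 ht).1 hts]
              norm_num
            · exact fun hn => absurd (Finset.mem_filter.2 ⟨hs, hd⟩) hn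
          have e2 : ∑ t ∈ S with t.1 ≠ t.2, ((1 - 1) / 1 : F) • v t = 0 :=
            Finset.sum_eq_zero fun t _ => by simp
          rw [e2]
          refine Eq.trans ?_ (congrArg (fun x => ((1 - 1 : F) ^ 2 / 1) • a + b₀ + x + 0) e1.symm)
          simp
        β_ne_one := fun h => absurd rfl h
        β_eq_one := fun _ => ⟨rfl, htype⟩ }

end Frame

/-- For `a = 0` the whole algebra is `A_0(a)`, of dimension at most one, hence commutative. -/
theorem ne_zero_of_not_comm {a : A} (ha0 : Module.rank F (eig F a (0, 0)) ≤ 1)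
    (hnc : ∃ x y : A, x * y ≠ y * x) : a ≠ 0 := by
  rintro rfl
  obtain ⟨z, hz⟩ := (rank_submodule_le_one_iff' _).1 ha0
  obtain ⟨x, y, hxy⟩ := hnc
  have hmem : ∀ x : A, ∃ c : F, c • z = x := fun x =>
    Submodule.mem_span_singleton.1 (hz (mem_eig.2 (by simp)))
  obtain ⟨c, rfl⟩ := hmem x
  obtain ⟨d, rfl⟩ := hmem y
  apply hxy
  rw [smul_mul_assoc, mul_smul_comm, smul_mul_assoc, mul_smul_comm, smul_comm]

end Final

end WeakAxial

end

/-! ### The classification -/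

theorem theoremA {F : Type*} {A : Type*} [Field F] [NonUnitalNonAssocRing A] [Module F A]
    [IsScalarTower F A A] [SMulCommClass F A A] (hchar : (2 : F) ≠ 0) (a b : A)
    (hgen : NonUnitalAlgebra.adjoin F ({a, b} : Set A) = ⊤)
    (ha : WeakAxial.IsAxis F a) (hap : WeakAxial.WeaklyPrimitive F a)
    (haf : WeakAxial.FusionRules F a)
    (ha0 : Module.rank F (WeakAxial.eig F a (0, 0)) ≤ 1)
    (hb : WeakAxial.IsAxis F b) (hbf : WeakAxial.FusionRules F b)
    (hnc : ∃ x y : A, x * y ≠ y * x) :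
    ∃ (S : Finset (F × F)) (α : F) (b₀ : A) (v : F × F → A),
      WeakAxial.IsDecomposition F a b S α b₀ v ∧
      ((WeakAxial.eig F a (0, 0) = ⊥ ∧ WeakAxial.IsNull a b S v) ∨
       (Module.finrank F (WeakAxial.eig F a (0, 0)) = 1 ∧
        ((Module.finrank F (WeakAxial.eig F b (1, 1)) = 2 ∧
            WeakAxial.IsTwoDimOne a b S b₀ v) ∨
         (WeakAxial.WeaklyPrimitive F b ∧
            (WeakAxial.IsExceptional a b S v ∨ WeakAxial.IsTypeTwo a b S b₀ v ∨
              WeakAxial.IsTypeHalf a b S b₀ v) ∧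
            ∃ (T : Finset (F × F)) (β : F) (a₀ : A) (w : F × F → A),
              WeakAxial.IsDecomposition F b a T β a₀ w ∧
              WeakAxial.FinerData F a b S α b₀ v β w)))) := by
  have hane := WeakAxial.ne_zero_of_not_comm ha0 hnc
  obtain ⟨S, α, b₀, v, hb₀, H⟩ := WeakAxial.exists_isSplit ha hap haf ha0 hb
  by_cases hb₀0 : b₀ = 0
  · subst hb₀0
    rw [add_zero] at H
    obtain ⟨h1, h2, rfl, h3⟩ := H.isNull hgen hnc hane
    exact ⟨S, 1, 0, v, ⟨h2, hb₀, H.mem, H.off, by simpa using H.eq_sum⟩, Or.inl ⟨h1, h3⟩⟩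
  · obtain ⟨ε, ω, p, q, φ, ψ, fa, f0, fs, K⟩ :=
      H.exists_frame hchar hb₀ hb₀0 hap ha0 hbf hgen hnc hane
    have hspan : ∀ x, ∃ (c d : F) (k : F × F → F), x = c • a + d • b₀ + ∑ s ∈ S, k s • v s :=
      fun x => ⟨fa x, f0 x, fun s => fs s x, K.expand x⟩
    have hdec : WeakAxial.IsDecomposition F a b S α b₀ v :=
      ⟨WeakAxial.pairsO_of_span ha ha.mem_eig hb₀ H.mem H.ne H.ne_zero H.ne_one hspan, hb₀,
        H.mem, H.off, H.eq_sum⟩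
    have hfin : Module.finrank F (WeakAxial.eig F a (0, 0)) = 1 := by
      rw [(WeakAxial.eig_of_span ha ha.mem_eig hb₀ H.mem H.ne_zero H.ne_one hspan).2.1]
      exact finrank_span_singleton hb₀0
    refine ⟨S, α, b₀, v, hdec, Or.inr ⟨hfin, ?_⟩⟩
    by_cases hα : α = 1
    · subst hα
      rcases K.trichotomy with ⟨hp, hω, hψ⟩ | ⟨hp, hω, hm, hψ⟩ | ⟨h3, hm, hω, hp2, hψ2, hpψ⟩
      · exact Or.inl ⟨K.finrank_eig_one hp hω, K.isTwoDimOne H hb₀ hp hω hψ⟩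
      · have htype := K.isTypeHalf H hb₀ hp hω hm hψ
        have hψ0 : ∀ t ∈ S, t ≠ (1 / 2, 1 / 2) → ψ t = 0 := by
          intro t ht hne
          by_cases hd : t.1 = t.2
          · exact absurd (K.eq_half_of_p_eq_zero ht hd (hp t ht)) hne
          · exact (K.sq_dagger ht hd).2
        -- The rows are `(0, 1)` and `(0, 1/2)`: `b₀` spans the kernel and `2 b₀ + v s` belongs to
        -- `1/2`.
        obtain ⟨h1, h2⟩ := K.exists_finer_one H hb₀ hm rfl (c := 0) (l := 2)
          (by have := htype.sum_one _ hm; linear_combination this) (by simp)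
          (fun t ht _ => hp t ht) hψ0
          (by
            have h := (K.plane_mem_eig_iff hm rfl (fun t ht _ => hp t ht)
              (y := 1) (k := 0) (l := 0)).2 ⟨by rw [hω]; ring, by rw [hp _ hm]; ring⟩
            simpa using h)
          (by
            have h := (K.plane_mem_eig_iff hm rfl (fun t ht _ => hp t ht)
              (y := 2) (k := 1) (l := 1 / 2)).2
              ⟨by rw [hω, hψ]; field_simp; ring, by rw [hp _ hm]; ring⟩
            simpa using h)
          (Or.inr htype)
        exact Or.inr ⟨h1, Or.inr (Or.inr htype), h2⟩
      · have htype := K.isTypeTwo H hb₀ hω hm hp2 hψ2 hpψ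
        have h4 : (4 : F) ≠ 0 := by
          have := mul_ne_zero hchar hchar
          norm_num at this
          exact this
        -- The rows are `(3/2, -1/2)` and `(-3/2, 1/2)`: `b₀ + 3 v s` spans the kernel and `-b₀ + v
        -- s` belongs to `2`.
        obtain ⟨h1, h2⟩ := K.exists_finer_one H hb₀ hm rfl (c := 3) (l := -1)
          (by norm_num) (by norm_num; exact h4)
          (fun t ht hne => (hpψ t ht hne).1) (fun t ht hne => (hpψ t ht hne).2)
          (by
            have h := (K.plane_mem_eig_iff hm rfl (fun t ht hne => (hpψ t ht hne).1)
              (y := 1) (k := 3) (l := 0)).2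
              ⟨by rw [hω, hψ2]; ring, by rw [hp2]; ring⟩
            simpa using h)
          (by
            have h := (K.plane_mem_eig_iff hm rfl (fun t ht hne => (hpψ t ht hne).1)
              (y := -1) (k := 1) (l := 2)).2
              ⟨by rw [hω, hψ2]; field_simp; ring, by rw [hp2]; field_simp; ring⟩
            simpa using h)
          (Or.inl htype)
        exact Or.inr ⟨h1, Or.inr (Or.inl htype), h2⟩
    · obtain rfl := K.alpha_eq_zero hα
      obtain ⟨h1, h2⟩ := K.exists_finer_exceptional H hb₀
      exact Or.inr ⟨h1, Or.inl (K.isExceptional H).1, h2⟩
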